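/- Let $\mathsf{fab}$ be the category of finitely generated free abelian groups. For a functor $F:\mathsf{fab}\to\mathsf{fab}$ with $F(0)=0$ for zero morphisms, and for $A=A_1\oplus\dots\oplus A_m$ with the idempotents $e_1,\dots,e_m$ of $A$ that belong to the summands, define endomorphisms $f(S)$ of $F(A)$ recursively by $f(S)=F\big(\sum_{k\in S}e_k\big)-\sum_{T\subsetneq S}f(T)$ for $S\subseteq\{1,\dots,m\}$. The $m$-th cross-effect is $F_m(A_1|\dots|A_m)=\operatorname{im} f(\{1,\dots,m\})$, a direct summand of $F(A)$. A *torsion free cubic module* is such a functor $F$ with $F_m=0$ for all $m>3$. Put $F_m=F_m(\mathbb Z|\dots|\mathbb Z)$. Let $h^m_k:F_m\to F_{m+1}$ be the composition of the inclusion $F_m\to F(\mathbb Z^m)$, of $F(\mathbb Z^m\to\mathbb Z^{m+1})$ for the map which is the diagonal $\mathbb Z\to\mathbb Z\oplus\mathbb Z$ on the $k$-th summand and the identity on the others, and of the projection $F(\mathbb Z^{m+1})\to F_{m+1}$. Let $p^m_k:F_{m+1}\to F_m$ be defined in the same way by means of the summation map $\mathbb Z\oplus\mathbb Z\to\mathbb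 Z$ on the summands $k$ and $k+1$. With $h=h^1_1$, $p=p^1_1$, $h_i=h^2_i$, $p_i=p^2_i$ $(i=1,2)$ one gets from $F$ the diagram $$D(F):\qquad F_1\ \overset{h}{\underset{p}{\rightleftarrows}}\ F_2\ \overset{h_1,h_2}{\underset{p_1,p_2}{\rightleftarrows}}\ F_3 .$$ Let $\mathbf A$ be the pre-additive category with three objects $1,2,3$ and generating morphisms $h:1\to2$, $p:2\to1$, $h_i:2\to3$, $p_i:3\to2$ $(i=1,2)$, subject to the relations $$\begin{aligned} & h_1p_2=h_2p_1=0,\quad h_1h=h_2h=:\bar h,\quad pp_1=pp_2=:\bar p,\quad h_ip_ih_i=2h_i,\quad p_ih_ip_i=2p_i\ (i=1,2),\\ & hph=2(h+(p_1+p_2)\bar h),\quad php=2(p+\bar p(h_1+h_2)),\\ & \bar hp+h_1+h_2=h_1p_1h_2p_2h_1+h_2p_2h_1p_1h_2,\quad h\bar p+p_1+p_2=p_1h_2p_2h_1p_1+p_2h_1p_1h_2p_2 . \end{aligned}$$ For a prime $p$ let $\mathbb Z_{(p)}$ be the localization of $\mathbb Z$ at $p$ and $\mathbf A_{(p)}=\mathbb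 Z_{(p)}\otimes\mathbf A$. An $\mathbf A_{(p)}$-module is a linear functor from $\mathbf A$ to $\mathbb Z_{(p)}$-modules, i.e. a diagram of $\mathbb Z_{(p)}$-modules of the above shape that satisfies the above relations; it is *torsion free* if its three components are finitely generated torsion free $\mathbb Z_{(p)}$-modules. For a torsion free cubic module $F$ put $F_{(p)}=\mathbb Z_{(p)}\otimes D(F)$. Two torsion free cubic modules $F,G$ *belong to the same genus* if $F_{(p)}\simeq G_{(p)}$ for every prime $p$. **Proposition.** The map $F\mapsto(F_{(2)},F_{(3)})$ induces a bijection from the isomorphism classes of torsion free cubic modules onto the pairs $(M_2,M_3)$ of isomorphism classes of torsion free $\mathbf A_{(p)}$-modules $M_p$ $(p=2,3)$ such that $\mathbb Q\otimes M_2\simeq\mathbb Q\otimes M_3$. That is: 1. For every torsion free cubic module $F$, $F_{(2)}$ and $F_{(3)}$ are torsion free modules over $\mathbf A_{(2)}$ and $\mathbf A_{(3)}$ respectively, and $\mathbb Q\otimes F_{(2)}\simeq\mathbb Q\otimes F_{(3)}$. 2. Torsion free cubic modules $F,G$ are isomorphic if and only if $F_{(2)}\simeq G_{(2)}$ and $F_{(3)}\simeq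 G_{(3)}$. 3. For all torsion free $\mathbf A_{(p)}$-modules $M_p$ $(p=2,3)$ with $\mathbb Q\otimes M_2\simeq\mathbb Q\otimes M_3$ there is a torsion free cubic module $F$ with $F_{(2)}\simeq M_2$ and $F_{(3)}\simeq M_3$. Moreover, two torsion free cubic modules belong to the same genus if and only if they are isomorphic, so every genus contains exactly one isomorphism class. -/

import Mathlib

open CategoryTheory TensorProduct

noncomputable section

/-- The property of an abelian group of being finitely generated and free. -/
def isFreeAb : ObjectProperty AddCommGrpCat.{0} :=
  fun M => Module.Finite ℤ M ∧ Module.Free ℤ M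

/-- The category of finitely generated free abelian groups. -/
abbrev FreeAb : Type 1 := isFreeAb.FullSubcategory

namespace FreeAb

/-- The morphism of `FreeAb` given by a homomorphism of groups. -/
def ofHom {X Y : FreeAb} (f : X.obj →+ Y.obj) : X ⟶ Y :=
  ObjectProperty.homMk (AddCommGrpCat.ofHom f)

instance finite (X : FreeAb) : Module.Finite ℤ X.obj := X.property.1

instance free (X : FreeAb) : Module.Free ℤ X.obj := X.property.2

/-- The group `ℤ`. -/
def int : FreeAb :=
  ⟨AddCommGrpCat.of ℤ, ⟨inferInstanceAs (Module.Finite ℤ ℤ), inferInstanceAs (Module.Free ℤ ℤ)⟩⟩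

/-- The direct sum of a finite family of finitely generated free abelian groups. -/
def sum {m : ℕ} (A : Fin m → FreeAb) : FreeAb :=
  ⟨AddCommGrpCat.of (∀ i, (A i).obj),
    ⟨inferInstanceAs (Module.Finite ℤ (∀ i, (A i).obj)),
      inferInstanceAs (Module.Free ℤ (∀ i, (A i).obj))⟩⟩

/-- The idempotent `e_S = ∑_{i ∈ S} e_i` of the direct sum of the `A i`: the identity on the
summands with index in `S` and zero on the others. -/
def idem {m : ℕ} (A : Fin m → FreeAb) (S : Finset (Fin m)) : sum A ⟶ sum A :=
  ofHom (X := sum A) (Y := sum A)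
    (show (∀ i, (A i).obj) →+ (∀ i, (A i).obj) from
      { toFun := fun x i => if i ∈ S then x i else 0
        map_zero' := by
          funext i
          simp
        map_add' := fun x y => by
          funext i
          by_cases h : i ∈ S <;> simp [h] })

/-- The group `ℤ ^ m`. -/
abbrev pow (m : ℕ) : FreeAb := sum fun _ : Fin m => int

/-- `ℤ ^ m → ℤ ^ (m + 1)`: the diagonal `ℤ → ℤ ⊕ ℤ` on the `k`-th summand, the identity on the
other ones. -/
def diag {m : ℕ} (k : Fin m) : pow m ⟶ pow (m + 1) :=
  ofHom (X := pow m) (Y := pow (m + 1))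
    (show (Fin m → ℤ) →+ (Fin (m + 1) → ℤ) from
      { toFun := fun x i => x (k.predAbove i)
        map_zero' := rfl
        map_add' := fun _ _ => rfl })

/-- `ℤ ^ (m + 1) → ℤ ^ m`: the sum `ℤ ⊕ ℤ → ℤ` on the `k`-th and the next summand, the identity on
the other ones. -/
def codiag {m : ℕ} (k : Fin m) : pow (m + 1) ⟶ pow m :=
  ofHom (X := pow (m + 1)) (Y := pow m)
    (show (Fin (m + 1) → ℤ) →+ (Fin m → ℤ) from
      { toFun := fun y j => ∑ i with k.predAbove i = j, y i
        map_zero' := by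
          funext j
          simp
        map_add' := fun x y => by
          funext j
          simp [Finset.sum_add_distrib] })

end FreeAb

/-! ### Cross-effects of a functor `FreeAb ⥤ FreeAb` -/

/-- The homomorphism of groups underlying `F(f)`. -/
def mapHom (F : FreeAb ⥤ FreeAb) {X Y : FreeAb} (f : X ⟶ Y) :
    (F.obj X).obj →+ (F.obj Y).obj :=
  (F.map f).hom.hom

/-- The deviation `f(S)` of `F` on `⨁ A_i`: the alternating sum
`∑_{T ⊆ S} (-1) ^ (|S| - |T|) F(e_T)`. By `sum_deviation` it is the solution of the recursion
`f(S) = F(e_S) - ∑_{T ⊊ S} f(T)`. -/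
def deviation (F : FreeAb ⥤ FreeAb) {m : ℕ} (A : Fin m → FreeAb) (S : Finset (Fin m)) :
    (F.obj (FreeAb.sum A)).obj →+ (F.obj (FreeAb.sum A)).obj :=
  ∑ T ∈ S.powerset, (-1 : ℤ) ^ (S.card - T.card) • mapHom F (FreeAb.idem A T)

theorem sum_deviation (F : FreeAb ⥤ FreeAb) {m : ℕ} (A : Fin m → FreeAb) (S : Finset (Fin m)) :
    ∑ T ∈ S.powerset, deviation F A T = mapHom F (FreeAb.idem A S) := by
  classical
  have key : ∀ U ∈ S.powerset, (∑ T ∈ S.powerset with U ⊆ T, (-1 : ℤ) ^ (T.card - U.card)) =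
      if U = S then 1 else 0 := by
    intro U hU
    have hU' : U ⊆ S := Finset.mem_powerset.1 hU
    have h1 : (∑ T ∈ S.powerset with U ⊆ T, (-1 : ℤ) ^ (T.card - U.card)) =
        ∑ T ∈ (S \ U).powerset, (-1 : ℤ) ^ T.card := by
      refine Finset.sum_bij' (fun T _ => T \ U) (fun T _ => T ∪ U) ?_ ?_ ?_ ?_ ?_
      · intro T hT
        simp only [Finset.mem_filter, Finset.mem_powerset] at hT ⊢
        exact Finset.sdiff_subset_sdiff hT.1 (Finset.Subset.refl _)
      · intro T hT
        simp only [Finset.mem_filter, Finset.mem_powerset] at hT ⊢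
        exact ⟨Finset.union_subset (hT.trans Finset.sdiff_subset) hU', Finset.subset_union_right⟩
      · intro T hT
        simp only [Finset.mem_filter] at hT
        exact Finset.sdiff_union_of_subset hT.2
      · intro T hT
        simp only [Finset.mem_powerset] at hT
        have : Disjoint T U := Finset.disjoint_of_subset_left hT Finset.sdiff_disjoint
        rw [Finset.union_sdiff_right, Finset.sdiff_eq_self_of_disjoint this]
      · intro T hT
        simp only [Finset.mem_filter] at hT
        rw [Finset.card_sdiff_of_subset hT.2]
    rw [h1, Finset.sum_powerset_neg_one_pow_card]
    refine if_congr ?_ rfl rfl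
    rw [Finset.sdiff_eq_empty_iff_subset]
    exact ⟨fun h => Finset.Subset.antisymm hU' h, fun h => h ▸ Finset.Subset.refl _⟩
  unfold deviation
  rw [Finset.sum_comm' (t' := S.powerset) (s' := fun U => S.powerset.filter (U ⊆ ·))]
  · simp_rw [← Finset.sum_smul]
    rw [Finset.sum_congr rfl fun U hU => by rw [key U hU]]
    simp
  · intro T U
    simp only [Finset.mem_filter, Finset.mem_powerset]
    exact ⟨fun h => ⟨h, h.2.trans h.1⟩, fun h => h.1⟩

/-- The `m`-th cross-effect `F_m(A_1|…|A_m)`, the image of `f(1 2 … m)` in `F(A_1 ⊕ … ⊕ A_m)`. -/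
def crossEffect (F : FreeAb ⥤ FreeAb) {m : ℕ} (A : Fin m → FreeAb) :
    AddSubgroup (F.obj (FreeAb.sum A)).obj :=
  (deviation F A Finset.univ).range

/-- `F_m = F_m(ℤ|…|ℤ)`. -/
abbrev crossZ (F : FreeAb ⥤ FreeAb) (m : ℕ) : AddSubgroup (F.obj (FreeAb.pow m)).obj :=
  crossEffect F fun _ : Fin m => FreeAb.int

/-- The projection of `F(ℤ ^ m)` onto its direct summand `F_m`. -/
def crossProj (F : FreeAb ⥤ FreeAb) (m : ℕ) : (F.obj (FreeAb.pow m)).obj →+ crossZ F m :=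
  (deviation F (fun _ : Fin m => FreeAb.int) Finset.univ).rangeRestrict

/-- `h^m_k : F_m → F_{m+1}`. -/
def crossH (F : FreeAb ⥤ FreeAb) {m : ℕ} (k : Fin m) : crossZ F m →+ crossZ F (m + 1) :=
  (crossProj F (m + 1)).comp ((mapHom F (FreeAb.diag k)).comp (crossZ F m).subtype)

/-- `p^m_k : F_{m+1} → F_m`. -/
def crossP (F : FreeAb ⥤ FreeAb) {m : ℕ} (k : Fin m) : crossZ F (m + 1) →+ crossZ F m :=
  (crossProj F m).comp ((mapHom F (FreeAb.codiag k)).comp (crossZ F (m + 1)).subtype)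

/-- A torsion free cubic module: a functor `FreeAb ⥤ FreeAb` that maps zero morphisms to zero
morphisms and is polynomial of degree at most `3`. -/
structure TorsionFreeCubicModule where
  /-- the functor -/
  F : FreeAb ⥤ FreeAb
  map_zero : ∀ X Y : FreeAb, F.map (0 : X ⟶ Y) = 0
  crossEffect_eq_bot : ∀ m : ℕ, 3 < m → ∀ A : Fin m → FreeAb, crossEffect F A = ⊥

/-! ### Modules over the category `𝐀` and its scalar extensions -/

/-- A representation over `R` of the quiver with the vertices `1, 2, 3` and the arrows
`h : 1 → 2`, `p : 2 → 1`, `h₁, h₂ : 2 → 3`, `p₁, p₂ : 3 → 2`. -/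
structure CubicDiagram (R : Type) [CommRing R] where
  V₁ : ModuleCat.{0} R
  V₂ : ModuleCat.{0} R
  V₃ : ModuleCat.{0} R
  h : V₁ →ₗ[R] V₂
  p : V₂ →ₗ[R] V₁
  h₁ : V₂ →ₗ[R] V₃
  h₂ : V₂ →ₗ[R] V₃
  p₁ : V₃ →ₗ[R] V₂
  p₂ : V₃ →ₗ[R] V₂

namespace CubicDiagram

variable {R : Type} [CommRing R]

/-- The defining relations of the pre-additive category `𝐀`. A diagram that satisfies them is the
same as a linear functor from `𝐀` to `R`-modules, i.e. a module over `𝐀 ⊗ R`. -/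
structure IsAModule (D : CubicDiagram R) : Prop where
  h₁_p₂ : D.h₁ ∘ₗ D.p₂ = 0
  h₂_p₁ : D.h₂ ∘ₗ D.p₁ = 0
  h₁_h : D.h₁ ∘ₗ D.h = D.h₂ ∘ₗ D.h
  p_p₁ : D.p ∘ₗ D.p₁ = D.p ∘ₗ D.p₂
  h₁_p₁_h₁ : D.h₁ ∘ₗ D.p₁ ∘ₗ D.h₁ = (2 : R) • D.h₁
  h₂_p₂_h₂ : D.h₂ ∘ₗ D.p₂ ∘ₗ D.h₂ = (2 : R) • D.h₂
  p₁_h₁_p₁ : D.p₁ ∘ₗ D.h₁ ∘ₗ D.p₁ = (2 : R) • D.p₁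
  p₂_h₂_p₂ : D.p₂ ∘ₗ D.h₂ ∘ₗ D.p₂ = (2 : R) • D.p₂
  h_p_h : D.h ∘ₗ D.p ∘ₗ D.h = (2 : R) • (D.h + (D.p₁ + D.p₂) ∘ₗ D.h₁ ∘ₗ D.h)
  p_h_p : D.p ∘ₗ D.h ∘ₗ D.p = (2 : R) • (D.p + D.p ∘ₗ D.p₁ ∘ₗ (D.h₁ + D.h₂))
  h₁_h_p : D.h₁ ∘ₗ D.h ∘ₗ D.p + D.h₁ + D.h₂ =
    D.h₁ ∘ₗ D.p₁ ∘ₗ D.h₂ ∘ₗ D.p₂ ∘ₗ D.h₁ + D.h₂ ∘ₗ D.p₂ ∘ₗ D.h₁ ∘ₗ D.p₁ ∘ₗ D.h₂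
  h_p_p₁ : D.h ∘ₗ D.p ∘ₗ D.p₁ + D.p₁ + D.p₂ =
    D.p₁ ∘ₗ D.h₂ ∘ₗ D.p₂ ∘ₗ D.h₁ ∘ₗ D.p₁ + D.p₂ ∘ₗ D.h₁ ∘ₗ D.p₁ ∘ₗ D.h₂ ∘ₗ D.p₂

/-- A torsion free `𝐀 ⊗ R`-module: one whose three components are finitely generated torsion free
`R`-modules. -/
structure IsTorsionFreeAModule (D : CubicDiagram R) : Prop where
  isAModule : D.IsAModule
  finite₁ : Module.Finite R D.V₁
  finite₂ : Module.Finite R D.V₂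
  finite₃ : Module.Finite R D.V₃
  torsionFree₁ : Module.IsTorsionFree R D.V₁
  torsionFree₂ : Module.IsTorsionFree R D.V₂
  torsionFree₃ : Module.IsTorsionFree R D.V₃

/-- Isomorphism of diagrams. -/
def Isomorphic (D E : CubicDiagram R) : Prop :=
  ∃ (e₁ : D.V₁ ≃ₗ[R] E.V₁) (e₂ : D.V₂ ≃ₗ[R] E.V₂) (e₃ : D.V₃ ≃ₗ[R] E.V₃),
    (∀ x, e₂ (D.h x) = E.h (e₁ x)) ∧ (∀ x, e₁ (D.p x) = E.p (e₂ x)) ∧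
    (∀ x, e₃ (D.h₁ x) = E.h₁ (e₂ x)) ∧ (∀ x, e₃ (D.h₂ x) = E.h₂ (e₂ x)) ∧
    (∀ x, e₂ (D.p₁ x) = E.p₁ (e₃ x)) ∧ (∀ x, e₂ (D.p₂ x) = E.p₂ (e₃ x))

/-- The map `S ⊗ f` for a linear map `f`, the tensor products being taken over `ℤ`. -/
def tensorMap (S : Type) [CommRing S] {V W : Type} [AddCommGroup V] [AddCommGroup W]
    [Module R V] [Module R W] (f : V →ₗ[R] W) : S ⊗[ℤ] V →ₗ[S] S ⊗[ℤ] W :=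
  f.toAddMonoidHom.toIntLinearMap.baseChange S

/-- The diagram `S ⊗ D` of `S`-modules, the tensor products being taken over `ℤ`. -/
def tensor (S : Type) [CommRing S] (D : CubicDiagram R) : CubicDiagram S where
  V₁ := ModuleCat.of S (S ⊗[ℤ] D.V₁)
  V₂ := ModuleCat.of S (S ⊗[ℤ] D.V₂)
  V₃ := ModuleCat.of S (S ⊗[ℤ] D.V₃)
  h := tensorMap S D.h
  p := tensorMap S D.p
  h₁ := tensorMap S D.h₁
  h₂ := tensorMap S D.h₂
  p₁ := tensorMap S D.p₁
  p₂ := tensorMap S D.p₂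

end CubicDiagram

instance isPrime_span_natCast (p : ℕ) [hp : Fact p.Prime] : (Ideal.span {(p : ℤ)}).IsPrime :=
  (Ideal.span_singleton_prime (Int.natCast_ne_zero.2 hp.out.ne_zero)).2
    (Nat.prime_iff_prime_int.1 hp.out)

/-- The local ring `ℤ_(p)`. -/
abbrev ZLoc (p : ℕ) [Fact p.Prime] : Type := Localization.AtPrime (Ideal.span {(p : ℤ)})

namespace TorsionFreeCubicModule

/-- The diagram `F_1 ⇄ F_2 ⇄ F_3` of a cubic module. -/
def diagram (M : TorsionFreeCubicModule) : CubicDiagram ℤ where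
  V₁ := ModuleCat.of ℤ (crossZ M.F 1)
  V₂ := ModuleCat.of ℤ (crossZ M.F 2)
  V₃ := ModuleCat.of ℤ (crossZ M.F 3)
  h := (crossH M.F (0 : Fin 1)).toIntLinearMap
  p := (crossP M.F (0 : Fin 1)).toIntLinearMap
  h₁ := (crossH M.F (0 : Fin 2)).toIntLinearMap
  h₂ := (crossH M.F (1 : Fin 2)).toIntLinearMap
  p₁ := (crossP M.F (0 : Fin 2)).toIntLinearMap
  p₂ := (crossP M.F (1 : Fin 2)).toIntLinearMap

/-- The localization `M_(p) = ℤ_(p) ⊗ M`. -/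
def localization (M : TorsionFreeCubicModule) (p : ℕ) [Fact p.Prime] : CubicDiagram (ZLoc p) :=
  M.diagram.tensor (ZLoc p)

/-- Isomorphism of cubic modules: natural isomorphism of functors. -/
def Isomorphic (M N : TorsionFreeCubicModule) : Prop := Nonempty (M.F ≅ N.F)

/-- Two torsion free cubic modules belong to the same genus if their localizations at every prime
are isomorphic. -/
def SameGenus (M N : TorsionFreeCubicModule) : Prop :=
  ∀ (p : ℕ) [Fact p.Prime], (M.localization p).Isomorphic (N.localization p)

end TorsionFreeCubicModule

end

/-! The argument separates into a statement about lattices with an action of `𝐀` and the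
correspondence between cubic functors and such lattices.

Lattices. Over `ℚ` a module over `𝐀` splits into isotypic parts of six kinds, one for each Schur
functor of degree 1, 2 or 3. For a torsion free module `D` they are recorded by six saturated
sublattices: `isoLin` in `V₁`, `isoAlt` and `isoSym` in `V₂`, `isoSym₃`, `isoAlt₃` and `isoStd` in
`V₃`. A morphism is determined by its restrictions to them (`Hom.eq_zero_of_iso`). Conversely, any
homomorphism between corresponding sublattices extends to a morphism that kills the other five, once
it is multiplied by 4 in the two bilinear cases and by 6 in the other four (the lemmas
`exists_hom_iso…`). So a morphism may be altered on each sublattice separately by any multiple of 4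
or 6.

Let `α` be invertible modulo 12. On each sublattice the Smith normal form of `α` has entries that
are units modulo 12, that is, congruent to ±1 or ±5. As 5 is 1 modulo 4 and -1 modulo 6, these
entries are congruent to ±1 modulo 4 and also modulo 6, though not modulo 12. Hence `α` is congruent
to an isomorphism of the sublattices modulo 4 or 6, whichever is needed, and can be corrected to an
isomorphism (`isomorphic_of_hom_mod_twelve`). Isomorphisms over `ℤ_(2)` and `ℤ_(3)` yield such an
`α` by clearing denominators and by the Chinese remainder theorem (`isomorphic_of_zLoc`). This is
why a genus has only one class.

Gluing. Inside one rational module, the lattices over `ℤ_(2)` and `ℤ_(3)` contain a common finitely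
generated stable subgroup that spans both (`exists_tensor_isomorphic`). The essential points are
that every nonzero integer is an odd number times a number prime to 3, and that the relations of `𝐀`
bound the words in its generators (`exists_isStable`).

Functors. Homomorphisms between the groups `ℤ ^ n` that come from spans of finite sets act on
cross-effects by a sum over those subsets of the apex that have at most three elements and map onto
both ends (`dev_univ_act_span`). This gives the relations of `𝐀`. It also shows that subgroups of
the cross-effects that are stable under `h`, `p`, `h₁`, `h₂`, `p₁`, `p₂` are stable under spans,
and, since `F` has degree at most 3, under all homomorphisms (`IsStableFamily.dev_act_mem`). Such
stable families are therefore the cross-effects of subfunctors. Applied to the graph of an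
isomorphism of diagrams in a product, this lifts the isomorphism to functors
(`isomorphic_of_diagram`). Applied to an embedding of a torsion free module `D` into the
cross-effects of the sum of the functors of `d`-linear maps from the dual of `X` to `V_d`, `d = 1,
2, 3`, it realizes `D` (`IsTorsionFreeAModule.exists_isomorphic_diagram`). -/

noncomputable section

/-! ### Modules over `𝐀`: isotypic sublattices and correction of morphisms modulo 12. -/

namespace CubicDiagram

variable {R : Type} [CommRing R]

/-! ### Elementwise form of the relations of `𝐀` -/

section relations

variable (D : CubicDiagram R) [hD : Fact D.IsAModule]

@[simp]
theorem h₁_p₂_apply (x : D.V₃) : D.h₁ (D.p₂ x) = 0 := LinearMap.congr_fun hD.out.h₁_p₂ x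

@[simp]
theorem h₂_p₁_apply (x : D.V₃) : D.h₂ (D.p₁ x) = 0 := LinearMap.congr_fun hD.out.h₂_p₁ x

@[simp]
theorem h₂_h_apply (x : D.V₁) : D.h₂ (D.h x) = D.h₁ (D.h x) :=
  (LinearMap.congr_fun hD.out.h₁_h x).symm

@[simp]
theorem p_p₂_apply (x : D.V₃) : D.p (D.p₂ x) = D.p (D.p₁ x) :=
  (LinearMap.congr_fun hD.out.p_p₁ x).symm

@[simp]
theorem h₁_p₁_h₁_apply (x : D.V₂) : D.h₁ (D.p₁ (D.h₁ x)) = (2 : R) • D.h₁ x :=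
  LinearMap.congr_fun hD.out.h₁_p₁_h₁ x

@[simp]
theorem h₂_p₂_h₂_apply (x : D.V₂) : D.h₂ (D.p₂ (D.h₂ x)) = (2 : R) • D.h₂ x :=
  LinearMap.congr_fun hD.out.h₂_p₂_h₂ x

@[simp]
theorem p₁_h₁_p₁_apply (x : D.V₃) : D.p₁ (D.h₁ (D.p₁ x)) = (2 : R) • D.p₁ x :=
  LinearMap.congr_fun hD.out.p₁_h₁_p₁ x

@[simp]
theorem p₂_h₂_p₂_apply (x : D.V₃) : D.p₂ (D.h₂ (D.p₂ x)) = (2 : R) • D.p₂ x :=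
  LinearMap.congr_fun hD.out.p₂_h₂_p₂ x

@[simp]
theorem h_p_h_apply (x : D.V₁) : D.h (D.p (D.h x)) =
    (2 : R) • (D.h x + (D.p₁ (D.h₁ (D.h x)) + D.p₂ (D.h₁ (D.h x)))) :=
  LinearMap.congr_fun hD.out.h_p_h x

@[simp]
theorem p_h_p_apply (x : D.V₂) : D.p (D.h (D.p x)) =
    (2 : R) • (D.p x + (D.p (D.p₁ (D.h₁ x)) + D.p (D.p₁ (D.h₂ x)))) := by
  simpa using LinearMap.congr_fun hD.out.p_h_p x

@[simp]
theorem h₁_h_p_apply (x : D.V₂) : D.h₁ (D.h (D.p x)) =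
    D.h₁ (D.p₁ (D.h₂ (D.p₂ (D.h₁ x)))) + D.h₂ (D.p₂ (D.h₁ (D.p₁ (D.h₂ x)))) -
      D.h₁ x - D.h₂ x := by
  have h : D.h₁ (D.h (D.p x)) + D.h₁ x + D.h₂ x =
    D.h₁ (D.p₁ (D.h₂ (D.p₂ (D.h₁ x)))) + D.h₂ (D.p₂ (D.h₁ (D.p₁ (D.h₂ x)))) :=
    LinearMap.congr_fun hD.out.h₁_h_p x
  rw [← h]
  abel

@[simp]
theorem h_p_p₁_apply (x : D.V₃) : D.h (D.p (D.p₁ x)) =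
    D.p₁ (D.h₂ (D.p₂ (D.h₁ (D.p₁ x)))) + D.p₂ (D.h₁ (D.p₁ (D.h₂ (D.p₂ x)))) -
      D.p₁ x - D.p₂ x := by
  have h : D.h (D.p (D.p₁ x)) + D.p₁ x + D.p₂ x =
    D.p₁ (D.h₂ (D.p₂ (D.h₁ (D.p₁ x)))) + D.p₂ (D.h₁ (D.p₁ (D.h₂ (D.p₂ x)))) :=
    LinearMap.congr_fun hD.out.h_p_p₁ x
  rw [← h]
  abel

-- Needed as a separate rewrite rule, since `h₂ h` is normalized to `h₁ h` before `h₂ p₂ h₂ = 2 h₂`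
-- can apply.
@[simp]
theorem h₂_p₂_h₁_h_apply (x : D.V₁) : D.h₂ (D.p₂ (D.h₁ (D.h x))) = (2 : R) • D.h₁ (D.h x) := by
  rw [← h₂_h_apply, h₂_p₂_h₂_apply]

@[simp]
theorem p_p₁_h₂_p₂_apply (x : D.V₃) :
    D.p (D.p₁ (D.h₂ (D.p₂ x))) = (2 : R) • D.p (D.p₁ x) := by
  rw [← p_p₂_apply, p₂_h₂_p₂_apply, map_smul, p_p₂_apply]

/-- The braid relation. -/
@[simp]
theorem h₂_p₂_h₁_p₁_h₂_p₂_apply (x : D.V₃) : D.h₂ (D.p₂ (D.h₁ (D.p₁ (D.h₂ (D.p₂ x))))) =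
    D.h₁ (D.p₁ (D.h₂ (D.p₂ (D.h₁ (D.p₁ x))))) - D.h₁ (D.p₁ x) + D.h₂ (D.p₂ x) := by
  -- The relation for `h₁ h p` is evaluated at `p₁ x` and at `p₂ x`, where `p` agrees. The terms
  -- with `h₁ p₂` and `h₂ p₁` vanish, and what remains is the braid relation.
  have h : D.h₁ (D.h (D.p (D.p₂ x))) = D.h₁ (D.h (D.p (D.p₁ x))) := by rw [p_p₂_apply]
  rw [h₁_h_p_apply, h₁_h_p_apply] at h
  simp only [h₁_p₂_apply, h₂_p₁_apply, map_zero, zero_add, add_zero, sub_zero] at h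
  rw [← h]
  abel

end relations

/-- A morphism of diagrams. -/
structure Hom (D E : CubicDiagram R) where
  f₁ : D.V₁ →ₗ[R] E.V₁
  f₂ : D.V₂ →ₗ[R] E.V₂
  f₃ : D.V₃ →ₗ[R] E.V₃
  h : ∀ x, f₂ (D.h x) = E.h (f₁ x)
  p : ∀ x, f₁ (D.p x) = E.p (f₂ x)
  h₁ : ∀ x, f₃ (D.h₁ x) = E.h₁ (f₂ x)
  h₂ : ∀ x, f₃ (D.h₂ x) = E.h₂ (f₂ x)
  p₁ : ∀ x, f₂ (D.p₁ x) = E.p₁ (f₃ x)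
  p₂ : ∀ x, f₂ (D.p₂ x) = E.p₂ (f₃ x)

namespace Hom

variable {D E G : CubicDiagram R}

attribute [simp] Hom.h Hom.p Hom.h₁ Hom.h₂ Hom.p₁ Hom.p₂

/-- The identity. -/
def id (D : CubicDiagram R) : Hom D D := by
  refine ⟨.id, .id, .id, ?_, ?_, ?_, ?_, ?_, ?_⟩ <;> intro x <;> rfl

/-- The composition of morphisms. -/
def comp (g : Hom E G) (f : Hom D E) : Hom D G := by
  refine ⟨g.f₁ ∘ₗ f.f₁, g.f₂ ∘ₗ f.f₂, g.f₃ ∘ₗ f.f₃, ?_, ?_, ?_, ?_, ?_, ?_⟩ <;> intro x <;> simp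

/-- The sum of morphisms. -/
def add (f g : Hom D E) : Hom D E := by
  refine ⟨f.f₁ + g.f₁, f.f₂ + g.f₂, f.f₃ + g.f₃, ?_, ?_, ?_, ?_, ?_, ?_⟩ <;> intro x <;> simp

/-- A scalar multiple of a morphism. -/
def smul (c : R) (f : Hom D E) : Hom D E := by
  refine ⟨c • f.f₁, c • f.f₂, c • f.f₃, ?_, ?_, ?_, ?_, ?_, ?_⟩ <;> intro x <;> simp

end Hom

/-! ### The isotypic sublattices -/

section isotypic

variable (D : CubicDiagram R)

/-- Twice the projection of `D.V₂` onto the kernel of `h₁` and `h₂`. -/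
def bil : D.V₂ →ₗ[R] D.V₂ := (2 : R) • LinearMap.id - D.p₁ ∘ₗ D.h₁ - D.p₂ ∘ₗ D.h₂

/-- Six times the projection of `D.V₁` onto the kernel of `h`. -/
def lin : D.V₁ →ₗ[R] D.V₁ :=
  (6 : R) • LinearMap.id - (3 : R) • (D.p ∘ₗ D.h) + (2 : R) • (D.p ∘ₗ D.p₁ ∘ₗ D.h₁ ∘ₗ D.h)

/-- The transposition of the first two arguments. -/
def t₁ : D.V₃ →ₗ[R] D.V₃ := D.h₁ ∘ₗ D.p₁ - LinearMap.id

/-- The transposition of the last two arguments. -/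
def t₂ : D.V₃ →ₗ[R] D.V₃ := D.h₂ ∘ₗ D.p₂ - LinearMap.id

theorem bil_apply (x : D.V₂) : D.bil x = (2 : R) • x - D.p₁ (D.h₁ x) - D.p₂ (D.h₂ x) := rfl

theorem lin_apply (x : D.V₁) : D.lin x =
    (6 : R) • x - (3 : R) • D.p (D.h x) + (2 : R) • D.p (D.p₁ (D.h₁ (D.h x))) := rfl

theorem t₁_apply (x : D.V₃) : D.t₁ x = D.h₁ (D.p₁ x) - x := rfl

theorem t₂_apply (x : D.V₃) : D.t₂ x = D.h₂ (D.p₂ x) - x := rfl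

theorem h₁_p₁_eq (x : D.V₃) : D.h₁ (D.p₁ x) = x + D.t₁ x := by
  simp [t₁_apply]

theorem h₂_p₂_eq (x : D.V₃) : D.h₂ (D.p₂ x) = x + D.t₂ x := by
  simp [t₂_apply]

section

variable [Fact D.IsAModule]

@[simp]
theorem h_lin (x : D.V₁) : D.h (D.lin x) = 0 := by
  simp [lin_apply]; module

@[simp]
theorem lin_p (x : D.V₂) : D.lin (D.p x) = 0 := by
  simp [lin_apply]; module

@[simp]
theorem h₁_bil (x : D.V₂) : D.h₁ (D.bil x) = 0 := by
  simp [bil_apply]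

@[simp]
theorem h₂_bil (x : D.V₂) : D.h₂ (D.bil x) = 0 := by
  simp [bil_apply]

@[simp]
theorem bil_p₁ (x : D.V₃) : D.bil (D.p₁ x) = 0 := by
  simp [bil_apply]

@[simp]
theorem bil_p₂ (x : D.V₃) : D.bil (D.p₂ x) = 0 := by
  simp [bil_apply]

theorem bil_h_p_h (x : D.V₁) : D.bil (D.h (D.p (D.h x))) = (2 : R) • D.bil (D.h x) := by
  simp

/-- On the bilinear part `p h p = 2 p`, so that `h p` satisfies `(h p)² = 2 h p` there; its
eigenvalues 0 and 2 separate `isoAlt` from `isoSym`. -/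
theorem h_p_bil (x : D.V₂) : D.h (D.p (D.bil x)) = D.bil (D.h (D.p x)) := by
  simp [bil_apply]; module

@[simp]
theorem t₁_t₁ (x : D.V₃) : D.t₁ (D.t₁ x) = x := by
  simp [t₁_apply]; module

@[simp]
theorem t₂_t₂ (x : D.V₃) : D.t₂ (D.t₂ x) = x := by
  simp [t₂_apply]; module

theorem t₂_t₁_t₂ (x : D.V₃) : D.t₂ (D.t₁ (D.t₂ x)) = D.t₁ (D.t₂ (D.t₁ x)) := by
  simp [t₁_apply, t₂_apply]; module

@[simp]
theorem t₁_h₁ (x : D.V₂) : D.t₁ (D.h₁ x) = D.h₁ x := by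
  simp [t₁_apply]; module

@[simp]
theorem t₂_h₂ (x : D.V₂) : D.t₂ (D.h₂ x) = D.h₂ x := by
  simp [t₂_apply]; module

@[simp]
theorem p₁_t₁ (x : D.V₃) : D.p₁ (D.t₁ x) = D.p₁ x := by
  simp [t₁_apply]; module

@[simp]
theorem p₂_t₂ (x : D.V₃) : D.p₂ (D.t₂ x) = D.p₂ x := by
  simp [t₂_apply]; module

@[simp]
theorem t₂_h₁_h (x : D.V₁) : D.t₂ (D.h₁ (D.h x)) = D.h₁ (D.h x) := by
  simp [t₂_apply]; module

/-- The six terms correspond to the six surjections of three points onto two: the translates of `h₁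
x` and of `h₂ x` under the symmetric group. -/
theorem h₁_h_p_eq (x : D.V₂) : D.h₁ (D.h (D.p x)) = D.h₁ x + D.t₂ (D.h₁ x) +
    D.t₁ (D.t₂ (D.h₁ x)) + D.h₂ x + D.t₁ (D.h₂ x) + D.t₂ (D.t₁ (D.h₂ x)) := by
  simp [t₁_apply, t₂_apply]; module

end

end isotypic

end CubicDiagram
end

noncomputable section

namespace CubicDiagram

section sublattices

variable {R : Type} [CommRing R] (D : CubicDiagram R)

/-- The linear part of `D.V₁`. -/
def isoLin : Submodule R D.V₁ := LinearMap.ker D.h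

/-- The bilinear alternating part of `D.V₂`. -/
def isoAlt : Submodule R D.V₂ := LinearMap.ker D.h₁ ⊓ LinearMap.ker D.h₂ ⊓ LinearMap.ker D.p

/-- The bilinear symmetric part of `D.V₂`. -/
def isoSym : Submodule R D.V₂ := LinearMap.ker D.h₁ ⊓ LinearMap.ker D.h₂ ⊓
  LinearMap.ker (D.h ∘ₗ D.p - (2 : R) • LinearMap.id)

/-- The invariants of the symmetric group in `D.V₃`. -/
def isoSym₃ : Submodule R D.V₃ :=
  LinearMap.ker (D.t₁ - LinearMap.id) ⊓ LinearMap.ker (D.t₂ - LinearMap.id)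

/-- The anti-invariants of the symmetric group in `D.V₃`. -/
def isoAlt₃ : Submodule R D.V₃ := LinearMap.ker D.p₁ ⊓ LinearMap.ker D.p₂

/-- The vectors that are invariant under `t₁` in the two-dimensional isotypic part of `D.V₃`. -/
def isoStd : Submodule R D.V₃ :=
  LinearMap.ker (D.t₁ - LinearMap.id) ⊓ LinearMap.ker (LinearMap.id + D.t₂ + D.t₁ ∘ₗ D.t₂)

variable {D}

theorem mem_isoLin {x : D.V₁} : x ∈ D.isoLin ↔ D.h x = 0 := Iff.rfl

theorem mem_isoAlt {x : D.V₂} : x ∈ D.isoAlt ↔ (D.h₁ x = 0 ∧ D.h₂ x = 0) ∧ D.p x = 0 := Iff.rfl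

theorem mem_isoSym {x : D.V₂} :
    x ∈ D.isoSym ↔ (D.h₁ x = 0 ∧ D.h₂ x = 0) ∧ D.h (D.p x) = (2 : R) • x :=
  and_congr Iff.rfl (sub_eq_zero (a := D.h (D.p x)))

theorem mem_isoSym₃ {x : D.V₃} : x ∈ D.isoSym₃ ↔ D.t₁ x = x ∧ D.t₂ x = x :=
  and_congr (sub_eq_zero (a := D.t₁ x)) (sub_eq_zero (a := D.t₂ x))

theorem mem_isoAlt₃ {x : D.V₃} : x ∈ D.isoAlt₃ ↔ D.p₁ x = 0 ∧ D.p₂ x = 0 := Iff.rfl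

theorem mem_isoStd {x : D.V₃} : x ∈ D.isoStd ↔ D.t₁ x = x ∧ x + D.t₂ x + D.t₁ (D.t₂ x) = 0 :=
  and_congr (sub_eq_zero (a := D.t₁ x)) Iff.rfl

theorem t₁_t₂_of_mem_isoStd {x : D.V₃} (hx : x ∈ D.isoStd) : D.t₁ (D.t₂ x) = - x - D.t₂ x := by
  have := (mem_isoStd.1 hx).2
  rw [← sub_eq_zero, ← this]; abel

end sublattices

/-! ### Integral multiples of the projections onto the isotypic parts. -/

section projections

variable {R : Type} [CommRing R] (D : CubicDiagram R) [hD : Fact D.IsAModule]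

/-- Six times the projection of `D.V₁` onto its linear part. -/
def toLin : D.V₁ →ₗ[R] D.isoLin := D.lin.codRestrict _ fun x => mem_isoLin.2 (by simp)

/-- Four times the projection of `D.V₂` onto its bilinear alternating part. -/
def toAlt : D.V₂ →ₗ[R] D.isoAlt := ((2 : R) • D.bil - D.h ∘ₗ D.p ∘ₗ D.bil).codRestrict _
  fun x => mem_isoAlt.2 (by simp)

/-- Four times the projection of `D.V₂` onto its bilinear symmetric part. -/
def toSym : D.V₂ →ₗ[R] D.isoSym := (D.h ∘ₗ D.p ∘ₗ D.bil).codRestrict _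
  fun x => mem_isoSym.2 (by simp)

/-- The map of `D.V₁` to the bilinear symmetric part of `D.V₂`. -/
def toSymH : D.V₁ →ₗ[R] D.isoSym := (D.bil ∘ₗ D.h).codRestrict _
  fun x => mem_isoSym.2 (by simp [h_p_bil])

/-- The symmetrization. -/
def toSym₃ : D.V₃ →ₗ[R] D.isoSym₃ :=
  (LinearMap.id + D.t₁ + D.t₂ + D.t₁ ∘ₗ D.t₂ + D.t₂ ∘ₗ D.t₁ + D.t₁ ∘ₗ D.t₂ ∘ₗ D.t₁).codRestrict _
  fun x => mem_isoSym₃.2 (by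
    constructor
    · simp; abel
    · simp [← t₂_t₁_t₂]; abel)

/-- The symmetrization of `h₁ x`, divided by two. -/
def toSym₃H₁ : D.V₂ →ₗ[R] D.isoSym₃ :=
  (D.h₁ + D.t₂ ∘ₗ D.h₁ + D.t₁ ∘ₗ D.t₂ ∘ₗ D.h₁).codRestrict _
  fun x => mem_isoSym₃.2 (by
    constructor
    · simp; abel
    · simp [t₂_t₁_t₂]; abel)

/-- The symmetrization of `h₂ x`, divided by two. -/
def toSym₃H₂ : D.V₂ →ₗ[R] D.isoSym₃ :=
  (D.h₂ + D.t₁ ∘ₗ D.h₂ + D.t₂ ∘ₗ D.t₁ ∘ₗ D.h₂).codRestrict _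
  fun x => mem_isoSym₃.2 (by
    constructor
    · simp [← t₂_t₁_t₂]; abel
    · simp; abel)

/-- The map `h₁ h` into the invariants. -/
def toSym₃H : D.V₁ →ₗ[R] D.isoSym₃ := (D.h₁ ∘ₗ D.h).codRestrict _
  fun x => mem_isoSym₃.2 (by simp)

/-- The antisymmetrization. -/
def toAlt₃ : D.V₃ →ₗ[R] D.isoAlt₃ :=
  (LinearMap.id - D.t₁ - D.t₂ + D.t₁ ∘ₗ D.t₂ + D.t₂ ∘ₗ D.t₁ - D.t₁ ∘ₗ D.t₂ ∘ₗ D.t₁).codRestrict _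
  fun x => mem_isoAlt₃.2 (by
    constructor
    · simp
    · simp [← t₂_t₁_t₂])

/-- The map `(1 + t₁)(1 - t₂)`. -/
def toStd : D.V₃ →ₗ[R] D.isoStd :=
  (LinearMap.id + D.t₁ - D.t₂ - D.t₁ ∘ₗ D.t₂).codRestrict _
  fun x => mem_isoStd.2 (by
    constructor
    · simp; abel
    · simp [t₂_t₁_t₂]; abel)

@[simp]
theorem coe_toLin (x : D.V₁) : (D.toLin x : D.V₁) = D.lin x := rfl

@[simp]
theorem coe_toAlt (x : D.V₂) :
    (D.toAlt x : D.V₂) = (2 : R) • D.bil x - D.h (D.p (D.bil x)) := rfl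

@[simp]
theorem coe_toSym (x : D.V₂) : (D.toSym x : D.V₂) = D.h (D.p (D.bil x)) := rfl

@[simp]
theorem coe_toSymH (x : D.V₁) : (D.toSymH x : D.V₂) = D.bil (D.h x) := rfl

@[simp]
theorem coe_toSym₃ (x : D.V₃) : (D.toSym₃ x : D.V₃) =
    x + D.t₁ x + D.t₂ x + D.t₁ (D.t₂ x) + D.t₂ (D.t₁ x) + D.t₁ (D.t₂ (D.t₁ x)) := rfl

@[simp]
theorem coe_toSym₃H₁ (x : D.V₂) :
    (D.toSym₃H₁ x : D.V₃) = D.h₁ x + D.t₂ (D.h₁ x) + D.t₁ (D.t₂ (D.h₁ x)) := rfl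

@[simp]
theorem coe_toSym₃H₂ (x : D.V₂) :
    (D.toSym₃H₂ x : D.V₃) = D.h₂ x + D.t₁ (D.h₂ x) + D.t₂ (D.t₁ (D.h₂ x)) := rfl

@[simp]
theorem coe_toSym₃H (x : D.V₁) : (D.toSym₃H x : D.V₃) = D.h₁ (D.h x) := rfl

@[simp]
theorem coe_toAlt₃ (x : D.V₃) : (D.toAlt₃ x : D.V₃) =
    x - D.t₁ x - D.t₂ x + D.t₁ (D.t₂ x) + D.t₂ (D.t₁ x) - D.t₁ (D.t₂ (D.t₁ x)) := rfl

@[simp]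
theorem coe_toStd (x : D.V₃) :
    (D.toStd x : D.V₃) = x + D.t₁ x - D.t₂ x - D.t₁ (D.t₂ x) := rfl

end projections

/-! ### Extension of homomorphisms of isotypic sublattices -/

section extension

variable {R : Type} [CommRing R] {D E : CubicDiagram R} [hD : Fact D.IsAModule]

/-- Extension by zero to the other vertices is a morphism because `lin` kills the image of `p` and
`isoLin` is killed by `h`. The factor 6 is the value of `lin` on `isoLin`. -/
theorem exists_hom_isoLin (ψ : D.isoLin →ₗ[R] E.isoLin) : ∃ f : Hom D E,
    (∀ x : D.isoLin, f.f₁ x = (6 : R) • (ψ x : E.V₁)) ∧ f.f₂ = 0 ∧ f.f₃ = 0 := by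
  have h0 (y : E.isoLin) : E.h y = 0 := y.2
  have h1 (x) : D.toLin (D.p x) = 0 := Subtype.ext (by simp)
  refine ⟨⟨Submodule.subtype _ ∘ₗ ψ ∘ₗ D.toLin, 0, 0, ?_, ?_, ?_, ?_, ?_, ?_⟩, ?_, rfl, rfl⟩
  all_goals intro x
  any_goals simp [h0, h1]
  rw [show D.toLin x = (6 : R) • x from Subtype.ext (by simp [lin_apply, mem_isoLin.1 x.2])]
  simp

/-- The factor 4 arises as 2 · 2: `bil` is twice the projection onto the bilinear part, and `2 - h
p` is on that part twice the projection onto its alternating summand. -/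
theorem exists_hom_isoAlt (ψ : D.isoAlt →ₗ[R] E.isoAlt) : ∃ f : Hom D E,
    (∀ x : D.isoAlt, f.f₂ x = (4 : R) • (ψ x : E.V₂)) ∧ f.f₁ = 0 ∧ f.f₃ = 0 ∧
      ∀ x ∈ D.isoSym, f.f₂ x = 0 := by
  have h0 (y : E.isoAlt) : E.h₁ y = 0 := (mem_isoAlt.1 y.2).1.1
  have h0' (y : E.isoAlt) : E.h₂ y = 0 := (mem_isoAlt.1 y.2).1.2
  have h0'' (y : E.isoAlt) : E.p y = 0 := (mem_isoAlt.1 y.2).2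
  have h1 (x) : D.toAlt (D.h x) = 0 := Subtype.ext (by simp [h_p_bil])
  have h2 (x) : D.toAlt (D.p₁ x) = 0 := Subtype.ext (by simp)
  have h3 (x) : D.toAlt (D.p₂ x) = 0 := Subtype.ext (by simp)
  refine ⟨⟨0, Submodule.subtype _ ∘ₗ ψ ∘ₗ D.toAlt, 0, ?_, ?_, ?_, ?_, ?_, ?_⟩, ?_, rfl, rfl, ?_⟩
  all_goals intro x
  any_goals simp [h0, h0', h0'', h1, h2, h3]
  · rw [show D.toAlt x = (4 : R) • x from Subtype.ext (by
      obtain ⟨⟨a, b⟩, c⟩ := mem_isoAlt.1 x.2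
      simp [bil_apply, a, b, c, smul_smul]; module)]
    simp
  · intro hx
    obtain ⟨⟨a, b⟩, c⟩ := mem_isoSym.1 hx
    rw [show D.toAlt x = 0 from Subtype.ext (by simp [bil_apply, a, b, c])]
    simp

/-- The symmetric bilinear part also lives in `V₁`. There the morphism is built from `toSymH`, which
is half of `toSym ∘ h`; since `h p = 2` on `isoSym`, this compensates exactly and the factor stays
4. -/
theorem exists_hom_isoSym (ψ : D.isoSym →ₗ[R] E.isoSym) : ∃ f : Hom D E,
    (∀ x : D.isoSym, f.f₂ x = (4 : R) • (ψ x : E.V₂)) ∧ f.f₃ = 0 ∧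
      (∀ x ∈ D.isoLin, f.f₁ x = 0) ∧ ∀ x ∈ D.isoAlt, f.f₂ x = 0 := by
  have h0 (y : E.isoSym) : E.h₁ y = 0 := (mem_isoSym.1 y.2).1.1
  have h0' (y : E.isoSym) : E.h₂ y = 0 := (mem_isoSym.1 y.2).1.2
  have h0'' (y : E.isoSym) : E.h (E.p y) = (2 : R) • (y : E.V₂) := (mem_isoSym.1 y.2).2
  have h1 (x) : D.toSym (D.h x) = (2 : R) • D.toSymH x := Subtype.ext (by simp [h_p_bil])
  have h2 (x) : D.toSym (D.p₁ x) = 0 := Subtype.ext (by simp)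
  have h3 (x) : D.toSym (D.p₂ x) = 0 := Subtype.ext (by simp)
  have h4 (x) : D.toSymH (D.p x) = D.toSym x := Subtype.ext (by simp [h_p_bil])
  refine ⟨⟨E.p ∘ₗ Submodule.subtype _ ∘ₗ ψ ∘ₗ D.toSymH, Submodule.subtype _ ∘ₗ ψ ∘ₗ D.toSym, 0,
    ?_, ?_, ?_, ?_, ?_, ?_⟩, ?_, rfl, ?_, ?_⟩
  all_goals intro x
  any_goals simp [h0, h0', h0'', h1, h2, h3, h4]
  · rw [show D.toSym x = (4 : R) • x from Subtype.ext (by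
      obtain ⟨⟨a, b⟩, c⟩ := mem_isoSym.1 x.2
      simp [bil_apply, a, b, c, smul_smul]; module)]
    simp
  · intro hx
    rw [show D.toSymH x = 0 from Subtype.ext (by simp [mem_isoLin.1 hx])]
    simp
  · intro hx
    obtain ⟨⟨a, b⟩, c⟩ := mem_isoAlt.1 hx
    rw [show D.toSym x = 0 from Subtype.ext (by simp [bil_apply, a, b, c])]
    simp

/-- The alternating part lives at the vertex 3 only, and the factor 6 is the order of the symmetric
group. -/
theorem exists_hom_isoAlt₃ (ψ : D.isoAlt₃ →ₗ[R] E.isoAlt₃) : ∃ f : Hom D E,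
    (∀ x : D.isoAlt₃, f.f₃ x = (6 : R) • (ψ x : E.V₃)) ∧ f.f₁ = 0 ∧ f.f₂ = 0 ∧
      (∀ x ∈ D.isoSym₃, f.f₃ x = 0) ∧ ∀ x ∈ D.isoStd, f.f₃ x = 0 := by
  have h0 (y : E.isoAlt₃) : E.p₁ y = 0 := (mem_isoAlt₃.1 y.2).1
  have h0' (y : E.isoAlt₃) : E.p₂ y = 0 := (mem_isoAlt₃.1 y.2).2
  have h1 (x) : D.toAlt₃ (D.h₁ x) = 0 := Subtype.ext (by simp)
  have h2 (x) : D.toAlt₃ (D.h₂ x) = 0 := Subtype.ext (by simp [← t₂_t₁_t₂])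
  refine ⟨⟨0, 0, Submodule.subtype _ ∘ₗ ψ ∘ₗ D.toAlt₃, ?_, ?_, ?_, ?_, ?_, ?_⟩, ?_, rfl, rfl,
    ?_, ?_⟩
  all_goals intro x
  any_goals simp [h0, h0', h1, h2]
  · rw [show D.toAlt₃ x = (6 : R) • x from Subtype.ext (by
      obtain ⟨a, b⟩ := mem_isoAlt₃.1 x.2
      simp [t₁_apply, t₂_apply, a, b]; module)]
    simp
  · intro hx
    obtain ⟨a, b⟩ := mem_isoSym₃.1 hx
    rw [show D.toAlt₃ x = 0 from Subtype.ext (by simp [a, b])]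
    simp
  · intro hx
    have a := (mem_isoStd.1 hx).1
    rw [show D.toAlt₃ x = 0 from Subtype.ext (by simp [a])]
    simp

/-- The symmetrization of `h₁ x` is divisible by 2, as `t₁` fixes `h₁ x`, and its half is divisible
by 3 on the image of `h`. Using the quotients `toSym₃H₁`, `toSym₃H₂` and `toSym₃H` at the vertices 2
and 1 avoids any factor beyond the 6 of the symmetrization on `V₃`. -/
theorem exists_hom_isoSym₃ [hE : Fact E.IsAModule] (ψ : D.isoSym₃ →ₗ[R] E.isoSym₃) : ∃ f : Hom D E,
    (∀ x : D.isoSym₃, f.f₃ x = (6 : R) • (ψ x : E.V₃)) ∧ (∀ x ∈ D.isoLin, f.f₁ x = 0) ∧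
      (∀ x, D.h₁ x = 0 → D.h₂ x = 0 → f.f₂ x = 0) ∧
      (∀ x ∈ D.isoAlt₃, f.f₃ x = 0) ∧ ∀ x ∈ D.isoStd, f.f₃ x = 0 := by
  have h0 (y : E.isoSym₃) : E.h₁ (E.p₁ y) = (2 : R) • (y : E.V₃) := by
    rw [h₁_p₁_eq, (mem_isoSym₃.1 y.2).1]; module
  have h0' (y : E.isoSym₃) : E.h₂ (E.p₂ y) = (2 : R) • (y : E.V₃) := by
    rw [h₂_p₂_eq, (mem_isoSym₃.1 y.2).2]; module
  have h1 (x) : D.toSym₃H₁ (D.h x) = (3 : R) • D.toSym₃H x := Subtype.ext (by simp; module)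
  have h2 (x) : D.toSym₃H₂ (D.h x) = (3 : R) • D.toSym₃H x := Subtype.ext (by simp; module)
  have h3 (x) : D.toSym₃H (D.p x) = D.toSym₃H₁ x + D.toSym₃H₂ x :=
    Subtype.ext (by simp only [coe_toSym₃H, h₁_h_p_eq]; simp; module)
  have h4 (x) : D.toSym₃ (D.h₁ x) = (2 : R) • D.toSym₃H₁ x := Subtype.ext (by simp; module)
  have h5 (x) : D.toSym₃ (D.h₂ x) = (2 : R) • D.toSym₃H₂ x :=
    Subtype.ext (by simp [← t₂_t₁_t₂]; module)
  have h6 (x) : D.toSym₃H₁ (D.p₁ x) = D.toSym₃ x :=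
    Subtype.ext (by simp [h₁_p₁_eq]; module)
  have h7 (x) : D.toSym₃H₂ (D.p₂ x) = D.toSym₃ x :=
    Subtype.ext (by simp [h₂_p₂_eq, t₂_t₁_t₂]; module)
  have h8 (x) : D.toSym₃H₂ (D.p₁ x) = 0 := Subtype.ext (by simp)
  have h9 (x) : D.toSym₃H₁ (D.p₂ x) = 0 := Subtype.ext (by simp)
  refine ⟨⟨E.p ∘ₗ E.p₁ ∘ₗ Submodule.subtype _ ∘ₗ ψ ∘ₗ D.toSym₃H,
    E.p₁ ∘ₗ Submodule.subtype _ ∘ₗ ψ ∘ₗ D.toSym₃H₁ + E.p₂ ∘ₗ Submodule.subtype _ ∘ₗ ψ ∘ₗ D.toSym₃H₂,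
    Submodule.subtype _ ∘ₗ ψ ∘ₗ D.toSym₃, ?_, ?_, ?_, ?_, ?_, ?_⟩, ?_, ?_, ?_, ?_, ?_⟩
  all_goals intro x
  any_goals simp [h0, h0', h1, h2, h3, h4, h5, h6, h7, h8, h9]
  · module
  · rw [show D.toSym₃ x = (6 : R) • x from Subtype.ext (by
      obtain ⟨a, b⟩ := mem_isoSym₃.1 x.2
      simp [a, b]; module)]
    simp
  · intro hx
    rw [show D.toSym₃H x = 0 from Subtype.ext (by simp [mem_isoLin.1 hx])]
    simp
  · intro a b
    rw [show D.toSym₃H₁ x = 0 from Subtype.ext (by simp [a]),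
      show D.toSym₃H₂ x = 0 from Subtype.ext (by simp [b])]
    simp
  · intro hx
    obtain ⟨a, b⟩ := mem_isoAlt₃.1 hx
    rw [show D.toSym₃ x = 0 from Subtype.ext (by simp [t₁_apply, t₂_apply, a, b])]
    simp
  · intro hx
    have a := (mem_isoStd.1 hx).1
    have b := t₁_t₂_of_mem_isoStd hx
    rw [show D.toSym₃ x = 0 from Subtype.ext (by simp [a, b])]
    simp

theorem p₁_of_mem_isoStd {x : D.V₃} (hx : x ∈ D.isoStd) :
    D.p₁ x + (2 : R) • D.p₁ (D.t₂ x) = 0 := by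
  have h := congrArg D.p₁ (mem_isoStd.1 hx).2
  rw [map_add, map_add, p₁_t₁, map_zero] at h
  rw [← h]; module

/-- The map `p p₁ = p p₂` is invariant under both transpositions, hence takes equal values on the
three terms of `x + t₂ x + t₁ t₂ x = 0`; so three times its value is zero. -/
theorem p_p₁_of_mem_isoStd [IsDomain R] [CharZero R] [Module.IsTorsionFree R D.V₁]
    {x : D.V₃} (hx : x ∈ D.isoStd) :
    D.p (D.p₁ x) = 0 := by
  have h := congrArg D.p (p₁_of_mem_isoStd hx)
  rw [map_add, map_smul, ← p_p₂_apply D (D.t₂ x), p₂_t₂, p_p₂_apply, map_zero,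
    show D.p (D.p₁ x) + (2 : R) • D.p (D.p₁ x) = (3 : R) • D.p (D.p₁ x) by module] at h
  exact (smul_eq_zero.1 h).resolve_left (by norm_num)

/-- The two-dimensional part of `V₃` is recovered from its `t₁`-invariant vectors and their
translates. It occurs at the vertices 2 and 3, but not at 1 by `p_p₁_of_mem_isoStd`. -/
theorem exists_hom_isoStd [hE : Fact E.IsAModule] [IsDomain R] [CharZero R]
    [Module.IsTorsionFree R E.V₁] (ψ : D.isoStd →ₗ[R] E.isoStd) :
    ∃ f : Hom D E, (∀ x : D.isoStd, f.f₃ x = (6 : R) • (ψ x : E.V₃)) ∧ f.f₁ = 0 ∧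
      (∀ x, D.h₁ x = 0 → D.h₂ x = 0 → f.f₂ x = 0) ∧
      (∀ x ∈ D.isoAlt₃, f.f₃ x = 0) ∧ ∀ x ∈ D.isoSym₃, f.f₃ x = 0 := by
  have e1 (y : E.isoStd) : E.t₁ y = y := (mem_isoStd.1 y.2).1
  have e2 (y : E.isoStd) : E.t₁ (E.t₂ y) = - y - E.t₂ y := t₁_t₂_of_mem_isoStd y.2
  have e3 (y : E.isoStd) : E.p (E.p₁ y) = 0 := p_p₁_of_mem_isoStd y.2
  have e5 (y : E.isoStd) : E.p₁ (y : E.V₃) = - ((2 : R) • E.p₁ (E.t₂ y)) :=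
    eq_neg_of_add_eq_zero_left (p₁_of_mem_isoStd y.2)
  have h1 (x) : D.toStd (D.h₁ (D.h x)) = 0 := Subtype.ext (by simp)
  have h3 (x) : D.toStd (D.h₂ x) = 0 := Subtype.ext (by simp)
  have h5 (x) : D.toStd (D.t₁ (D.t₂ x)) = D.toStd (D.t₁ x) - D.toStd x :=
    Subtype.ext (by simp [t₂_t₁_t₂]; abel)
  -- The formula on `V₃` is the term for the two-dimensional part in the identity `6 = toSym₃ +
  -- toAlt₃ - 2 (t₂ toStd + t₁ t₂ toStd t₁)`, with `ψ` inserted after `toStd`.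
  refine ⟨⟨0, E.p₁ ∘ₗ Submodule.subtype _ ∘ₗ ψ ∘ₗ D.toStd ∘ₗ D.h₁ -
      E.p₂ ∘ₗ E.t₁ ∘ₗ E.t₂ ∘ₗ Submodule.subtype _ ∘ₗ ψ ∘ₗ D.toStd ∘ₗ D.t₁ ∘ₗ D.h₂,
    (-2 : R) • (E.t₂ ∘ₗ Submodule.subtype _ ∘ₗ ψ ∘ₗ D.toStd +
      E.t₁ ∘ₗ E.t₂ ∘ₗ Submodule.subtype _ ∘ₗ ψ ∘ₗ D.toStd ∘ₗ D.t₁),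
    ?_, ?_, ?_, ?_, ?_, ?_⟩, ?_, rfl, ?_, ?_, ?_⟩
  all_goals intro x
  · have : D.t₁ (D.h₁ (D.h x)) = D.h₁ (D.h x) := by simp
    simp [h1]
  · simp [e2, e3]
  · simp [e2, h₁_p₁_eq, e1]; module
  · simp [h₂_p₂_eq, h3, e2]; module
  · simp [h₁_p₁_eq, e2, e5]; module
  · simp [h₂_p₂_eq, e2, h5]; module
  · have a := (mem_isoStd.1 x.2).1
    have b := t₁_t₂_of_mem_isoStd x.2
    have c : D.toStd x = (3 : R) • x := Subtype.ext (by simp [a, b]; module)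
    simp [a, c, e2]; module
  · intro a b
    simp [a, b]
  · intro hx
    obtain ⟨a, b⟩ := mem_isoAlt₃.1 hx
    have c : D.toStd x = 0 := Subtype.ext (by simp [t₁_apply, t₂_apply, a, b])
    have d : D.toStd (D.t₁ x) = 0 := by
      rw [t₁_apply, a, map_zero, zero_sub, map_neg, c, neg_zero]
    simp [c, d]
  · intro hx
    obtain ⟨a, b⟩ := mem_isoSym₃.1 hx
    have c : D.toStd x = 0 := Subtype.ext (by simp [a, b])
    simp [a, c]

end extension

end CubicDiagram
end

noncomputable section

/-! ### Lifting of isomorphisms modulo `4` or `6` -/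

/-- Kernels are saturated. This is what allows a congruence modulo 12 in a component to be read as
one inside an isotypic sublattice. -/
theorem LinearMap.mem_ker_of_smul_mem {R V W : Type*} [CommRing R] [IsDomain R] [AddCommGroup V]
    [Module R V]
    [AddCommGroup W] [Module R W] [Module.IsTorsionFree R W] {m : R} (hm : m ≠ 0)
    (f : V →ₗ[R] W) {z : V} (h : m • z ∈ LinearMap.ker f) : z ∈ LinearMap.ker f := by
  rw [LinearMap.mem_ker, map_smul] at h
  exact (smul_eq_zero.1 h).resolve_left hm

section lifting

variable {R L L' : Type*} [CommRing R] [AddCommGroup L] [Module R L] [AddCommGroup L'] [Module R L']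

theorem LinearMap.exists_eq_smul_of_basis {ι : Type*} (b : Module.Basis ι R L) (f : L →ₗ[R] L')
    (N : R) (h : ∀ i, ∃ z, f (b i) = N • z) : ∃ g : L →ₗ[R] L', f = N • g := by
  choose z hz using h
  exact ⟨b.constr R z, b.ext fun i => by rw [LinearMap.smul_apply, b.constr_basis, hz]⟩

variable [IsDomain R] [IsPrincipalIdealRing R] [Module.Finite R L] [Module.IsTorsionFree R L]

/-- The kernel `K` satisfies `K = m K`, so by Nakayama some `r` congruent to 1 modulo `m`
annihilates it. As `m` is not a unit, `r ≠ 0`, and `K = 0` by torsion freeness. -/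
theorem LinearMap.injective_of_eq_add_smul {m : R} (hm0 : m ≠ 0) (hm : ¬ IsUnit m)
    (f : L →ₗ[R] L) (h : ∀ x, ∃ z, f x = x + m • z) : Function.Injective f := by
  rw [← LinearMap.ker_eq_bot, Submodule.eq_bot_iff]
  have hle : LinearMap.ker f ≤ Ideal.span {m} • LinearMap.ker f := by
    intro x hx
    obtain ⟨z, hz⟩ := h x
    have hx' : f x = 0 := hx
    have hxz : x = m • (-z) := by
      rw [smul_neg]
      exact eq_neg_of_add_eq_zero_left (hz.symm.trans hx')
    have hz0 : f (-z) = 0 := by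
      rw [hxz, map_smul] at hx'
      exact (smul_eq_zero.1 hx').resolve_left hm0
    rw [hxz]
    exact Submodule.smul_mem_smul (Ideal.mem_span_singleton_self _) hz0
  obtain ⟨r, hr, hr0⟩ := Submodule.exists_sub_one_mem_and_smul_eq_zero_of_fg_of_le_smul _ _
    (IsNoetherian.noetherian (LinearMap.ker f)) hle
  intro x hx
  refine (smul_eq_zero.1 (hr0 x hx)).resolve_left ?_
  rintro rfl
  rw [Ideal.mem_span_singleton, zero_sub, dvd_neg] at hr
  exact hm (isUnit_of_dvd_one hr)

/-- A homomorphism that is invertible modulo `m` is congruent to an isomorphism modulo a divisor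
`N` of `m` if the units modulo `m` lift to units modulo `N`. -/
theorem exists_linearEquiv_eq_add_smul [Module.Finite R L'] [Module.IsTorsionFree R L']
    {m N : R} (hm0 : m ≠ 0) (hm : ¬ IsUnit m) (hN : N ∣ m)
    (hunit : ∀ r s : R, m ∣ r * s - 1 → ∃ ε : Rˣ, N ∣ (ε : R) - r)
    (a : L →ₗ[R] L') (b : L' →ₗ[R] L)
    (hba : ∀ x, ∃ z, b (a x) = x + m • z) (hab : ∀ y, ∃ z, a (b y) = y + m • z) :
    ∃ (φ : L ≃ₗ[R] L') (ψ : L →ₗ[R] L') (ψ' : L' →ₗ[R] L),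
      (∀ x, φ x = a x + N • ψ x) ∧ ∀ y, φ.symm y = b y + N • ψ' y := by
  have : Module.Free R L := Module.free_of_finite_type_torsion_free'
  have : Module.Free R L' := Module.free_of_finite_type_torsion_free'
  have ha : Function.Injective a :=
    Function.Injective.of_comp (f := b) ((b ∘ₗ a).injective_of_eq_add_smul hm0 hm hba)
  have hb : Function.Injective b :=
    Function.Injective.of_comp (f := a) ((a ∘ₗ b).injective_of_eq_add_smul hm0 hm hab)
  -- In bases adapted to the image, `a` is diagonal with the entries `c i`. Injections in both
  -- directions make the ranks equal, so no basis vector of `L'` is missed by `f`.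
  obtain ⟨n, bM, bN, f, c, hc⟩ :=
    Submodule.smithNormalForm (Module.finBasis R L') (LinearMap.range a)
  let e := LinearEquiv.ofInjective a ha
  let bL := bN.map e.symm
  have haL (i) : a (bL i) = c i • bM (f i) := by
    rw [← hc]
    exact congrArg Subtype.val (e.apply_symm_apply (bN i))
  have hcard : n = Module.finrank R L' := by
    have h1 := Module.finrank_eq_card_basis bL
    rw [Fintype.card_fin] at h1
    rw [← h1]
    exact le_antisymm (LinearMap.finrank_le_finrank_of_injective ha)
      (LinearMap.finrank_le_finrank_of_injective hb)
  have hf : Function.Bijective f :=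
    (Fintype.bijective_iff_injective_and_card f).2 ⟨f.injective, by simpa using hcard⟩
  -- The coordinate at `f i` of `a (b y) = y + m z`, for `y` the basis vector `bM (f i)`, says that
  -- `c i` is invertible modulo `m`.
  have hε (i) : ∃ ε : Rˣ, N ∣ (ε : R) - c i := by
    obtain ⟨z, hz⟩ := hab (bM (f i))
    refine hunit (c i) (bL.repr (b (bM (f i))) i) ⟨bM.repr z (f i), ?_⟩
    have h1 := congrArg (fun y => bM.repr y (f i)) hz
    have h2 : bM.repr (a (b (bM (f i)))) (f i) = c i * bL.repr (b (bM (f i))) i := by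
      conv_lhs => rw [← bL.sum_repr (b (bM (f i)))]
      simp only [map_sum, map_smul, haL, Finsupp.coe_finsetSum, Finset.sum_apply,
        Finsupp.smul_apply, Module.Basis.repr_self, smul_eq_mul]
      rw [Finset.sum_eq_single i]
      · rw [Finsupp.single_eq_same]; ring
      · intro j _ hj
        rw [Finsupp.single_eq_of_ne (fun h => hj (f.injective h).symm)]
        ring
      · simp
    simp only [map_add, map_smul, Finsupp.add_apply, Finsupp.smul_apply, Module.Basis.repr_self,
      Finsupp.single_eq_same, smul_eq_mul] at h1
    rw [← h2, h1]
    ring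
  choose ε hε using hε
  -- Replacing each diagonal entry `c i` by the unit `ε i` gives the isomorphism; it differs from
  -- `a` by a multiple of `N`.
  let φ : L ≃ₗ[R] L' := bL.equiv ((bM.reindex (Equiv.ofBijective f hf).symm).unitsSMul ε)
    (Equiv.refl _)
  have hφ (i) : φ (bL i) = (ε i : R) • bM (f i) := by
    simp [φ, Module.Basis.unitsSMul_apply, Units.smul_def]
  obtain ⟨ψ, hψ⟩ := LinearMap.exists_eq_smul_of_basis bL (φ.toLinearMap - a) N fun i => by
    obtain ⟨k, hk⟩ := hε i
    refine ⟨k • bM (f i), ?_⟩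
    rw [LinearMap.sub_apply, LinearEquiv.coe_coe, hφ, haL, ← sub_smul, hk, mul_smul]
  have hψ' (x) : φ x = a x + N • ψ x := by
    rw [← LinearMap.smul_apply, ← hψ]
    simp
  -- After applying `φ`, the difference `φ⁻¹ y - b y` becomes `y - a (b y) - N ψ (b y)`, and `y - a
  -- (b y)` is a multiple of `m`, hence of `N`.
  obtain ⟨ψ', hψ''⟩ := LinearMap.exists_eq_smul_of_basis bM (φ.symm.toLinearMap - b) N fun i => by
    obtain ⟨z, hz⟩ := hab (bM i)
    obtain ⟨k, hk⟩ := hN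
    refine ⟨- φ.symm (k • z + ψ (b (bM i))), ?_⟩
    apply φ.injective
    simp only [LinearMap.sub_apply, LinearEquiv.coe_coe, map_sub, map_smul, map_neg,
      LinearEquiv.apply_symm_apply]
    rw [hψ', hz, hk]
    module
  refine ⟨φ, ψ, ψ', hψ', fun y => ?_⟩
  rw [← LinearMap.smul_apply, ← hψ'']
  simp

end lifting

namespace CubicDiagram

/-! ### Morphisms of torsion free modules are determined on the isotypic sublattices -/

section

variable {R : Type} [CommRing R] {D E : CubicDiagram R}

namespace Hom

variable (f : Hom D E)

@[simp]
theorem t₁ (x : D.V₃) : f.f₃ (D.t₁ x) = E.t₁ (f.f₃ x) := by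
  simp [t₁_apply]

@[simp]
theorem t₂ (x : D.V₃) : f.f₃ (D.t₂ x) = E.t₂ (f.f₃ x) := by
  simp [t₂_apply]

theorem mem_isoLin {x : D.V₁} (hx : x ∈ D.isoLin) : f.f₁ x ∈ E.isoLin := by
  simp_all [CubicDiagram.mem_isoLin, ← f.h]

theorem mem_isoAlt {x : D.V₂} (hx : x ∈ D.isoAlt) : f.f₂ x ∈ E.isoAlt := by
  simp_all [CubicDiagram.mem_isoAlt, ← f.h₁, ← f.h₂, ← f.p]

theorem mem_isoSym {x : D.V₂} (hx : x ∈ D.isoSym) : f.f₂ x ∈ E.isoSym := by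
  obtain ⟨⟨a, b⟩, c⟩ := CubicDiagram.mem_isoSym.1 hx
  refine CubicDiagram.mem_isoSym.2 ⟨⟨?_, ?_⟩, ?_⟩
  · rw [← f.h₁, a, map_zero]
  · rw [← f.h₂, b, map_zero]
  · rw [← f.p, ← f.h, c, map_smul]

theorem mem_isoSym₃ {x : D.V₃} (hx : x ∈ D.isoSym₃) : f.f₃ x ∈ E.isoSym₃ := by
  simp_all [CubicDiagram.mem_isoSym₃, ← f.t₁, ← f.t₂]

theorem mem_isoAlt₃ {x : D.V₃} (hx : x ∈ D.isoAlt₃) : f.f₃ x ∈ E.isoAlt₃ := by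
  simp_all [CubicDiagram.mem_isoAlt₃, ← f.p₁, ← f.p₂]

theorem mem_isoStd {x : D.V₃} (hx : x ∈ D.isoStd) : f.f₃ x ∈ E.isoStd := by
  rw [CubicDiagram.mem_isoStd] at hx ⊢
  rw [← f.t₁, ← f.t₂, ← f.t₁, ← map_add, ← map_add, hx.1, hx.2, map_zero]
  exact ⟨rfl, rfl⟩

end Hom

/-- Six or four times an element is a sum of translates of its isotypic components and of elements
that come from a vertex already treated. The order is therefore `V₃`, then `V₂`, whose remaining
part is the image of `p₁` and `p₂`, then `V₁`, whose remaining part is the image of `p`. -/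
theorem Hom.eq_zero_of_iso [IsDomain R] [CharZero R] [Fact D.IsAModule]
    [Module.IsTorsionFree R E.V₁] [Module.IsTorsionFree R E.V₂] [Module.IsTorsionFree R E.V₃]
    (f : Hom D E) (h₁ : ∀ x ∈ D.isoLin, f.f₁ x = 0) (h₂ : ∀ x ∈ D.isoAlt, f.f₂ x = 0)
    (h₃ : ∀ x ∈ D.isoSym, f.f₂ x = 0) (h₄ : ∀ x ∈ D.isoSym₃, f.f₃ x = 0)
    (h₅ : ∀ x ∈ D.isoAlt₃, f.f₃ x = 0) (h₆ : ∀ x ∈ D.isoStd, f.f₃ x = 0) :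
    (∀ x, f.f₁ x = 0) ∧ (∀ x, f.f₂ x = 0) ∧ ∀ x, f.f₃ x = 0 := by
  have k₃ (x) : f.f₃ x = 0 := by
    refine (smul_eq_zero.1 (?_ : (6 : R) • f.f₃ x = 0)).resolve_left (by norm_num)
    have e : (6 : R) • x = D.toSym₃ x + D.toAlt₃ x -
        (2 : R) • (D.t₂ (D.toStd x) + D.t₁ (D.t₂ (D.toStd (D.t₁ x)))) := by
      simp only [coe_toSym₃, coe_toAlt₃, coe_toStd, map_add, map_sub, t₁_t₁, t₂_t₂, t₂_t₁_t₂]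
      module
    rw [← map_smul, e]
    simp only [map_add, map_sub, map_smul, Hom.t₁, Hom.t₂, h₄ _ (D.toSym₃ x).2,
      h₅ _ (D.toAlt₃ x).2, h₆ _ (D.toStd _).2]
    simp
  have k₂ (x) : f.f₂ x = 0 := by
    refine (smul_eq_zero.1 (?_ : (4 : R) • f.f₂ x = 0)).resolve_left (by norm_num)
    have e : (4 : R) • x = D.toAlt x + D.toSym x + (2 : R) • (D.p₁ (D.h₁ x) + D.p₂ (D.h₂ x)) := by
      simp only [coe_toAlt, coe_toSym, bil_apply]
      module
    rw [← map_smul, e]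
    simp only [map_add, map_smul, h₂ _ (D.toAlt x).2, h₃ _ (D.toSym x).2, Hom.p₁, Hom.p₂, k₃]
    simp
  refine ⟨fun x => ?_, k₂, k₃⟩
  refine (smul_eq_zero.1 (?_ : (6 : R) • f.f₁ x = 0)).resolve_left (by norm_num)
  have e : (6 : R) • x = D.toLin x + D.p ((3 : R) • D.h x - (2 : R) • D.p₁ (D.h₁ (D.h x))) := by
    simp only [coe_toLin, lin_apply, map_sub, map_smul]
    module
  rw [← map_smul, e, map_add, h₁ _ (D.toLin x).2, Hom.p, k₂]
  simp

end

/-! ### Torsion free modules that are isomorphic modulo `12` are isomorphic -/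

/-- Saturation of `P` and `Q` makes the restrictions of `f` and `g` inverse to each other modulo `m`
within these submodules, so `exists_linearEquiv_eq_add_smul` applies to them. -/
theorem exists_submodule_equiv_eq_add_smul {R : Type} [CommRing R] [IsDomain R]
    [IsPrincipalIdealRing R] {V W : Type} [AddCommGroup V] [Module R V]
    [AddCommGroup W] [Module R W] [Module.Finite R V] [Module.IsTorsionFree R V]
    [Module.Finite R W] [Module.IsTorsionFree R W]
    {m N : R} (hm0 : m ≠ 0) (hm : ¬ IsUnit m) (hN : N ∣ m)
    (hunit : ∀ r s : R, m ∣ r * s - 1 → ∃ ε : Rˣ, N ∣ (ε : R) - r)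
    {P : Submodule R V} {Q : Submodule R W} (hP : ∀ z, m • z ∈ P → z ∈ P)
    (hQ : ∀ z, m • z ∈ Q → z ∈ Q) (f : V →ₗ[R] W) (g : W →ₗ[R] V) (hf : ∀ x ∈ P, f x ∈ Q)
    (hg : ∀ y ∈ Q, g y ∈ P) (hgf : ∀ x, ∃ z, g (f x) = x + m • z)
    (hfg : ∀ y, ∃ z, f (g y) = y + m • z) :
    ∃ (φ : P ≃ₗ[R] Q) (ψ : P →ₗ[R] Q) (ψ' : Q →ₗ[R] P),
      (∀ x, (φ x : W) = f x + N • (ψ x : W)) ∧ ∀ y, (φ.symm y : V) = g y + N • (ψ' y : V) := by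
  have k (x : P) : ∃ z, g.restrict hg (f.restrict hf x) = x + m • z := by
    obtain ⟨z, hz⟩ := hgf x
    refine ⟨⟨z, hP z ?_⟩, Subtype.ext hz⟩
    rw [← add_sub_cancel_left (x : V) (m • z), ← hz]
    exact P.sub_mem (hg _ (hf _ x.2)) x.2
  have k' (y : Q) : ∃ z, f.restrict hf (g.restrict hg y) = y + m • z := by
    obtain ⟨z, hz⟩ := hfg y
    refine ⟨⟨z, hQ z ?_⟩, Subtype.ext hz⟩
    rw [← add_sub_cancel_left (y : W) (m • z), ← hz]
    exact Q.sub_mem (hf _ (hg _ y.2)) y.2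
  obtain ⟨φ, ψ, ψ', h, h'⟩ := exists_linearEquiv_eq_add_smul hm0 hm hN hunit
    (f.restrict hf) (g.restrict hg) k k'
  exact ⟨φ, ψ, ψ', fun x => congrArg Subtype.val (h x), fun y => congrArg Subtype.val (h' y)⟩

section genus

variable {R : Type} [CommRing R] [IsDomain R] [CharZero R] {D E : CubicDiagram R}

/-- Each of the six extensions vanishes on the other five sublattices, so they can be added to `α`
without interfering. -/
theorem exists_hom_add [Fact D.IsAModule] [Fact E.IsAModule] [Module.IsTorsionFree R E.V₁]
    (α : Hom D E) (ψ₁ : D.isoLin →ₗ[R] E.isoLin) (ψ₂ : D.isoAlt →ₗ[R] E.isoAlt)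
    (ψ₃ : D.isoSym →ₗ[R] E.isoSym) (ψ₄ : D.isoSym₃ →ₗ[R] E.isoSym₃)
    (ψ₅ : D.isoAlt₃ →ₗ[R] E.isoAlt₃) (ψ₆ : D.isoStd →ₗ[R] E.isoStd) : ∃ f : Hom D E,
      (∀ x : D.isoLin, f.f₁ x = α.f₁ x + (6 : R) • (ψ₁ x : E.V₁)) ∧
      (∀ x : D.isoAlt, f.f₂ x = α.f₂ x + (4 : R) • (ψ₂ x : E.V₂)) ∧
      (∀ x : D.isoSym, f.f₂ x = α.f₂ x + (4 : R) • (ψ₃ x : E.V₂)) ∧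
      (∀ x : D.isoSym₃, f.f₃ x = α.f₃ x + (6 : R) • (ψ₄ x : E.V₃)) ∧
      (∀ x : D.isoAlt₃, f.f₃ x = α.f₃ x + (6 : R) • (ψ₅ x : E.V₃)) ∧
      (∀ x : D.isoStd, f.f₃ x = α.f₃ x + (6 : R) • (ψ₆ x : E.V₃)) := by
  obtain ⟨f₁, a₁, b₁, c₁⟩ := exists_hom_isoLin ψ₁
  obtain ⟨f₂, a₂, b₂, c₂, d₂⟩ := exists_hom_isoAlt ψ₂
  obtain ⟨f₃, a₃, b₃, c₃, d₃⟩ := exists_hom_isoSym ψ₃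
  obtain ⟨f₄, a₄, b₄, c₄, d₄, e₄⟩ := exists_hom_isoSym₃ ψ₄
  obtain ⟨f₅, a₅, b₅, c₅, d₅, e₅⟩ := exists_hom_isoAlt₃ ψ₅
  obtain ⟨f₆, a₆, b₆, c₆, d₆, e₆⟩ := exists_hom_isoStd ψ₆
  refine ⟨((((((α.add f₁).add f₂).add f₃).add f₄).add f₅).add f₆), ?_, ?_, ?_, ?_, ?_, ?_⟩
  all_goals intro x; simp only [Hom.add, LinearMap.add_apply]
  · rw [a₁, b₂, c₃ x x.2, b₄ x x.2, b₅, b₆]; simp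
  · obtain ⟨⟨h, h'⟩, -⟩ := mem_isoAlt.1 x.2
    rw [b₁, a₂, d₃ x x.2, c₄ x h h', c₅, c₆ x h h']; simp
  · obtain ⟨⟨h, h'⟩, -⟩ := mem_isoSym.1 x.2
    rw [b₁, d₂ x x.2, a₃, c₄ x h h', c₅, c₆ x h h']; simp
  · rw [c₁, c₂, b₃, a₄, d₅ x x.2, e₆ x x.2]; simp
  · rw [c₁, c₂, b₃, d₄ x x.2, a₅, d₆ x x.2]; simp
  · rw [c₁, c₂, b₃, e₄ x x.2, e₅ x x.2, a₆]; simp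

theorem Hom.comp_eq_id [Fact D.IsAModule] [Module.IsTorsionFree R D.V₁]
    [Module.IsTorsionFree R D.V₂] [Module.IsTorsionFree R D.V₃] (g : Hom E D) (f : Hom D E)
    (h₁ : ∀ x ∈ D.isoLin, g.f₁ (f.f₁ x) = x) (h₂ : ∀ x ∈ D.isoAlt, g.f₂ (f.f₂ x) = x)
    (h₃ : ∀ x ∈ D.isoSym, g.f₂ (f.f₂ x) = x) (h₄ : ∀ x ∈ D.isoSym₃, g.f₃ (f.f₃ x) = x)
    (h₅ : ∀ x ∈ D.isoAlt₃, g.f₃ (f.f₃ x) = x) (h₆ : ∀ x ∈ D.isoStd, g.f₃ (f.f₃ x) = x) :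
    (∀ x, g.f₁ (f.f₁ x) = x) ∧ (∀ x, g.f₂ (f.f₂ x) = x) ∧ ∀ x, g.f₃ (f.f₃ x) = x := by
  obtain ⟨k₁, k₂, k₃⟩ := Hom.eq_zero_of_iso ((g.comp f).add (Hom.smul (-1) (Hom.id D)))
    (fun x hx => by simp [Hom.comp, Hom.add, Hom.smul, Hom.id, h₁ x hx])
    (fun x hx => by simp [Hom.comp, Hom.add, Hom.smul, Hom.id, h₂ x hx])
    (fun x hx => by simp [Hom.comp, Hom.add, Hom.smul, Hom.id, h₃ x hx])
    (fun x hx => by simp [Hom.comp, Hom.add, Hom.smul, Hom.id, h₄ x hx])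
    (fun x hx => by simp [Hom.comp, Hom.add, Hom.smul, Hom.id, h₅ x hx])
    (fun x hx => by simp [Hom.comp, Hom.add, Hom.smul, Hom.id, h₆ x hx])
  refine ⟨fun x => ?_, fun x => ?_, fun x => ?_⟩
  · simpa [Hom.comp, Hom.add, Hom.smul, Hom.id, ← sub_eq_add_neg, sub_eq_zero] using k₁ x
  · simpa [Hom.comp, Hom.add, Hom.smul, Hom.id, ← sub_eq_add_neg, sub_eq_zero] using k₂ x
  · simpa [Hom.comp, Hom.add, Hom.smul, Hom.id, ← sub_eq_add_neg, sub_eq_zero] using k₃ x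

variable [IsPrincipalIdealRing R]

/-- Two torsion free modules over `𝐀 ⊗ R` are isomorphic if there are morphisms between them that
are inverse to each other modulo `12`, provided that the units modulo `12` lift to units modulo
`4` and modulo `6`. -/
theorem isomorphic_of_hom_mod_twelve (h12 : ¬ IsUnit (12 : R))
    (h4 : ∀ r s : R, 12 ∣ r * s - 1 → ∃ ε : Rˣ, 4 ∣ (ε : R) - r)
    (h6 : ∀ r s : R, 12 ∣ r * s - 1 → ∃ ε : Rˣ, 6 ∣ (ε : R) - r)
    (hD : D.IsTorsionFreeAModule) (hE : E.IsTorsionFreeAModule) (α : Hom D E) (β : Hom E D)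
    (k₁ : ∀ x, ∃ z, β.f₁ (α.f₁ x) = x + (12 : R) • z)
    (k₂ : ∀ x, ∃ z, β.f₂ (α.f₂ x) = x + (12 : R) • z)
    (k₃ : ∀ x, ∃ z, β.f₃ (α.f₃ x) = x + (12 : R) • z)
    (l₁ : ∀ x, ∃ z, α.f₁ (β.f₁ x) = x + (12 : R) • z)
    (l₂ : ∀ x, ∃ z, α.f₂ (β.f₂ x) = x + (12 : R) • z)
    (l₃ : ∀ x, ∃ z, α.f₃ (β.f₃ x) = x + (12 : R) • z) : D.Isomorphic E := by
  obtain ⟨aD, _, _, _, _, _, _⟩ := hD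
  obtain ⟨aE, _, _, _, _, _, _⟩ := hE
  have := Fact.mk aD
  have := Fact.mk aE
  have h0 : (12 : R) ≠ 0 := by norm_num
  have d4 : (4 : R) ∣ 12 := ⟨3, by norm_num⟩
  have d6 : (6 : R) ∣ 12 := ⟨2, by norm_num⟩
  obtain ⟨φ₁, ψ₁, χ₁, a₁, b₁⟩ := exists_submodule_equiv_eq_add_smul h0 h12 d6 h6
    (P := D.isoLin) (Q := E.isoLin) (fun z hz => LinearMap.mem_ker_of_smul_mem h0 _ hz)
    (fun z hz => LinearMap.mem_ker_of_smul_mem h0 _ hz) α.f₁ β.f₁ (fun _ => α.mem_isoLin)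
    (fun _ => β.mem_isoLin) k₁ l₁
  obtain ⟨φ₂, ψ₂, χ₂, a₂, b₂⟩ := exists_submodule_equiv_eq_add_smul h0 h12 d4 h4
    (P := D.isoAlt) (Q := E.isoAlt) (fun z hz => ⟨⟨LinearMap.mem_ker_of_smul_mem h0 _ hz.1.1,
      LinearMap.mem_ker_of_smul_mem h0 _ hz.1.2⟩, LinearMap.mem_ker_of_smul_mem h0 _ hz.2⟩)
    (fun z hz => ⟨⟨LinearMap.mem_ker_of_smul_mem h0 _ hz.1.1,
      LinearMap.mem_ker_of_smul_mem h0 _ hz.1.2⟩, LinearMap.mem_ker_of_smul_mem h0 _ hz.2⟩)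
    α.f₂ β.f₂
    (fun _ => α.mem_isoAlt) (fun _ => β.mem_isoAlt) k₂ l₂
  obtain ⟨φ₃, ψ₃, χ₃, a₃, b₃⟩ := exists_submodule_equiv_eq_add_smul h0 h12 d4 h4
    (P := D.isoSym) (Q := E.isoSym) (fun z hz => ⟨⟨LinearMap.mem_ker_of_smul_mem h0 _ hz.1.1,
      LinearMap.mem_ker_of_smul_mem h0 _ hz.1.2⟩, LinearMap.mem_ker_of_smul_mem h0 _ hz.2⟩)
    (fun z hz => ⟨⟨LinearMap.mem_ker_of_smul_mem h0 _ hz.1.1,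
      LinearMap.mem_ker_of_smul_mem h0 _ hz.1.2⟩, LinearMap.mem_ker_of_smul_mem h0 _ hz.2⟩)
    α.f₂ β.f₂
    (fun _ => α.mem_isoSym) (fun _ => β.mem_isoSym) k₂ l₂
  obtain ⟨φ₄, ψ₄, χ₄, a₄, b₄⟩ := exists_submodule_equiv_eq_add_smul h0 h12 d6 h6
    (P := D.isoSym₃) (Q := E.isoSym₃)
    (fun z hz => ⟨LinearMap.mem_ker_of_smul_mem h0 _ hz.1, LinearMap.mem_ker_of_smul_mem h0 _ hz.2⟩)
    (fun z hz => ⟨LinearMap.mem_ker_of_smul_mem h0 _ hz.1, LinearMap.mem_ker_of_smul_mem h0 _ hz.2⟩)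
    α.f₃ β.f₃
    (fun _ => α.mem_isoSym₃) (fun _ => β.mem_isoSym₃) k₃ l₃
  obtain ⟨φ₅, ψ₅, χ₅, a₅, b₅⟩ := exists_submodule_equiv_eq_add_smul h0 h12 d6 h6
    (P := D.isoAlt₃) (Q := E.isoAlt₃)
    (fun z hz => ⟨LinearMap.mem_ker_of_smul_mem h0 _ hz.1, LinearMap.mem_ker_of_smul_mem h0 _ hz.2⟩)
    (fun z hz => ⟨LinearMap.mem_ker_of_smul_mem h0 _ hz.1, LinearMap.mem_ker_of_smul_mem h0 _ hz.2⟩)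
    α.f₃ β.f₃
    (fun _ => α.mem_isoAlt₃) (fun _ => β.mem_isoAlt₃) k₃ l₃
  obtain ⟨φ₆, ψ₆, χ₆, a₆, b₆⟩ := exists_submodule_equiv_eq_add_smul h0 h12 d6 h6
    (P := D.isoStd) (Q := E.isoStd)
    (fun z hz => ⟨LinearMap.mem_ker_of_smul_mem h0 _ hz.1, LinearMap.mem_ker_of_smul_mem h0 _ hz.2⟩)
    (fun z hz => ⟨LinearMap.mem_ker_of_smul_mem h0 _ hz.1, LinearMap.mem_ker_of_smul_mem h0 _ hz.2⟩)
    α.f₃ β.f₃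
    (fun _ => α.mem_isoStd) (fun _ => β.mem_isoStd) k₃ l₃
  -- The corrected morphisms `f` and `g` restrict to `φᵢ` and its inverse on each isotypic
  -- sublattice, hence are inverse to each other by `Hom.comp_eq_id`.
  obtain ⟨f, c₁, c₂, c₃, c₄, c₅, c₆⟩ := exists_hom_add α ψ₁ ψ₂ ψ₃ ψ₄ ψ₅ ψ₆
  obtain ⟨g, d₁, d₂, d₃, d₄, d₅, d₆⟩ := exists_hom_add β χ₁ χ₂ χ₃ χ₄ χ₅ χ₆
  simp only [← a₁, ← a₂, ← a₃, ← a₄, ← a₅, ← a₆] at c₁ c₂ c₃ c₄ c₅ c₆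
  simp only [← b₁, ← b₂, ← b₃, ← b₄, ← b₅, ← b₆] at d₁ d₂ d₃ d₄ d₅ d₆
  obtain ⟨m₁, m₂, m₃⟩ := Hom.comp_eq_id g f
    (fun x hx => by rw [c₁ ⟨x, hx⟩, d₁, LinearEquiv.symm_apply_apply])
    (fun x hx => by rw [c₂ ⟨x, hx⟩, d₂, LinearEquiv.symm_apply_apply])
    (fun x hx => by rw [c₃ ⟨x, hx⟩, d₃, LinearEquiv.symm_apply_apply])
    (fun x hx => by rw [c₄ ⟨x, hx⟩, d₄, LinearEquiv.symm_apply_apply])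
    (fun x hx => by rw [c₅ ⟨x, hx⟩, d₅, LinearEquiv.symm_apply_apply])
    (fun x hx => by rw [c₆ ⟨x, hx⟩, d₆, LinearEquiv.symm_apply_apply])
  obtain ⟨n₁, n₂, n₃⟩ := Hom.comp_eq_id f g
    (fun x hx => by rw [d₁ ⟨x, hx⟩, c₁, LinearEquiv.apply_symm_apply])
    (fun x hx => by rw [d₂ ⟨x, hx⟩, c₂, LinearEquiv.apply_symm_apply])
    (fun x hx => by rw [d₃ ⟨x, hx⟩, c₃, LinearEquiv.apply_symm_apply])
    (fun x hx => by rw [d₄ ⟨x, hx⟩, c₄, LinearEquiv.apply_symm_apply])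
    (fun x hx => by rw [d₅ ⟨x, hx⟩, c₅, LinearEquiv.apply_symm_apply])
    (fun x hx => by rw [d₆ ⟨x, hx⟩, c₆, LinearEquiv.apply_symm_apply])
  exact ⟨.ofLinearMap f.f₁ g.f₁ (LinearMap.ext n₁) (LinearMap.ext m₁),
    .ofLinearMap f.f₂ g.f₂ (LinearMap.ext n₂) (LinearMap.ext m₂),
    .ofLinearMap f.f₃ g.f₃ (LinearMap.ext n₃) (LinearMap.ext m₃), f.h, f.p, f.h₁, f.h₂, f.p₁, f.p₂⟩

end genus

end CubicDiagram
end

/-! ### Lattices over `ℤ` and over its localizations. -/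

noncomputable section

namespace CubicDiagram

/-! ### Finitely generated stable subgroups -/

section closure

variable {R : Type} [CommRing R] (D : CubicDiagram R)

/-- A family of subgroups of the components that is stable under the structure maps. -/
structure IsStable (H₁ : Submodule ℤ D.V₁) (H₂ : Submodule ℤ D.V₂) (H₃ : Submodule ℤ D.V₃) :
    Prop where
  h : ∀ x ∈ H₁, D.h x ∈ H₂
  p : ∀ x ∈ H₂, D.p x ∈ H₁
  h₁ : ∀ x ∈ H₂, D.h₁ x ∈ H₃
  h₂ : ∀ x ∈ H₂, D.h₂ x ∈ H₃
  p₁ : ∀ x ∈ H₃, D.p₁ x ∈ H₂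
  p₂ : ∀ x ∈ H₃, D.p₂ x ∈ H₂

/-- With `a = h₁ p₁` and `b = h₂ p₂` the relations are `a² = 2 a`, `b² = 2 b` and `b a b = a b a - a
+ b`. Every word is thus an integral combination of `1, a, b, a b, b a, a b a`, and six images of
`K` suffice. -/
theorem exists_isStable₃ [Fact D.IsAModule] {K : Submodule ℤ D.V₃} (hK : K.FG) :
    ∃ H : Submodule ℤ D.V₃, H.FG ∧ K ≤ H ∧ (∀ x ∈ H, D.h₁ (D.p₁ x) ∈ H) ∧
      (∀ x ∈ H, D.h₂ (D.p₂ x) ∈ H) ∧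
      ∀ N : Submodule ℤ D.V₃, K ≤ N → (∀ x ∈ N, D.h₁ (D.p₁ x) ∈ N) →
        (∀ x ∈ N, D.h₂ (D.p₂ x) ∈ N) → H ≤ N := by
  let a : D.V₃ →ₗ[ℤ] D.V₃ := (D.h₁ ∘ₗ D.p₁).toAddMonoidHom.toIntLinearMap
  let b : D.V₃ →ₗ[ℤ] D.V₃ := (D.h₂ ∘ₗ D.p₂).toAddMonoidHom.toIntLinearMap
  have ha (x) : a x = D.h₁ (D.p₁ x) := rfl
  have hb (x) : b x = D.h₂ (D.p₂ x) := rfl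
  have haa (x) : a (a x) = a x + a x := by simp [ha, two_smul]
  have hbb (x) : b (b x) = b x + b x := by simp [hb, two_smul]
  have hbab (x) : b (a (b x)) = a (b (a x)) - a x + b x := by simp [ha, hb]
  let H : Submodule ℤ D.V₃ := K ⊔ K.map a ⊔ K.map b ⊔ (K.map b).map a ⊔ (K.map a).map b ⊔
    ((K.map a).map b).map a
  have m₅ : ((K.map a).map b).map a ≤ H := le_sup_right
  have m₄ : (K.map a).map b ≤ H := le_sup_right.trans le_sup_left
  have m₃ : (K.map b).map a ≤ H := le_sup_right.trans (le_sup_left.trans le_sup_left)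
  have m₂ : K.map b ≤ H :=
    le_sup_right.trans (le_sup_left.trans (le_sup_left.trans le_sup_left))
  have m₁ : K.map a ≤ H := le_sup_right.trans (le_sup_left.trans (le_sup_left.trans
    (le_sup_left.trans le_sup_left)))
  have m₀ : K ≤ H := le_sup_left.trans (le_sup_left.trans (le_sup_left.trans
    (le_sup_left.trans le_sup_left)))
  replace m₅ (x) (hx : x ∈ K) : a (b (a x)) ∈ H := m₅ ⟨_, ⟨_, ⟨x, hx, rfl⟩, rfl⟩, rfl⟩
  replace m₄ (x) (hx : x ∈ K) : b (a x) ∈ H := m₄ ⟨_, ⟨x, hx, rfl⟩, rfl⟩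
  replace m₃ (x) (hx : x ∈ K) : a (b x) ∈ H := m₃ ⟨_, ⟨x, hx, rfl⟩, rfl⟩
  replace m₂ (x) (hx : x ∈ K) : b x ∈ H := m₂ ⟨x, hx, rfl⟩
  replace m₁ (x) (hx : x ∈ K) : a x ∈ H := m₁ ⟨x, hx, rfl⟩
  have key (N : Submodule ℤ D.V₃) (n₀ : ∀ x ∈ K, x ∈ N) (n₁ : ∀ x ∈ K, a x ∈ N)
      (n₂ : ∀ x ∈ K, b x ∈ N) (n₃ : ∀ x ∈ K, a (b x) ∈ N) (n₄ : ∀ x ∈ K, b (a x) ∈ N)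
      (n₅ : ∀ x ∈ K, a (b (a x)) ∈ N) : H ≤ N := by
    refine sup_le (sup_le (sup_le (sup_le (sup_le n₀ ?_) ?_) ?_) ?_) ?_
    · rintro _ ⟨x, hx, rfl⟩; exact n₁ x hx
    · rintro _ ⟨x, hx, rfl⟩; exact n₂ x hx
    · rintro _ ⟨_, ⟨x, hx, rfl⟩, rfl⟩; exact n₃ x hx
    · rintro _ ⟨_, ⟨x, hx, rfl⟩, rfl⟩; exact n₄ x hx
    · rintro _ ⟨_, ⟨_, ⟨x, hx, rfl⟩, rfl⟩, rfl⟩; exact n₅ x hx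
  refine ⟨H, ?_, m₀, ?_, ?_, ?_⟩
  · exact ((((hK.sup (hK.map a)).sup (hK.map b)).sup ((hK.map b).map a)).sup
      ((hK.map a).map b)).sup (((hK.map a).map b).map a)
  · refine key (H.comap a) m₁ (fun x hx => ?_) m₃ (fun x hx => ?_) m₅ (fun x hx => ?_) <;>
      rw [Submodule.mem_comap, haa]
    · exact add_mem (m₁ x hx) (m₁ x hx)
    · exact add_mem (m₃ x hx) (m₃ x hx)
    · exact add_mem (m₅ x hx) (m₅ x hx)
  · refine key (H.comap b) m₂ m₄ (fun x hx => ?_) (fun x hx => ?_) (fun x hx => ?_)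
      (fun x hx => ?_) <;> rw [Submodule.mem_comap]
    · rw [hbb]; exact add_mem (m₂ x hx) (m₂ x hx)
    · rw [hbab]; exact add_mem (sub_mem (m₅ x hx) (m₁ x hx)) (m₂ x hx)
    · rw [hbb]; exact add_mem (m₄ x hx) (m₄ x hx)
    · rw [hbab, haa, map_add, map_add]
      exact add_mem (sub_mem (add_mem (m₅ x hx) (m₅ x hx)) (add_mem (m₁ x hx) (m₁ x hx)))
        (m₄ x hx)
  · intro N hN n₁ n₂
    exact key N hN (fun x hx => n₁ _ (hN hx)) (fun x hx => n₂ _ (hN hx))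
      (fun x hx => n₁ _ (n₂ _ (hN hx))) (fun x hx => n₂ _ (n₁ _ (hN hx)))
      (fun x hx => n₁ _ (n₂ _ (n₁ _ (hN hx))))

/-- The subgroups that are generated under the structure maps by finitely generated subgroups are
finitely generated. -/
theorem exists_isStable [Fact D.IsAModule] {G₁ : Submodule ℤ D.V₁} {G₂ : Submodule ℤ D.V₂}
    {G₃ : Submodule ℤ D.V₃} (hG₁ : G₁.FG) (hG₂ : G₂.FG) (hG₃ : G₃.FG) :
    ∃ (H₁ : Submodule ℤ D.V₁) (H₂ : Submodule ℤ D.V₂) (H₃ : Submodule ℤ D.V₃),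
      D.IsStable H₁ H₂ H₃ ∧ H₁.FG ∧ H₂.FG ∧ H₃.FG ∧ G₁ ≤ H₁ ∧ G₂ ≤ H₂ ∧ G₃ ≤ H₃ ∧
      ∀ (N₁ : Submodule ℤ D.V₁) (N₂ : Submodule ℤ D.V₂) (N₃ : Submodule ℤ D.V₃),
        D.IsStable N₁ N₂ N₃ → G₁ ≤ N₁ → G₂ ≤ N₂ → G₃ ≤ N₃ → H₁ ≤ N₁ ∧ H₂ ≤ N₂ ∧ H₃ ≤ N₃ := by
  let h : D.V₁ →ₗ[ℤ] D.V₂ := D.h.toAddMonoidHom.toIntLinearMap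
  let p : D.V₂ →ₗ[ℤ] D.V₁ := D.p.toAddMonoidHom.toIntLinearMap
  let h₁ : D.V₂ →ₗ[ℤ] D.V₃ := D.h₁.toAddMonoidHom.toIntLinearMap
  let h₂ : D.V₂ →ₗ[ℤ] D.V₃ := D.h₂.toAddMonoidHom.toIntLinearMap
  let p₁ : D.V₃ →ₗ[ℤ] D.V₂ := D.p₁.toAddMonoidHom.toIntLinearMap
  let p₂ : D.V₃ →ₗ[ℤ] D.V₂ := D.p₂.toAddMonoidHom.toIntLinearMap
  -- At the vertex 3 it suffices to close up under `h₁ p₁` and `h₂ p₂`: a path that returns to it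
  -- through the vertex 1 is rewritten by the relations for `h₁ h p` and `h p p₁`.
  obtain ⟨H₃, hH₃, hK, c₁, c₂, hmin⟩ := D.exists_isStable₃
    (((hG₃.sup (hG₂.map h₁)).sup (hG₂.map h₂)).sup ((hG₁.map h).map h₁))
  have m₀ (x) (hx : x ∈ G₃) : x ∈ H₃ := hK.trans' (le_sup_left.trans
    (le_sup_left.trans le_sup_left)) hx
  have m₁ (x) (hx : x ∈ G₂) : D.h₁ x ∈ H₃ :=
    hK.trans' (le_sup_right.trans (le_sup_left.trans le_sup_left)) (Submodule.mem_map_of_mem hx)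
  have m₂ (x) (hx : x ∈ G₂) : D.h₂ x ∈ H₃ :=
    hK.trans' (le_sup_right.trans le_sup_left) (Submodule.mem_map_of_mem hx)
  have m₃ (x) (hx : x ∈ G₁) : D.h₁ (D.h x) ∈ H₃ :=
    hK.trans' le_sup_right (Submodule.mem_map_of_mem (Submodule.mem_map_of_mem hx))
  -- No further words are needed, since the relations for `h p h` and `h p p₁` take `h p` of each
  -- summand back into this sum.
  let H₂ : Submodule ℤ D.V₂ := G₂ ⊔ (G₂.map p).map h ⊔ G₁.map h ⊔ H₃.map p₁ ⊔ H₃.map p₂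
  have n₀ : G₂ ≤ H₂ := le_sup_left.trans (le_sup_left.trans (le_sup_left.trans le_sup_left))
  have n₁ : (G₂.map p).map h ≤ H₂ :=
    le_sup_right.trans (le_sup_left.trans (le_sup_left.trans le_sup_left))
  have n₂ : G₁.map h ≤ H₂ := le_sup_right.trans (le_sup_left.trans le_sup_left)
  have n₃ : H₃.map p₁ ≤ H₂ := le_sup_right.trans le_sup_left
  have n₄ : H₃.map p₂ ≤ H₂ := le_sup_right
  replace n₁ (x) (hx : x ∈ G₂) : D.h (D.p x) ∈ H₂ := n₁ ⟨_, ⟨x, hx, rfl⟩, rfl⟩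
  replace n₂ (x) (hx : x ∈ G₁) : D.h x ∈ H₂ := n₂ ⟨x, hx, rfl⟩
  replace n₃ (x) (hx : x ∈ H₃) : D.p₁ x ∈ H₂ := n₃ ⟨x, hx, rfl⟩
  replace n₄ (x) (hx : x ∈ H₃) : D.p₂ x ∈ H₂ := n₄ ⟨x, hx, rfl⟩
  have key₂ (N : Submodule ℤ D.V₂) (l₀ : ∀ x ∈ G₂, x ∈ N) (l₁ : ∀ x ∈ G₂, D.h (D.p x) ∈ N)
      (l₂ : ∀ x ∈ G₁, D.h x ∈ N) (l₃ : ∀ x ∈ H₃, D.p₁ x ∈ N) (l₄ : ∀ x ∈ H₃, D.p₂ x ∈ N) :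
      H₂ ≤ N := by
    refine sup_le (sup_le (sup_le (sup_le l₀ ?_) ?_) ?_) ?_
    · rintro _ ⟨_, ⟨x, hx, rfl⟩, rfl⟩; exact l₁ x hx
    · rintro _ ⟨x, hx, rfl⟩; exact l₂ x hx
    · rintro _ ⟨x, hx, rfl⟩; exact l₃ x hx
    · rintro _ ⟨x, hx, rfl⟩; exact l₄ x hx
  let H₁ : Submodule ℤ D.V₁ := G₁ ⊔ (G₁.map h).map p ⊔ H₂.map p
  have o₀ : G₁ ≤ H₁ := le_sup_left.trans le_sup_left
  have o₂ : H₂.map p ≤ H₁ := le_sup_right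
  replace o₂ (x) (hx : x ∈ H₂) : D.p x ∈ H₁ := o₂ ⟨x, hx, rfl⟩
  have key₁ (N : Submodule ℤ D.V₁) (l₀ : ∀ x ∈ G₁, x ∈ N) (l₁ : ∀ x ∈ G₁, D.p (D.h x) ∈ N)
      (l₂ : ∀ x ∈ H₂, D.p x ∈ N) : H₁ ≤ N := by
    refine sup_le (sup_le l₀ ?_) ?_
    · rintro _ ⟨_, ⟨x, hx, rfl⟩, rfl⟩; exact l₁ x hx
    · rintro _ ⟨x, hx, rfl⟩; exact l₂ x hx
  have q (x) (hx : x ∈ G₂) : D.h₁ (D.h (D.p x)) ∈ H₃ := by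
    rw [h₁_h_p_apply]
    exact sub_mem (sub_mem (add_mem (c₁ _ (c₂ _ (m₁ x hx))) (c₂ _ (c₁ _ (m₂ x hx)))) (m₁ x hx))
      (m₂ x hx)
  have r (x) (hx : x ∈ G₁) : D.h (D.p (D.h x)) ∈ H₂ := by
    rw [h_p_h_apply, two_smul]
    have := add_mem (n₂ x hx) (add_mem (n₃ _ (m₃ x hx)) (n₄ _ (m₃ x hx)))
    exact add_mem this this
  refine ⟨H₁, H₂, H₃, ⟨?_, o₂, ?_, ?_, n₃, n₄⟩, ?_, ?_, hH₃, o₀, n₀, m₀, ?_⟩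
  · refine key₁ (H₂.comap h) n₂ r
      (key₂ (H₂.comap (h ∘ₗ p)) n₁ (fun x hx => ?_) r (fun x hx => ?_) (fun x hx => ?_))
    · change D.h (D.p (D.h (D.p x))) ∈ H₂
      rw [h_p_h_apply, two_smul]
      have := add_mem (n₁ x hx) (add_mem (n₃ _ (q x hx)) (n₄ _ (q x hx)))
      exact add_mem this this
    · change D.h (D.p (D.p₁ x)) ∈ H₂
      rw [h_p_p₁_apply]
      exact sub_mem (sub_mem (add_mem (n₃ _ (c₂ _ (c₁ _ hx))) (n₄ _ (c₁ _ (c₂ _ hx)))) (n₃ x hx))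
        (n₄ x hx)
    · change D.h (D.p (D.p₂ x)) ∈ H₂
      rw [p_p₂_apply, h_p_p₁_apply]
      exact sub_mem (sub_mem (add_mem (n₃ _ (c₂ _ (c₁ _ hx))) (n₄ _ (c₁ _ (c₂ _ hx)))) (n₃ x hx))
        (n₄ x hx)
  · refine key₂ (H₃.comap h₁) m₁ q m₃ c₁ (fun x hx => ?_)
    change D.h₁ (D.p₂ x) ∈ H₃
    rw [h₁_p₂_apply]
    exact zero_mem _
  · refine key₂ (H₃.comap h₂) m₂ (fun x hx => ?_) (fun x hx => ?_) (fun x hx => ?_) c₂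
    · change D.h₂ (D.h (D.p x)) ∈ H₃
      rw [h₂_h_apply]
      exact q x hx
    · change D.h₂ (D.h x) ∈ H₃
      rw [h₂_h_apply]
      exact m₃ x hx
    · change D.h₂ (D.p₁ x) ∈ H₃
      rw [h₂_p₁_apply]
      exact zero_mem _
  · exact (hG₁.sup ((hG₁.map h).map p)).sup
      (((((hG₂.sup ((hG₂.map p).map h)).sup (hG₁.map h)).sup (hH₃.map p₁)).sup (hH₃.map p₂)).map p)
  · exact (((hG₂.sup ((hG₂.map p).map h)).sup (hG₁.map h)).sup (hH₃.map p₁)).sup (hH₃.map p₂)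
  · intro N₁ N₂ N₃ hN g₁ g₂ g₃
    have l₃ : H₃ ≤ N₃ := by
      refine hmin N₃ (sup_le (sup_le (sup_le g₃ ?_) ?_) ?_) (fun x hx => hN.h₁ _ (hN.p₁ _ hx))
        (fun x hx => hN.h₂ _ (hN.p₂ _ hx))
      · rintro _ ⟨x, hx, rfl⟩; exact hN.h₁ _ (g₂ hx)
      · rintro _ ⟨x, hx, rfl⟩; exact hN.h₂ _ (g₂ hx)
      · rintro _ ⟨_, ⟨x, hx, rfl⟩, rfl⟩; exact hN.h₁ _ (hN.h _ (g₁ hx))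
    have l₂ : H₂ ≤ N₂ := key₂ N₂ g₂ (fun x hx => hN.h _ (hN.p _ (g₂ hx)))
      (fun x hx => hN.h _ (g₁ hx))
      (fun x hx => hN.p₁ _ (l₃ hx)) (fun x hx => hN.p₂ _ (l₃ hx))
    exact ⟨key₁ N₁ g₁ (fun x hx => hN.p _ (hN.h _ (g₁ hx))) (fun x hx => hN.p _ (l₂ hx)), l₂, l₃⟩

end closure

end CubicDiagram
end

noncomputable section

/-! ### Localization of abelian groups -/

/-- A component over `ℤ` carries a module structure that agrees with the canonical one of its
additive group only propositionally, while the scalar extensions use the canonical one. -/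
theorem Module.Finite.toIntModule (V : Type*) [AddCommGroup V] [i : Module ℤ V]
    [h : Module.Finite ℤ V] : @Module.Finite ℤ V _ _ (AddCommGroup.toIntModule V) := by
  rwa [← Subsingleton.elim i (AddCommGroup.toIntModule V)]

theorem Module.IsTorsionFree.isAddTorsionFree (V : Type*) [AddCommGroup V] [i : Module ℤ V]
    [h : Module.IsTorsionFree ℤ V] : IsAddTorsionFree V := by
  rw [Subsingleton.elim i (AddCommGroup.toIntModule V)] at h
  exact Module.isTorsionFree_int_iff_isAddTorsionFree.1 h

section localization

variable (S : Type) [CommRing S] (T : Submonoid ℤ) [IsLocalization T S]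
variable {V : Type} [AddCommGroup V]

theorem IsLocalization.exists_smul_eq_one_tmul (y : S ⊗[ℤ] V) :
    ∃ t ∈ T, ∃ x : V, t • y = (1 : S) ⊗ₜ[ℤ] x := by
  obtain ⟨⟨x, t⟩, h⟩ := IsLocalizedModule.surj T (TensorProduct.mk ℤ S V 1) y
  exact ⟨t, t.2, x, h⟩

variable {T} in
theorem IsLocalization.one_tmul_injective [IsAddTorsionFree V] (hT : (0 : ℤ) ∉ T) :
    Function.Injective fun x : V => (1 : S) ⊗ₜ[ℤ] x := by
  intro x y h
  obtain ⟨c, hc⟩ := IsLocalizedModule.exists_of_eq (S := T)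
    (f := TensorProduct.mk ℤ S V 1) (x₁ := x) (x₂ := y) h
  have hc0 : (c : ℤ) ≠ 0 := fun h0 => hT (h0 ▸ c.2)
  exact smul_right_injective V hc0 hc

theorem isLocalizedModule_of_injective {N : Type} [AddCommGroup N] [Module S N]
    (i : V →+ N) (hi : Function.Injective i) (hs : ∀ y, ∃ t ∈ T, ∃ x, t • y = i x) :
    IsLocalizedModule T i.toIntLinearMap where
  map_units t := by
    have := (IsLocalization.map_units S t).map (Module.toModuleEnd ℤ (S := S) N)
    convert this using 1
    ext y
    simp
  surj y := by
    obtain ⟨t, ht, x, h⟩ := hs y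
    exact ⟨(x, ⟨t, ht⟩), h⟩
  exists_of_eq h := ⟨1, by rw [hi h]⟩

/-- An additive map into a localization that is defined on a finitely generated group takes values
in the group itself after multiplication by a denominator. -/
theorem IsLocalization.exists_smul_eq_one_tmul_of_finite {W : Type} [AddCommGroup W]
    [Module.Finite ℤ V] (g : V →+ S ⊗[ℤ] W) :
    ∃ t ∈ T, ∀ x, ∃ y : W, t • g x = (1 : S) ⊗ₜ[ℤ] y := by
  classical
  obtain ⟨s, hs⟩ := Module.Finite.fg_top (R := ℤ) (M := V)
  choose t ht y hy using fun x => IsLocalization.exists_smul_eq_one_tmul S T (g x)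
  refine ⟨∏ x ∈ s, t x, prod_mem fun x _ => ht x, fun x => ?_⟩
  have hx : x ∈ Submodule.span ℤ (s : Set V) := hs ▸ Submodule.mem_top
  induction hx using Submodule.span_induction with
  | mem x hx =>
    refine ⟨(∏ z ∈ s.erase x, t z) • y x, ?_⟩
    rw [← Finset.prod_erase_mul _ _ hx, mul_smul, hy, TensorProduct.tmul_smul]
  | zero => exact ⟨0, by simp⟩
  | add x x' _ _ h h' =>
    obtain ⟨z, hz⟩ := h
    obtain ⟨z', hz'⟩ := h'
    exact ⟨z + z', by rw [map_add, smul_add, hz, hz', TensorProduct.tmul_add]⟩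
  | smul a x _ h =>
    obtain ⟨z, hz⟩ := h
    exact ⟨a • z, by rw [map_zsmul, smul_comm, hz, TensorProduct.tmul_smul]⟩

/-- Additivity of the chosen preimages is automatic, as `x ↦ 1 ⊗ x` is injective. -/
theorem exists_addMonoidHom_one_tmul [IsAddTorsionFree V] (hT : (0 : ℤ) ∉ T) {W : Type}
    [AddCommGroup W] (g : W →+ S ⊗[ℤ] V) (h : ∀ x, ∃ y : V, g x = (1 : S) ⊗ₜ[ℤ] y) :
    ∃ f : W →+ V, ∀ x, g x = (1 : S) ⊗ₜ[ℤ] f x := by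
  choose f hf using h
  have hinj := IsLocalization.one_tmul_injective (V := V) S hT
  refine ⟨⟨⟨f, hinj ?_⟩, fun x y => hinj ?_⟩, hf⟩
  · simp [← hf]
  · simp [← hf, TensorProduct.tmul_add]

end localization

namespace CubicDiagram

/-! ### Scalar extension of diagrams -/

section isomorphic

variable {R : Type} [CommRing R] {D E G : CubicDiagram R}

theorem Isomorphic.symm (h : D.Isomorphic E) : E.Isomorphic D := by
  obtain ⟨e₁, e₂, e₃, a, b, c, d, e, f⟩ := h
  refine ⟨e₁.symm, e₂.symm, e₃.symm, fun x => ?_, fun x => ?_, fun x => ?_, fun x => ?_,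
    fun x => ?_, fun x => ?_⟩
  · rw [LinearEquiv.symm_apply_eq, a, LinearEquiv.apply_symm_apply]
  · rw [LinearEquiv.symm_apply_eq, b, LinearEquiv.apply_symm_apply]
  · rw [LinearEquiv.symm_apply_eq, c, LinearEquiv.apply_symm_apply]
  · rw [LinearEquiv.symm_apply_eq, d, LinearEquiv.apply_symm_apply]
  · rw [LinearEquiv.symm_apply_eq, e, LinearEquiv.apply_symm_apply]
  · rw [LinearEquiv.symm_apply_eq, f, LinearEquiv.apply_symm_apply]

theorem Isomorphic.trans (h : D.Isomorphic E) (h' : E.Isomorphic G) : D.Isomorphic G := by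
  obtain ⟨e₁, e₂, e₃, a, b, c, d, e, f⟩ := h
  obtain ⟨e₁', e₂', e₃', a', b', c', d', e', f'⟩ := h'
  exact ⟨e₁.trans e₁', e₂.trans e₂', e₃.trans e₃', fun x => by simp [a, a'],
    fun x => by simp [b, b'], fun x => by simp [c, c'], fun x => by simp [d, d'],
    fun x => by simp [e, e'], fun x => by simp [f, f']⟩

end isomorphic

section tensor

variable {R : Type} [CommRing R] (S : Type) [CommRing S]

section

variable {U V W : Type} [AddCommGroup U] [AddCommGroup V] [AddCommGroup W]
  [Module R U] [Module R V] [Module R W]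

theorem eq_of_one_tmul {N : Type} [AddCommGroup N] [Module S N] (f g : S ⊗[ℤ] V →ₗ[S] N)
    (h : ∀ x, f (1 ⊗ₜ x) = g (1 ⊗ₜ x)) (y : S ⊗[ℤ] V) : f y = g y := by
  induction y using TensorProduct.induction_on with
  | zero => rw [map_zero, map_zero]
  | add x y hx hy => rw [map_add, map_add, hx, hy]
  | tmul s x =>
    rw [← mul_one s, ← smul_eq_mul, ← TensorProduct.smul_tmul', map_smul, map_smul, h]

theorem tensorMap_comp (f : V →ₗ[R] W) (g : U →ₗ[R] V) :
    tensorMap S (f ∘ₗ g) = tensorMap S f ∘ₗ tensorMap S g :=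
  LinearMap.baseChange_comp (f := g.toAddMonoidHom.toIntLinearMap)
    (g := f.toAddMonoidHom.toIntLinearMap) (A := S)

theorem tensorMap_add (f g : V →ₗ[R] W) : tensorMap S (f + g) = tensorMap S f + tensorMap S g :=
  LinearMap.baseChange_add f.toAddMonoidHom.toIntLinearMap g.toAddMonoidHom.toIntLinearMap

theorem tensorMap_zero : tensorMap S (0 : V →ₗ[R] W) = 0 := LinearMap.baseChange_zero

/-- The tensor product is taken over `ℤ`, so a general scalar of `R` has no counterpart in `S`. The
only scalar in the relations is 2, and it acts as a sum. -/
theorem tensorMap_two_smul (f : V →ₗ[R] W) :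
    tensorMap S ((2 : R) • f) = (2 : S) • tensorMap S f := by
  rw [two_smul, two_smul, tensorMap_add]

end

theorem IsAModule.tensor {D : CubicDiagram R} (hD : D.IsAModule) : (D.tensor S).IsAModule := by
  constructor
  · have := congrArg (tensorMap S) hD.h₁_p₂
    simp only [tensorMap_comp, tensorMap_zero] at this
    exact this
  · have := congrArg (tensorMap S) hD.h₂_p₁
    simp only [tensorMap_comp, tensorMap_zero] at this
    exact this
  · have := congrArg (tensorMap S) hD.h₁_h
    simp only [tensorMap_comp] at this
    exact this
  · have := congrArg (tensorMap S) hD.p_p₁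
    simp only [tensorMap_comp] at this
    exact this
  · have := congrArg (tensorMap S) hD.h₁_p₁_h₁
    simp only [tensorMap_comp, tensorMap_two_smul] at this
    exact this
  · have := congrArg (tensorMap S) hD.h₂_p₂_h₂
    simp only [tensorMap_comp, tensorMap_two_smul] at this
    exact this
  · have := congrArg (tensorMap S) hD.p₁_h₁_p₁
    simp only [tensorMap_comp, tensorMap_two_smul] at this
    exact this
  · have := congrArg (tensorMap S) hD.p₂_h₂_p₂
    simp only [tensorMap_comp, tensorMap_two_smul] at this
    exact this
  · have := congrArg (tensorMap S) hD.h_p_h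
    simp only [tensorMap_comp, tensorMap_add, tensorMap_two_smul] at this
    exact this
  · have := congrArg (tensorMap S) hD.p_h_p
    simp only [tensorMap_comp, tensorMap_add, tensorMap_two_smul] at this
    exact this
  · have := congrArg (tensorMap S) hD.h₁_h_p
    simp only [tensorMap_comp, tensorMap_add] at this
    exact this
  · have := congrArg (tensorMap S) hD.h_p_p₁
    simp only [tensorMap_comp, tensorMap_add] at this
    exact this

theorem Isomorphic.tensor {D E : CubicDiagram R} (h : D.Isomorphic E) :
    (D.tensor S).Isomorphic (E.tensor S) := by
  obtain ⟨e₁, e₂, e₃, a, b, c, d, e, f⟩ := h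
  let i₁ : S ⊗[ℤ] D.V₁ ≃ₗ[S] S ⊗[ℤ] E.V₁ :=
    e₁.toAddEquiv.toIntLinearEquiv.baseChange ℤ S _ _
  let i₂ : S ⊗[ℤ] D.V₂ ≃ₗ[S] S ⊗[ℤ] E.V₂ :=
    e₂.toAddEquiv.toIntLinearEquiv.baseChange ℤ S _ _
  let i₃ : S ⊗[ℤ] D.V₃ ≃ₗ[S] S ⊗[ℤ] E.V₃ :=
    e₃.toAddEquiv.toIntLinearEquiv.baseChange ℤ S _ _
  exact ⟨i₁, i₂, i₃,
    eq_of_one_tmul S (i₂.toLinearMap ∘ₗ tensorMap S D.h) (tensorMap S E.h ∘ₗ i₁.toLinearMap)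
      fun x => congrArg ((1 : S) ⊗ₜ[ℤ] ·) (a x),
    eq_of_one_tmul S (i₁.toLinearMap ∘ₗ tensorMap S D.p) (tensorMap S E.p ∘ₗ i₂.toLinearMap)
      fun x => congrArg ((1 : S) ⊗ₜ[ℤ] ·) (b x),
    eq_of_one_tmul S (i₃.toLinearMap ∘ₗ tensorMap S D.h₁) (tensorMap S E.h₁ ∘ₗ i₂.toLinearMap)
      fun x => congrArg ((1 : S) ⊗ₜ[ℤ] ·) (c x),
    eq_of_one_tmul S (i₃.toLinearMap ∘ₗ tensorMap S D.h₂) (tensorMap S E.h₂ ∘ₗ i₂.toLinearMap)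
      fun x => congrArg ((1 : S) ⊗ₜ[ℤ] ·) (d x),
    eq_of_one_tmul S (i₂.toLinearMap ∘ₗ tensorMap S D.p₁) (tensorMap S E.p₁ ∘ₗ i₃.toLinearMap)
      fun x => congrArg ((1 : S) ⊗ₜ[ℤ] ·) (e x),
    eq_of_one_tmul S (i₂.toLinearMap ∘ₗ tensorMap S D.p₂) (tensorMap S E.p₂ ∘ₗ i₃.toLinearMap)
      fun x => congrArg ((1 : S) ⊗ₜ[ℤ] ·) (f x)⟩

/-- A diagram that maps to an `S`-diagram by localizations has this diagram as scalar extension. -/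
theorem tensor_isomorphic (T : Submonoid ℤ) [IsLocalization T S] (D : CubicDiagram R)
    (M : CubicDiagram S) (i₁ : D.V₁ →+ M.V₁) (i₂ : D.V₂ →+ M.V₂) (i₃ : D.V₃ →+ M.V₃)
    [IsLocalizedModule T i₁.toIntLinearMap] [IsLocalizedModule T i₂.toIntLinearMap]
    [IsLocalizedModule T i₃.toIntLinearMap]
    (h : ∀ x, i₂ (D.h x) = M.h (i₁ x)) (p : ∀ x, i₁ (D.p x) = M.p (i₂ x))
    (h₁ : ∀ x, i₃ (D.h₁ x) = M.h₁ (i₂ x)) (h₂ : ∀ x, i₃ (D.h₂ x) = M.h₂ (i₂ x))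
    (p₁ : ∀ x, i₂ (D.p₁ x) = M.p₁ (i₃ x)) (p₂ : ∀ x, i₂ (D.p₂ x) = M.p₂ (i₃ x)) :
    (D.tensor S).Isomorphic M := by
  have e₁ := IsLocalizedModule.isBaseChange T S i₁.toIntLinearMap
  have e₂ := IsLocalizedModule.isBaseChange T S i₂.toIntLinearMap
  have e₃ := IsLocalizedModule.isBaseChange T S i₃.toIntLinearMap
  have f₁ (x) : e₁.equiv (1 ⊗ₜ x) = i₁ x := (e₁.equiv_tmul 1 x).trans (one_smul S _)
  have f₂ (x) : e₂.equiv (1 ⊗ₜ x) = i₂ x := (e₂.equiv_tmul 1 x).trans (one_smul S _)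
  have f₃ (x) : e₃.equiv (1 ⊗ₜ x) = i₃ x := (e₃.equiv_tmul 1 x).trans (one_smul S _)
  exact ⟨e₁.equiv, e₂.equiv, e₃.equiv,
    eq_of_one_tmul S (e₂.equiv.toLinearMap ∘ₗ tensorMap S D.h) (M.h ∘ₗ e₁.equiv.toLinearMap)
      fun x => (f₂ (D.h x)).trans ((h x).trans (congrArg M.h (f₁ x).symm)),
    eq_of_one_tmul S (e₁.equiv.toLinearMap ∘ₗ tensorMap S D.p) (M.p ∘ₗ e₂.equiv.toLinearMap)
      fun x => (f₁ (D.p x)).trans ((p x).trans (congrArg M.p (f₂ x).symm)),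
    eq_of_one_tmul S (e₃.equiv.toLinearMap ∘ₗ tensorMap S D.h₁) (M.h₁ ∘ₗ e₂.equiv.toLinearMap)
      fun x => (f₃ (D.h₁ x)).trans ((h₁ x).trans (congrArg M.h₁ (f₂ x).symm)),
    eq_of_one_tmul S (e₃.equiv.toLinearMap ∘ₗ tensorMap S D.h₂) (M.h₂ ∘ₗ e₂.equiv.toLinearMap)
      fun x => (f₃ (D.h₂ x)).trans ((h₂ x).trans (congrArg M.h₂ (f₂ x).symm)),
    eq_of_one_tmul S (e₂.equiv.toLinearMap ∘ₗ tensorMap S D.p₁) (M.p₁ ∘ₗ e₃.equiv.toLinearMap)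
      fun x => (f₂ (D.p₁ x)).trans ((p₁ x).trans (congrArg M.p₁ (f₃ x).symm)),
    eq_of_one_tmul S (e₂.equiv.toLinearMap ∘ₗ tensorMap S D.p₂) (M.p₂ ∘ₗ e₃.equiv.toLinearMap)
      fun x => (f₂ (D.p₂ x)).trans ((p₂ x).trans (congrArg M.p₂ (f₃ x).symm))⟩

end tensor

end CubicDiagram
end

/-! ### Torsion free diagrams in their scalar extensions; clearing of denominators. -/

noncomputable section

namespace CubicDiagram

/-- A diagram that is embedded into a module over `𝐀 ⊗ S` is a module. -/
theorem IsAModule.of_injective {R S : Type} [CommRing R] [CommRing S] {D : CubicDiagram R}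
    {M : CubicDiagram S} (hM : M.IsAModule) (i₁ : D.V₁ →+ M.V₁) (i₂ : D.V₂ →+ M.V₂)
    (i₃ : D.V₃ →+ M.V₃) (hi₁ : Function.Injective i₁) (hi₂ : Function.Injective i₂)
    (hi₃ : Function.Injective i₃)
    (h : ∀ x, i₂ (D.h x) = M.h (i₁ x)) (p : ∀ x, i₁ (D.p x) = M.p (i₂ x))
    (h₁ : ∀ x, i₃ (D.h₁ x) = M.h₁ (i₂ x)) (h₂ : ∀ x, i₃ (D.h₂ x) = M.h₂ (i₂ x))
    (p₁ : ∀ x, i₂ (D.p₁ x) = M.p₁ (i₃ x)) (p₂ : ∀ x, i₂ (D.p₂ x) = M.p₂ (i₃ x)) :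
    D.IsAModule := by
  have := Fact.mk hM
  constructor <;> refine LinearMap.ext fun x => ?_ <;>
    first | apply hi₁ | apply hi₂ | apply hi₃
  all_goals
    simp only [LinearMap.comp_apply, LinearMap.add_apply, map_add, two_smul,
      LinearMap.zero_apply, map_zero, h, p, h₁, h₂, p₁, p₂, M.h₁_p₂_apply, M.h₂_p₁_apply,
      M.h₂_h_apply, M.p_p₂_apply, M.h₁_p₁_h₁_apply, M.h₂_p₂_h₂_apply, M.p₁_h₁_p₁_apply,
      M.p₂_h₂_p₂_apply, M.h_p_h_apply, M.p_h_p_apply, M.h₁_h_p_apply, M.h_p_p₁_apply]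
  all_goals abel

section tensor

variable (S : Type) [CommRing S]

section

variable (V : Type) [AddCommGroup V]

theorem finite_tensor [h : Module.Finite ℤ V] : Module.Finite S (S ⊗[ℤ] V) := inferInstance

theorem isTorsionFree_tensor [IsDomain S] [Module.Finite ℤ V] [IsAddTorsionFree V] :
    Module.IsTorsionFree S (S ⊗[ℤ] V) := by
  have : Module.Free ℤ V := Module.free_of_finite_type_torsion_free'
  infer_instance

theorem isAddTorsionFree_of_charZero [IsDomain S] [CharZero S] [Module S V]
    [Module.IsTorsionFree S V] : IsAddTorsionFree V := by
  have : Module.IsTorsionFree ℤ V := Module.IsTorsionFree.trans (R := S)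
  exact Module.IsTorsionFree.isAddTorsionFree V

variable {V}

/-- Both steps `V → S ⊗ V → ℚ ⊗ (S ⊗ V)` are injective and their denominators multiply, so the
composite is again a rationalization of `V`. -/
theorem isLocalizedModule_tmul_tmul (T : Submonoid ℤ) [IsLocalization T S]
    (hT : (0 : ℤ) ∉ T) [IsAddTorsionFree V] [IsAddTorsionFree (S ⊗[ℤ] V)] :
    IsLocalizedModule (nonZeroDivisors ℤ) (AddMonoidHom.toIntLinearMap
      ((TensorProduct.mk ℤ ℚ (S ⊗[ℤ] V) 1).toAddMonoidHom.comp
        (TensorProduct.mk ℤ S V 1).toAddMonoidHom)) := by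
  refine isLocalizedModule_of_injective ℚ _ _ ?_ fun y => ?_
  · exact (IsLocalization.one_tmul_injective ℚ (T := nonZeroDivisors ℤ) (by simp)).comp
      (IsLocalization.one_tmul_injective S hT)
  · obtain ⟨t, ht, z, hz⟩ := IsLocalization.exists_smul_eq_one_tmul ℚ (nonZeroDivisors ℤ) y
    obtain ⟨s, hs, x, hx⟩ := IsLocalization.exists_smul_eq_one_tmul S T z
    refine ⟨s * t, mul_mem (mem_nonZeroDivisors_of_ne_zero fun h => hT (h ▸ hs)) ht, x, ?_⟩
    rw [mul_smul, hz]
    exact (map_zsmul (TensorProduct.mk ℤ ℚ (S ⊗[ℤ] V) 1) s z).symm.trans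
      (congrArg (fun z => (1 : ℚ) ⊗ₜ[ℤ] z) hx)

/-- Every multiple of the denominator `t` is admitted, so that the three components of a morphism
can be given a common one. -/
theorem exists_addMonoidHom_of_tensor {W : Type} [AddCommGroup W] (T : Submonoid ℤ)
    [IsLocalization T S] (hT : (0 : ℤ) ∉ T) [Module.Finite ℤ V] [IsAddTorsionFree W]
    (e : S ⊗[ℤ] V →ₗ[S] S ⊗[ℤ] W) : ∃ t ∈ T, ∀ s : ℤ, t ∣ s → ∃ f : V →+ W,
      ∀ x, (1 : S) ⊗ₜ[ℤ] f x = s • e ((1 : S) ⊗ₜ[ℤ] x) := by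
  let g : V →+ S ⊗[ℤ] W := e.toAddMonoidHom.comp (TensorProduct.mk ℤ S V 1).toAddMonoidHom
  obtain ⟨t, ht, h⟩ := IsLocalization.exists_smul_eq_one_tmul_of_finite S T g
  refine ⟨t, ht, ?_⟩
  rintro _ ⟨s, rfl⟩
  obtain ⟨f, hf⟩ := exists_addMonoidHom_one_tmul S T hT ((t * s) • g) fun x => by
    obtain ⟨y, hy⟩ := h x
    refine ⟨s • y, ?_⟩
    rw [AddMonoidHom.smul_apply, mul_comm, mul_smul, hy, TensorProduct.tmul_smul]
  exact ⟨f, fun x => (hf x).symm⟩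

end

theorem IsTorsionFreeAModule.tensor [IsDomain S] {D : CubicDiagram ℤ}
    (hD : D.IsTorsionFreeAModule) : (D.tensor S).IsTorsionFreeAModule := by
  obtain ⟨aD, f₁, f₂, f₃, t₁, t₂, t₃⟩ := hD
  have u₁ := Module.IsTorsionFree.isAddTorsionFree D.V₁
  have u₂ := Module.IsTorsionFree.isAddTorsionFree D.V₂
  have u₃ := Module.IsTorsionFree.isAddTorsionFree D.V₃
  replace f₁ := Module.Finite.toIntModule D.V₁
  replace f₂ := Module.Finite.toIntModule D.V₂
  replace f₃ := Module.Finite.toIntModule D.V₃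
  exact ⟨aD.tensor S, finite_tensor S D.V₁ (h := f₁), finite_tensor S D.V₂ (h := f₂),
    finite_tensor S D.V₃ (h := f₃), @isTorsionFree_tensor S _ D.V₁ _ _ f₁ _,
    @isTorsionFree_tensor S _ D.V₂ _ _ f₂ _, @isTorsionFree_tensor S _ D.V₃ _ _ f₃ _⟩

/-- The rationalization of a localization. -/
theorem tensor_tensor_rat_isomorphic [IsDomain S] [CharZero S] (T : Submonoid ℤ)
    [IsLocalization T S] (hT : (0 : ℤ) ∉ T) {D : CubicDiagram ℤ} (hD : D.IsTorsionFreeAModule) :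
    (D.tensor ℚ).Isomorphic ((D.tensor S).tensor ℚ) := by
  have hS := hD.tensor S
  obtain ⟨-, -, -, -, t₁, t₂, t₃⟩ := hD
  obtain ⟨-, -, -, -, u₁, u₂, u₃⟩ := hS
  have := Module.IsTorsionFree.isAddTorsionFree D.V₁
  have := Module.IsTorsionFree.isAddTorsionFree D.V₂
  have := Module.IsTorsionFree.isAddTorsionFree D.V₃
  have v₁ := isAddTorsionFree_of_charZero S (D.tensor S).V₁
  have v₂ := isAddTorsionFree_of_charZero S (D.tensor S).V₂
  have v₃ := isAddTorsionFree_of_charZero S (D.tensor S).V₃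
  have w₁ := @isLocalizedModule_tmul_tmul S _ D.V₁ _ T _ hT _ v₁
  have w₂ := @isLocalizedModule_tmul_tmul S _ D.V₂ _ T _ hT _ v₂
  have w₃ := @isLocalizedModule_tmul_tmul S _ D.V₃ _ T _ hT _ v₃
  refine @tensor_isomorphic _ _ ℚ _ (nonZeroDivisors ℤ) _ D ((D.tensor S).tensor ℚ) _ _ _
    w₁ w₂ w₃ ?_ ?_ ?_ ?_ ?_ ?_ <;> intro x <;> rfl

/-- An additive map is linear for all `ℤ`-module structures. -/
def intLinearMap {V W : Type} [AddCommGroup V] [AddCommGroup W] [Module ℤ V] [Module ℤ W]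
    (f : V →+ W) : V →ₗ[ℤ] W where
  toFun := f
  map_add' := f.map_add
  map_smul' n x := by simpa using map_intCast_smul f ℤ ℤ n x

theorem one_tmul_smul_id {V W : Type} [AddCommGroup V] [AddCommGroup W]
    (e : S ⊗[ℤ] V ≃ₗ[S] S ⊗[ℤ] W) {f : V → W} {g : W → V} {s t : ℤ}
    (hf : ∀ x, (1 : S) ⊗ₜ[ℤ] f x = s • e ((1 : S) ⊗ₜ[ℤ] x))
    (hg : ∀ y, (1 : S) ⊗ₜ[ℤ] g y = t • e.symm ((1 : S) ⊗ₜ[ℤ] y)) (x : V) :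
    (1 : S) ⊗ₜ[ℤ] g (f x) = (1 : S) ⊗ₜ[ℤ] ((s * t) • x) := by
  rw [hg, hf, map_zsmul, LinearEquiv.symm_apply_apply, TensorProduct.tmul_smul, mul_comm, mul_smul]

/-- A morphism of diagrams of abelian groups. -/
structure AddHom {R R' : Type} [CommRing R] [CommRing R'] (D : CubicDiagram R)
    (E : CubicDiagram R') where
  f₁ : D.V₁ →+ E.V₁
  f₂ : D.V₂ →+ E.V₂
  f₃ : D.V₃ →+ E.V₃
  h : ∀ x, f₂ (D.h x) = E.h (f₁ x)
  p : ∀ x, f₁ (D.p x) = E.p (f₂ x)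
  h₁ : ∀ x, f₃ (D.h₁ x) = E.h₁ (f₂ x)
  h₂ : ∀ x, f₃ (D.h₂ x) = E.h₂ (f₂ x)
  p₁ : ∀ x, f₂ (D.p₁ x) = E.p₁ (f₃ x)
  p₂ : ∀ x, f₂ (D.p₂ x) = E.p₂ (f₃ x)

/-- Additive morphisms of diagrams over `ℤ` are morphisms. -/
def AddHom.toHom {D E : CubicDiagram ℤ} (f : AddHom D E) : Hom D E :=
  ⟨intLinearMap f.f₁, intLinearMap f.f₂, intLinearMap f.f₃, f.h, f.p, f.h₁, f.h₂, f.p₁, f.p₂⟩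

section

variable {R : Type} [CommRing R] (T : Submonoid ℤ) [IsLocalization T S]
  {D E : CubicDiagram R}

/-- The product of the three denominators serves all components; compatibility with the structure
maps is inherited because `x ↦ 1 ⊗ x` is injective. -/
theorem exists_addHom_of_tensor (hT : (0 : ℤ) ∉ T) [Module.Finite ℤ D.V₁] [Module.Finite ℤ D.V₂]
    [Module.Finite ℤ D.V₃] [IsAddTorsionFree E.V₁] [IsAddTorsionFree E.V₂]
    [IsAddTorsionFree E.V₃]
    (e₁ : S ⊗[ℤ] D.V₁ →ₗ[S] S ⊗[ℤ] E.V₁) (e₂ : S ⊗[ℤ] D.V₂ →ₗ[S] S ⊗[ℤ] E.V₂)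
    (e₃ : S ⊗[ℤ] D.V₃ →ₗ[S] S ⊗[ℤ] E.V₃)
    (h : ∀ x, e₂ (tensorMap S D.h x) = tensorMap S E.h (e₁ x))
    (p : ∀ x, e₁ (tensorMap S D.p x) = tensorMap S E.p (e₂ x))
    (h₁ : ∀ x, e₃ (tensorMap S D.h₁ x) = tensorMap S E.h₁ (e₂ x))
    (h₂ : ∀ x, e₃ (tensorMap S D.h₂ x) = tensorMap S E.h₂ (e₂ x))
    (p₁ : ∀ x, e₂ (tensorMap S D.p₁ x) = tensorMap S E.p₁ (e₃ x))
    (p₂ : ∀ x, e₂ (tensorMap S D.p₂ x) = tensorMap S E.p₂ (e₃ x)) :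
    ∃ t ∈ T, ∃ f : AddHom D E, (∀ x, (1 : S) ⊗ₜ[ℤ] f.f₁ x = t • e₁ ((1 : S) ⊗ₜ[ℤ] x)) ∧
      (∀ x, (1 : S) ⊗ₜ[ℤ] f.f₂ x = t • e₂ ((1 : S) ⊗ₜ[ℤ] x)) ∧
      ∀ x, (1 : S) ⊗ₜ[ℤ] f.f₃ x = t • e₃ ((1 : S) ⊗ₜ[ℤ] x) := by
  obtain ⟨t₁, ht₁, k₁⟩ := exists_addMonoidHom_of_tensor S T hT e₁
  obtain ⟨t₂, ht₂, k₂⟩ := exists_addMonoidHom_of_tensor S T hT e₂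
  obtain ⟨t₃, ht₃, k₃⟩ := exists_addMonoidHom_of_tensor S T hT e₃
  obtain ⟨f₁, a₁⟩ := k₁ (t₁ * t₂ * t₃) ⟨t₂ * t₃, by ring⟩
  obtain ⟨f₂, a₂⟩ := k₂ (t₁ * t₂ * t₃) ⟨t₁ * t₃, by ring⟩
  obtain ⟨f₃, a₃⟩ := k₃ (t₁ * t₂ * t₃) ⟨t₁ * t₂, by ring⟩
  have i₁ := IsLocalization.one_tmul_injective (V := E.V₁) S hT
  have i₂ := IsLocalization.one_tmul_injective (V := E.V₂) S hT
  have i₃ := IsLocalization.one_tmul_injective (V := E.V₃) S hT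
  refine ⟨t₁ * t₂ * t₃, mul_mem (mul_mem ht₁ ht₂) ht₃,
    ⟨f₁, f₂, f₃, fun x => i₂ ?_, fun x => i₁ ?_, fun x => i₃ ?_, fun x => i₃ ?_,
    fun x => i₂ ?_, fun x => i₂ ?_⟩, a₁, a₂, a₃⟩
  · exact (a₂ _).trans ((congrArg _ (h (1 ⊗ₜ x))).trans
      ((map_zsmul (tensorMap S E.h) _ _).symm.trans (congrArg (tensorMap S E.h) (a₁ x).symm)))
  · exact (a₁ _).trans ((congrArg _ (p (1 ⊗ₜ x))).trans
      ((map_zsmul (tensorMap S E.p) _ _).symm.trans (congrArg (tensorMap S E.p) (a₂ x).symm)))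
  · exact (a₃ _).trans ((congrArg _ (h₁ (1 ⊗ₜ x))).trans
      ((map_zsmul (tensorMap S E.h₁) _ _).symm.trans (congrArg (tensorMap S E.h₁) (a₂ x).symm)))
  · exact (a₃ _).trans ((congrArg _ (h₂ (1 ⊗ₜ x))).trans
      ((map_zsmul (tensorMap S E.h₂) _ _).symm.trans (congrArg (tensorMap S E.h₂) (a₂ x).symm)))
  · exact (a₂ _).trans ((congrArg _ (p₁ (1 ⊗ₜ x))).trans
      ((map_zsmul (tensorMap S E.p₁) _ _).symm.trans (congrArg (tensorMap S E.p₁) (a₃ x).symm)))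
  · exact (a₂ _).trans ((congrArg _ (p₂ (1 ⊗ₜ x))).trans
      ((map_zsmul (tensorMap S E.p₂) _ _).symm.trans (congrArg (tensorMap S E.p₂) (a₃ x).symm)))

/-- Isomorphic localizations of diagrams of lattices: there are morphisms of the lattices that are
inverse to each other up to a denominator. -/
theorem Isomorphic.exists_addHom (hT : (0 : ℤ) ∉ T) [Module.Finite ℤ D.V₁] [Module.Finite ℤ D.V₂]
    [Module.Finite ℤ D.V₃] [IsAddTorsionFree D.V₁] [IsAddTorsionFree D.V₂]
    [IsAddTorsionFree D.V₃] [Module.Finite ℤ E.V₁] [Module.Finite ℤ E.V₂]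
    [Module.Finite ℤ E.V₃] [IsAddTorsionFree E.V₁] [IsAddTorsionFree E.V₂]
    [IsAddTorsionFree E.V₃] (hDE : (D.tensor S).Isomorphic (E.tensor S)) :
    ∃ t ∈ T, ∃ (f : AddHom D E) (g : AddHom E D),
      (∀ x, g.f₁ (f.f₁ x) = t • x) ∧ (∀ x, g.f₂ (f.f₂ x) = t • x) ∧
      (∀ x, g.f₃ (f.f₃ x) = t • x) ∧ (∀ x, f.f₁ (g.f₁ x) = t • x) ∧
      (∀ x, f.f₂ (g.f₂ x) = t • x) ∧ (∀ x, f.f₃ (g.f₃ x) = t • x) := by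
  have hED := hDE.symm
  obtain ⟨e₁, e₂, e₃, h, p, h₁, h₂, p₁, p₂⟩ := hDE
  obtain ⟨s, hs, f, a₁, a₂, a₃⟩ :=
    exists_addHom_of_tensor S T hT e₁.toLinearMap e₂.toLinearMap e₃.toLinearMap h p h₁ h₂ p₁ p₂
  obtain ⟨t, ht, g, b₁, b₂, b₃⟩ :=
    exists_addHom_of_tensor S T hT e₁.symm.toLinearMap e₂.symm.toLinearMap e₃.symm.toLinearMap
      (fun x => e₂.symm_apply_eq.2 ((congrArg (tensorMap S E.h) (e₁.apply_symm_apply x)).symm.trans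
        (h (e₁.symm x)).symm))
      (fun x => e₁.symm_apply_eq.2 ((congrArg (tensorMap S E.p) (e₂.apply_symm_apply x)).symm.trans
        (p (e₂.symm x)).symm))
      (fun x => e₃.symm_apply_eq.2 ((congrArg (tensorMap S E.h₁) (e₂.apply_symm_apply x)).symm.trans
        (h₁ (e₂.symm x)).symm))
      (fun x => e₃.symm_apply_eq.2 ((congrArg (tensorMap S E.h₂) (e₂.apply_symm_apply x)).symm.trans
        (h₂ (e₂.symm x)).symm))
      (fun x => e₂.symm_apply_eq.2 ((congrArg (tensorMap S E.p₁) (e₃.apply_symm_apply x)).symm.trans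
        (p₁ (e₃.symm x)).symm))
      (fun x => e₂.symm_apply_eq.2 ((congrArg (tensorMap S E.p₂) (e₃.apply_symm_apply x)).symm.trans
        (p₂ (e₃.symm x)).symm))
  refine ⟨s * t, mul_mem hs ht, f, g, fun x => ?_, fun x => ?_, fun x => ?_, fun x => ?_,
    fun x => ?_, fun x => ?_⟩ <;> apply IsLocalization.one_tmul_injective S hT
  · exact one_tmul_smul_id S e₁ a₁ b₁ x
  · exact one_tmul_smul_id S e₂ a₂ b₂ x
  · exact one_tmul_smul_id S e₃ a₃ b₃ x
  · exact mul_comm t s ▸ one_tmul_smul_id S e₁.symm b₁ a₁ x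
  · exact mul_comm t s ▸ one_tmul_smul_id S e₂.symm b₂ a₂ x
  · exact mul_comm t s ▸ one_tmul_smul_id S e₃.symm b₃ a₃ x

end

end tensor

end CubicDiagram
end

noncomputable section

namespace CubicDiagram

/-! ### Lattices with isomorphic localizations at `2` and `3` -/

/-- A combination of additive morphisms of diagrams. -/
def AddHom.combine {R : Type} [CommRing R] {D E : CubicDiagram R} (a b : ℤ) (f g : AddHom D E) :
    AddHom D E where
  f₁ := a • f.f₁ + b • g.f₁
  f₂ := a • f.f₂ + b • g.f₂
  f₃ := a • f.f₃ + b • g.f₃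
  h x := by simp [f.h, g.h]
  p x := by simp [f.p, g.p]
  h₁ x := by simp [f.h₁, g.h₁]
  h₂ x := by simp [f.h₂, g.h₂]
  p₁ x := by simp [f.p₁, g.p₁]
  p₂ x := by simp [f.p₂, g.p₂]

/-- In the product of the two combinations the mixed terms `g f'` and `g' f` have coefficients
divisible by `n`, and the other two terms are scalars by hypothesis. -/
theorem exists_combine_eq_add_smul {V W : Type} [AddCommGroup V] [AddCommGroup W]
    {f f' : V →+ W} {g g' : W →+ V} {s t a a' b b' n : ℤ} (h1 : n ∣ b * a * s + b' * a' * t - 1)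
    (h2 : n ∣ b * a') (h3 : n ∣ b' * a)
    (h : ∀ x, g (f x) = s • x) (h' : ∀ x, g' (f' x) = t • x) (x : V) :
    ∃ z, (b • g + b' • g') ((a • f + a' • f') x) = x + n • z := by
  obtain ⟨u, hu⟩ := h1
  obtain ⟨v, hv⟩ := h2
  obtain ⟨w, hw⟩ := h3
  refine ⟨u • x + v • g (f' x) + w • g' (f x), ?_⟩
  simp only [AddMonoidHom.add_apply, AddMonoidHom.smul_apply, map_add, map_zsmul, h, h', smul_add,
    smul_smul]
  rw [← hu, ← hv, ← hw]
  module

/-- The units modulo 12 are ±1 and ±5. Because 5 is 1 modulo 4 and -1 modulo 6, they all lift to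
units of `ℤ` modulo 4 and modulo 6, although not modulo 12. -/
theorem exists_int_unit (r s : ℤ) (h : 12 ∣ r * s - 1) : ∃ ε : ℤˣ, (12 : ℤ) ∣ ε - r ∨
    (12 : ℤ) ∣ ε * 5 - r := by
  have h1 : (r % 12) * (s % 12) % 12 = 1 := by
    rw [← Int.mul_emod]; omega
  have hr : 0 ≤ r % 12 ∧ r % 12 < 12 := by omega
  have hs : 0 ≤ s % 12 ∧ s % 12 < 12 := by omega
  have : r % 12 = 1 ∨ r % 12 = 5 ∨ r % 12 = 7 ∨ r % 12 = 11 := by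
    generalize r % 12 = a at *
    generalize s % 12 = b at *
    obtain ⟨h2, h3⟩ := hr
    interval_cases a <;> omega
  rcases this with h | h | h | h
  · exact ⟨1, Or.inl (by push_cast; omega)⟩
  · exact ⟨1, Or.inr (by push_cast; omega)⟩
  · exact ⟨-1, Or.inr (by push_cast; omega)⟩
  · exact ⟨-1, Or.inl (by push_cast; omega)⟩

theorem exists_mul_sub_one_dvd_of_not_dvd (p : ℕ) [hp : Fact p.Prime] (k : ℕ) {t : ℤ}
    (ht : t ∈ (Ideal.span {(p : ℤ)}).primeCompl) : ∃ b : ℤ, (p : ℤ) ^ k ∣ b * t - 1 := by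
  have h : ¬ (p : ℤ) ∣ t := fun h => ht (Ideal.mem_span_singleton.2 h)
  have hc : IsCoprime ((p : ℤ) ^ k) t :=
    ((Prime.coprime_iff_not_dvd (Nat.prime_iff_prime_int.1 hp.out)).2 h).pow_left
  obtain ⟨a, b, hab⟩ := hc
  exact ⟨b, -a, by linear_combination hab⟩

theorem zero_notMem_primeCompl (p : ℕ) [Fact p.Prime] :
    (0 : ℤ) ∉ (Ideal.span {(p : ℤ)}).primeCompl := fun h => h (Ideal.zero_mem _)

/-- The canonical `ℤ`-algebra structure is the one that the tensor products over `ℤ` use; it has to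
be identified with the structure from the construction of the localization. -/
instance isLocalization_zLoc (p : ℕ) [Fact p.Prime] :
    @IsLocalization ℤ _ (Ideal.span {(p : ℤ)}).primeCompl (ZLoc p) _ (Ring.toIntAlgebra _) := by
  rw [Subsingleton.elim (Ring.toIntAlgebra (ZLoc p)) OreLocalization.instAlgebra]
  exact Localization.isLocalization

/-- Clearing denominators gives `f, g` with `g f = s`, `s` odd, and `f', g'` with `g' f' = t`, `t`
prime to 3. With inverses `b` of `s` modulo 4 and `c` of `t` modulo 3, the morphisms `9 f + 4 f'`
and `9 b g + 4 c g'` are inverse to each other modulo 12. -/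
theorem isomorphic_of_zLoc {D E : CubicDiagram ℤ} (hD : D.IsTorsionFreeAModule)
    (hE : E.IsTorsionFreeAModule) (i₂ : (D.tensor (ZLoc 2)).Isomorphic (E.tensor (ZLoc 2)))
    (i₃ : (D.tensor (ZLoc 3)).Isomorphic (E.tensor (ZLoc 3))) : D.Isomorphic E := by
  have ⟨_, d₁, d₂, d₃, d₄, d₅, d₆⟩ := hD
  have ⟨_, e₁, e₂, e₃, e₄, e₅, e₆⟩ := hE
  replace d₁ := Module.Finite.toIntModule D.V₁
  replace d₂ := Module.Finite.toIntModule D.V₂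
  replace d₃ := Module.Finite.toIntModule D.V₃
  replace d₄ := Module.IsTorsionFree.isAddTorsionFree D.V₁
  replace d₅ := Module.IsTorsionFree.isAddTorsionFree D.V₂
  replace d₆ := Module.IsTorsionFree.isAddTorsionFree D.V₃
  replace e₁ := Module.Finite.toIntModule E.V₁
  replace e₂ := Module.Finite.toIntModule E.V₂
  replace e₃ := Module.Finite.toIntModule E.V₃
  replace e₄ := Module.IsTorsionFree.isAddTorsionFree E.V₁
  replace e₅ := Module.IsTorsionFree.isAddTorsionFree E.V₂
  replace e₆ := Module.IsTorsionFree.isAddTorsionFree E.V₃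
  obtain ⟨s, hs, f, g, a₁, a₂, a₃, a₄, a₅, a₆⟩ := @Isomorphic.exists_addHom (ZLoc 2) _ ℤ _
    (Ideal.span {((2 : ℕ) : ℤ)}).primeCompl _ D E (zero_notMem_primeCompl 2)
    d₁ d₂ d₃ d₄ d₅ d₆ e₁ e₂ e₃ e₄ e₅ e₆ i₂
  obtain ⟨t, ht, f', g', b₁, b₂, b₃, b₄, b₅, b₆⟩ := @Isomorphic.exists_addHom (ZLoc 3) _ ℤ _
    (Ideal.span {((3 : ℕ) : ℤ)}).primeCompl _ D E (zero_notMem_primeCompl 3)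
    d₁ d₂ d₃ d₄ d₅ d₆ e₁ e₂ e₃ e₄ e₅ e₆ i₃
  obtain ⟨b, hb⟩ := exists_mul_sub_one_dvd_of_not_dvd 2 2 hs
  obtain ⟨c, hc⟩ := exists_mul_sub_one_dvd_of_not_dvd 3 1 ht
  norm_num at hb hc
  obtain ⟨u, hb⟩ := hb
  obtain ⟨v, hc⟩ := hc
  have key {V W : Type} [AddCommGroup V] [AddCommGroup W] (i : Module ℤ V)
      {f f' : V →+ W} {g g' : W →+ V} {a a' b b' : ℤ} (h1 : 12 ∣ b * a * s + b' * a' * t - 1)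
      (h2 : 12 ∣ b * a') (h3 : 12 ∣ b' * a)
      (h : ∀ x, g (f x) = s • x) (h' : ∀ x, g' (f' x) = t • x) (x : V) : ∃ z,
      (b • g + b' • g') ((a • f + a' • f') x) =
        x + i.toDistribMulAction.toMulAction.toSMul.smul (12 : ℤ) z := by
    obtain ⟨z, hz⟩ := exists_combine_eq_add_smul h1 h2 h3 h h' x
    exact ⟨z, hz.trans (congrArg (x + ·) (@int_smul_eq_zsmul V _ i 12 z).symm)⟩
  -- The numbers 9 and 4 are the idempotents modulo 12 that belong to 4 and to 3: 9 is 1 modulo 4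
  -- and 0 modulo 3, and 4 is the reverse.
  have k₁ : 12 ∣ 9 * b * 9 * s + 4 * c * 4 * t - 1 :=
    ⟨8 + 27 * u + 4 * v, by linear_combination 81 * hb + 16 * hc⟩
  have k₂ : 12 ∣ 9 * b * 4 := ⟨3 * b, by ring⟩
  have k₃ : 12 ∣ 4 * c * 9 := ⟨3 * c, by ring⟩
  have l₁ : 12 ∣ 9 * (9 * b) * s + 4 * (4 * c) * t - 1 := by convert k₁ using 1; ring
  have l₂ : 12 ∣ 9 * (4 * c) := ⟨3 * c, by ring⟩
  have l₃ : 12 ∣ 4 * (9 * b) := ⟨3 * b, by ring⟩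
  refine isomorphic_of_hom_mod_twelve (by decide) ?_ ?_ hD hE
    (AddHom.combine 9 4 f f').toHom (AddHom.combine (9 * b) (4 * c) g g').toHom
    (key _ k₁ k₂ k₃ a₁ b₁) (key _ k₁ k₂ k₃ a₂ b₂) (key _ k₁ k₂ k₃ a₃ b₃)
    (key _ l₁ l₂ l₃ a₄ b₄) (key _ l₁ l₂ l₃ a₅ b₅) (key _ l₁ l₂ l₃ a₆ b₆)
  · intro r s h
    obtain ⟨ε, h | h⟩ := exists_int_unit r s h
    · exact ⟨ε, (by norm_num : (4 : ℤ) ∣ 12).trans h⟩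
    -- Modulo 4 the sign is kept, as 5 is congruent to 1.
    · exact ⟨ε, by omega⟩
  · intro r s h
    obtain ⟨ε, h | h⟩ := exists_int_unit r s h
    · exact ⟨ε, (by norm_num : (6 : ℤ) ∣ 12).trans h⟩
    -- Modulo 6 the sign changes, as 5 is congruent to -1.
    · exact ⟨-ε, by push_cast; omega⟩

end CubicDiagram
end

noncomputable section

/-! ### Gluing of lattices over two localizations of `ℤ` -/

/-- The group is spanned by multiples of finitely many `S`-generators of `M`, each multiplied by a
denominator that brings it into `W`. It lies in both lattices, and its `S`-span is all of `j(M)`. -/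
theorem exists_fg_forall_smul_mem (S : Type) [CommRing S] (T : Submonoid ℤ)
    [IsLocalization T S]
    {M V : Type} [AddCommGroup M] [Module S M] [AddCommGroup V]
    [Module.Finite S M] (j : M →+ V) (W : AddSubgroup V)
    (h : ∀ x, ∃ s ∈ T, s • j x ∈ W) :
    ∃ G : Submodule ℤ V, G.FG ∧ (∀ y ∈ G, y ∈ j.range ∧ y ∈ W) ∧
      ∀ H : Submodule ℤ V, G ≤ H → ∀ y, ∃ t ∈ T, t • j y ∈ H := by
  classical
  obtain ⟨s, hs⟩ := Module.Finite.fg_top (R := S) (M := M)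
  choose t ht hW using h
  refine ⟨Submodule.span ℤ ((s.image fun x => t x • j x : Finset V) : Set V), ⟨_, rfl⟩, ?_, ?_⟩
  · intro y hy
    induction hy using Submodule.span_induction with
    | mem y hy =>
      obtain ⟨x, -, rfl⟩ := Finset.mem_image.1 (Finset.mem_coe.1 hy)
      exact ⟨⟨t x • x, map_zsmul _ _ _⟩, hW x⟩
    | zero => exact ⟨zero_mem _, zero_mem _⟩
    | add x y _ _ hx hy => exact ⟨add_mem hx.1 hy.1, add_mem hx.2 hy.2⟩
    | smul a x _ hx => exact ⟨zsmul_mem hx.1 a, zsmul_mem hx.2 a⟩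
  · intro H hH y
    have hy : y ∈ Submodule.span S (s : Set M) := hs ▸ Submodule.mem_top
    induction hy using Submodule.span_induction with
    | mem x hx =>
      exact ⟨t x, ht x, hH
        (Submodule.subset_span (Finset.mem_coe.2 (Finset.mem_image_of_mem _ hx)))⟩
    | zero => exact ⟨1, one_mem _, by simp⟩
    | add x y _ _ hx hy =>
      obtain ⟨a, ha, hx⟩ := hx
      obtain ⟨b, hb, hy⟩ := hy
      refine ⟨a * b, mul_mem ha hb, ?_⟩
      rw [map_add, smul_add]
      refine add_mem ?_ ?_
      · rw [mul_comm, mul_smul]; exact H.smul_mem _ hx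
      · rw [mul_smul]; exact H.smul_mem _ hy
    | smul a x _ hx =>
      obtain ⟨u, hu, hx⟩ := hx
      obtain ⟨⟨b, c⟩, hc⟩ := IsLocalization.surj T a
      refine ⟨c * u, mul_mem c.2 hu, ?_⟩
      have : ((c : ℤ) * u) • j (a • x) = b • u • j x := by
        rw [← map_zsmul, ← map_zsmul, ← map_zsmul]
        congr 1
        have hc' : a * ((c : ℤ) : S) = ((b : ℤ) : S) := by simpa using hc
        rw [← Int.cast_smul_eq_zsmul S, ← Int.cast_smul_eq_zsmul S, ← Int.cast_smul_eq_zsmul S,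
          smul_smul, smul_smul, ← hc']
        push_cast
        congr 1
        ring
      rw [this]
      exact H.smul_mem _ hx

/-- Elements that are in a localization up to a product of a denominator and some number. -/
theorem exists_smul_mem_range (S : Type) [CommRing S] (T : Submonoid ℤ) [IsLocalization T S]
    {M V : Type} [AddCommGroup M] [Module S M] [AddCommGroup V]
    [IsAddTorsionFree V] (hT : (0 : ℤ) ∉ T) (j : M →+ V) {s t : ℤ}
    (ht : t ∈ T) {y : V} (h : (s * t) • y ∈ j.range) : s • y ∈ j.range := by
  obtain ⟨x, hx⟩ := h
  obtain ⟨u, hu⟩ := IsLocalization.map_units S (⟨t, ht⟩ : T)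
  have hu' : (u : S) = ((t : ℤ) : S) := by simpa using hu
  refine ⟨(↑u⁻¹ : S) • x, ?_⟩
  have ht0 : t ≠ 0 := fun h0 => hT (h0 ▸ ht)
  refine smul_right_injective V ht0 ?_
  have : t • (↑u⁻¹ : S) • x = x := by
    rw [← Int.cast_smul_eq_zsmul S, ← hu', smul_smul, Units.mul_inv, one_smul]
  change t • j _ = t • s • y
  rw [← map_zsmul, this, hx, smul_smul, mul_comm]

theorem exists_addMonoidHom_of_le_range (S : Type) [CommRing S] (T : Submonoid ℤ) [IsLocalization T S]
    {M V : Type} [AddCommGroup M] [Module S M] [AddCommGroup V]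
    {j : M →+ V} (hj : Function.Injective j)
    (H : Submodule ℤ V) (hH : ∀ y ∈ H, y ∈ j.range) (ht : ∀ y, ∃ t ∈ T, t • j y ∈ H) :
    ∃ i : H →+ M, (∀ x, j (i x) = x) ∧ IsLocalizedModule T i.toIntLinearMap := by
  choose f hf using fun x : H => hH x x.2
  let i : H →+ M := ⟨⟨f, hj (by simp [hf])⟩, fun x y => hj (by simp [hf])⟩
  have hi (x) : j (i x) = x := hf x
  refine ⟨i, hi, isLocalizedModule_of_injective S T i (fun x y h => ?_) fun y => ?_⟩
  · exact Subtype.ext (by rw [← hi x, ← hi y, h])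
  · obtain ⟨t, ht, h⟩ := ht y
    exact ⟨t, ht, ⟨_, h⟩, hj (by rw [hi, map_zsmul])⟩

theorem charZero_zLoc (p : ℕ) [Fact p.Prime] : CharZero (ZLoc p) := by
  have h : Function.Injective (algebraMap ℤ (ZLoc p)) :=
    IsLocalization.injective _ (Ideal.primeCompl_le_nonZeroDivisors (Ideal.span {(p : ℤ)}))
  refine ⟨fun m n h' => ?_⟩
  have := @h m n (by simpa using h')
  exact_mod_cast this

namespace CubicDiagram

variable {S S' : Type} [CommRing S] [CommRing S'] (T T' : Submonoid ℤ) [IsLocalization T S]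
  [IsLocalization T' S']

/-- The restriction of a diagram to a stable family of subgroups. -/
def restrict {R : Type} [CommRing R] (E : CubicDiagram R) {H₁ : Submodule ℤ E.V₁}
    {H₂ : Submodule ℤ E.V₂} {H₃ : Submodule ℤ E.V₃} (hH : E.IsStable H₁ H₂ H₃) :
    CubicDiagram ℤ where
  V₁ := ModuleCat.of ℤ H₁
  V₂ := ModuleCat.of ℤ H₂
  V₃ := ModuleCat.of ℤ H₃
  h := E.h.toAddMonoidHom.toIntLinearMap.restrict hH.h
  p := E.p.toAddMonoidHom.toIntLinearMap.restrict hH.p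
  h₁ := E.h₁.toAddMonoidHom.toIntLinearMap.restrict hH.h₁
  h₂ := E.h₂.toAddMonoidHom.toIntLinearMap.restrict hH.h₂
  p₁ := E.p₁.toAddMonoidHom.toIntLinearMap.restrict hH.p₁
  p₂ := E.p₂.toAddMonoidHom.toIntLinearMap.restrict hH.p₂

theorem restrict_tensor_isomorphic {R : Type} [CommRing R] {E : CubicDiagram R}
    {H₁ : Submodule ℤ E.V₁} {H₂ : Submodule ℤ E.V₂} {H₃ : Submodule ℤ E.V₃}
    (hH : E.IsStable H₁ H₂ H₃) {M : CubicDiagram S} (j : AddHom M E)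
    (j₁ : Function.Injective j.f₁) (j₂ : Function.Injective j.f₂) (j₃ : Function.Injective j.f₃)
    (r₁ : ∀ y ∈ H₁, y ∈ j.f₁.range) (r₂ : ∀ y ∈ H₂, y ∈ j.f₂.range)
    (r₃ : ∀ y ∈ H₃, y ∈ j.f₃.range) (t₁ : ∀ y, ∃ t ∈ T, t • j.f₁ y ∈ H₁)
    (t₂ : ∀ y, ∃ t ∈ T, t • j.f₂ y ∈ H₂) (t₃ : ∀ y, ∃ t ∈ T, t • j.f₃ y ∈ H₃) :
    ((E.restrict hH).tensor S).Isomorphic M := by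
  obtain ⟨i₁, a₁, l₁⟩ := exists_addMonoidHom_of_le_range S T j₁ H₁ r₁ t₁
  obtain ⟨i₂, a₂, l₂⟩ := exists_addMonoidHom_of_le_range S T j₂ H₂ r₂ t₂
  obtain ⟨i₃, a₃, l₃⟩ := exists_addMonoidHom_of_le_range S T j₃ H₃ r₃ t₃
  refine @tensor_isomorphic _ _ S _ T _ (E.restrict hH) M i₁ i₂ i₃ l₁ l₂ l₃
    (fun x => j₂ ?_) (fun x => j₁ ?_)
    (fun x => j₃ ?_) (fun x => j₃ ?_) (fun x => j₂ ?_) (fun x => j₂ ?_)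
  · exact (a₂ _).trans ((congrArg E.h (a₁ x)).symm.trans (j.h _).symm)
  · exact (a₁ _).trans ((congrArg E.p (a₂ x)).symm.trans (j.p _).symm)
  · exact (a₃ _).trans ((congrArg E.h₁ (a₂ x)).symm.trans (j.h₁ _).symm)
  · exact (a₃ _).trans ((congrArg E.h₂ (a₂ x)).symm.trans (j.h₂ _).symm)
  · exact (a₂ _).trans ((congrArg E.p₁ (a₃ x)).symm.trans (j.p₁ _).symm)
  · exact (a₂ _).trans ((congrArg E.p₂ (a₃ x)).symm.trans (j.p₂ _).symm)

theorem IsAModule.restrict {R : Type} [CommRing R] {E : CubicDiagram R} (hE : E.IsAModule)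
    {H₁ : Submodule ℤ E.V₁} {H₂ : Submodule ℤ E.V₂} {H₃ : Submodule ℤ E.V₃}
    (hH : E.IsStable H₁ H₂ H₃) : (E.restrict hH).IsAModule :=
  hE.of_injective H₁.subtype.toAddMonoidHom H₂.subtype.toAddMonoidHom H₃.subtype.toAddMonoidHom
    H₁.injective_subtype H₂.injective_subtype H₃.injective_subtype
    (fun _ => rfl) (fun _ => rfl) (fun _ => rfl) (fun _ => rfl) (fun _ => rfl) fun _ => rfl

/-- The inclusion of a diagram into a scalar extension. -/
def toTensor {R : Type} [CommRing R] (S : Type) [CommRing S] (D : CubicDiagram R) :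
    AddHom D (D.tensor S) where
  f₁ := (TensorProduct.mk ℤ S D.V₁ 1).toAddMonoidHom
  f₂ := (TensorProduct.mk ℤ S D.V₂ 1).toAddMonoidHom
  f₃ := (TensorProduct.mk ℤ S D.V₃ 1).toAddMonoidHom
  h _ := rfl
  p _ := rfl
  h₁ _ := rfl
  h₂ _ := rfl
  p₁ _ := rfl
  p₂ _ := rfl

theorem toTensor_injective {R : Type} [CommRing R] (M : CubicDiagram R) [IsAddTorsionFree M.V₁]
    [IsAddTorsionFree M.V₂] [IsAddTorsionFree M.V₃] :
    Function.Injective (M.toTensor ℚ).f₁ ∧ Function.Injective (M.toTensor ℚ).f₂ ∧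
      Function.Injective (M.toTensor ℚ).f₃ := by
  have h : (0 : ℤ) ∉ nonZeroDivisors ℤ := by simp
  exact ⟨IsLocalization.one_tmul_injective ℚ h, IsLocalization.one_tmul_injective ℚ h,
    IsLocalization.one_tmul_injective ℚ h⟩

theorem exists_smul_mem_range_toTensor {R : Type} [CommRing R] (M : CubicDiagram R) :
    (∀ y, ∃ n : ℤ, n ≠ 0 ∧ n • y ∈ (M.toTensor ℚ).f₁.range) ∧
    (∀ y, ∃ n : ℤ, n ≠ 0 ∧ n • y ∈ (M.toTensor ℚ).f₂.range) ∧
    (∀ y, ∃ n : ℤ, n ≠ 0 ∧ n • y ∈ (M.toTensor ℚ).f₃.range) := by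
  have key (V : Type) [AddCommGroup V] (y : ℚ ⊗[ℤ] V) : ∃ n : ℤ, n ≠ 0 ∧
      ∃ x : V, (1 : ℚ) ⊗ₜ[ℤ] x = n • y := by
    obtain ⟨n, hn, x, hx⟩ := IsLocalization.exists_smul_eq_one_tmul ℚ (nonZeroDivisors ℤ) y
    exact ⟨n, nonZeroDivisors.ne_zero hn, x, hx.symm⟩
  exact ⟨key M.V₁, key M.V₂, key M.V₃⟩

/-- Two lattices over localizations of `ℤ` that have all denominators between them, in a common
rational diagram, are localizations of the same lattice. -/
theorem exists_tensor_isomorphic {R : Type} [CommRing R] {E : CubicDiagram R} (hE : E.IsAModule)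
    [IsAddTorsionFree E.V₁] [IsAddTorsionFree E.V₂] [IsAddTorsionFree E.V₃]
    (hT : (0 : ℤ) ∉ T) (hT' : (0 : ℤ) ∉ T')
    (hTT' : ∀ n : ℤ, n ≠ 0 → ∃ s ∈ T, ∃ t ∈ T', n = s * t)
    {M : CubicDiagram S} {M' : CubicDiagram S'} (hM : M.IsTorsionFreeAModule)
    (hM' : M'.IsTorsionFreeAModule) (j : AddHom M E) (j' : AddHom M' E)
    (hj : Function.Injective j.f₁ ∧ Function.Injective j.f₂ ∧ Function.Injective j.f₃)
    (hj' : Function.Injective j'.f₁ ∧ Function.Injective j'.f₂ ∧ Function.Injective j'.f₃)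
    (hr : (∀ y, ∃ n : ℤ, n ≠ 0 ∧ n • y ∈ j.f₁.range) ∧
      (∀ y, ∃ n : ℤ, n ≠ 0 ∧ n • y ∈ j.f₂.range) ∧ ∀ y, ∃ n : ℤ, n ≠ 0 ∧ n • y ∈ j.f₃.range)
    (hr' : (∀ y, ∃ n : ℤ, n ≠ 0 ∧ n • y ∈ j'.f₁.range) ∧
      (∀ y, ∃ n : ℤ, n ≠ 0 ∧ n • y ∈ j'.f₂.range) ∧
      ∀ y, ∃ n : ℤ, n ≠ 0 ∧ n • y ∈ j'.f₃.range) :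
    ∃ D : CubicDiagram ℤ, D.IsTorsionFreeAModule ∧ (D.tensor S).Isomorphic M ∧
      (D.tensor S').Isomorphic M' := by
  have := Fact.mk hE
  obtain ⟨-, f₁, f₂, f₃, -, -, -⟩ := hM
  obtain ⟨-, f₁', f₂', f₃', -, -, -⟩ := hM'
  -- For each component: a finitely generated subgroup of the intersection of the two lattices that
  -- spans each of them up to denominators.
  have key {P P' V : Type} [AddCommGroup P] [AddCommGroup P'] [AddCommGroup V] [Module S P]
      [Module S' P'] [Module.Finite S P] [Module.Finite S' P'] [IsAddTorsionFree V]
      (a : P →+ V) (a' : P' →+ V) (r : ∀ y : V, ∃ n : ℤ, n ≠ 0 ∧ n • y ∈ a.range)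
      (r' : ∀ y : V, ∃ n : ℤ, n ≠ 0 ∧ n • y ∈ a'.range) :
      ∃ G : Submodule ℤ V, G.FG ∧ (∀ y ∈ G, y ∈ a.range ∧ y ∈ a'.range) ∧
        ∀ H : Submodule ℤ V, G ≤ H → (∀ y, ∃ t ∈ T, t • a y ∈ H) ∧ ∀ y, ∃ t ∈ T', t • a' y ∈ H := by
    obtain ⟨G, g, hG, hH⟩ := exists_fg_forall_smul_mem S T a a'.range fun x => by
      obtain ⟨n, hn, h⟩ := r' (a x)
      obtain ⟨s, hs, t, ht, rfl⟩ := hTT' n hn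
      exact ⟨s, hs, exists_smul_mem_range S' T' hT' a' ht h⟩
    obtain ⟨G', g', hG', hH'⟩ := exists_fg_forall_smul_mem S' T' a' a.range fun x => by
      obtain ⟨n, hn, h⟩ := r (a' x)
      obtain ⟨s, hs, t, ht, rfl⟩ := hTT' n hn
      exact ⟨t, ht, exists_smul_mem_range S T hT a hs (mul_comm s t ▸ h)⟩
    refine ⟨G ⊔ G', g.sup g', fun y hy => ?_, fun H h => ⟨hH H (le_sup_left.trans h),
      hH' H (le_sup_right.trans h)⟩⟩
    obtain ⟨u, hu, v, hv, rfl⟩ := Submodule.mem_sup.1 hy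
    exact ⟨add_mem (hG u hu).1 (hG' v hv).2, add_mem (hG u hu).2 (hG' v hv).1⟩
  obtain ⟨G₁, g₁, k₁, l₁⟩ := key j.f₁ j'.f₁ hr.1 hr'.1
  obtain ⟨G₂, g₂, k₂, l₂⟩ := key j.f₂ j'.f₂ hr.2.1 hr'.2.1
  obtain ⟨G₃, g₃, k₃, l₃⟩ := key j.f₃ j'.f₃ hr.2.2 hr'.2.2
  obtain ⟨H₁, H₂, H₃, hH, h₁, h₂, h₃, i₁, i₂, i₃, hN⟩ := E.exists_isStable g₁ g₂ g₃
  -- Each of the two lattices is stable under the structure maps, so the minimal stable family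
  -- generated by the groups `Gᵢ` remains inside it.
  have range {U : Type} [CommRing U] {P : CubicDiagram U} (a : AddHom P E)
      (b₁ : ∀ y ∈ G₁, y ∈ a.f₁.range) (b₂ : ∀ y ∈ G₂, y ∈ a.f₂.range)
      (b₃ : ∀ y ∈ G₃, y ∈ a.f₃.range) : (∀ y ∈ H₁, y ∈ a.f₁.range) ∧
      (∀ y ∈ H₂, y ∈ a.f₂.range) ∧ ∀ y ∈ H₃, y ∈ a.f₃.range := by
    refine hN (AddSubgroup.toIntSubmodule a.f₁.range) (AddSubgroup.toIntSubmodule a.f₂.range)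
      (AddSubgroup.toIntSubmodule a.f₃.range) ⟨?_, ?_, ?_, ?_, ?_, ?_⟩ b₁ b₂ b₃
    · rintro _ ⟨x, rfl⟩; exact ⟨_, a.h x⟩
    · rintro _ ⟨x, rfl⟩; exact ⟨_, a.p x⟩
    · rintro _ ⟨x, rfl⟩; exact ⟨_, a.h₁ x⟩
    · rintro _ ⟨x, rfl⟩; exact ⟨_, a.h₂ x⟩
    · rintro _ ⟨x, rfl⟩; exact ⟨_, a.p₁ x⟩
    · rintro _ ⟨x, rfl⟩; exact ⟨_, a.p₂ x⟩
  obtain ⟨r₁, r₂, r₃⟩ := range j (fun y hy => (k₁ y hy).1) (fun y hy => (k₂ y hy).1)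
    (fun y hy => (k₃ y hy).1)
  obtain ⟨r₁', r₂', r₃'⟩ := range j' (fun y hy => (k₁ y hy).2) (fun y hy => (k₂ y hy).2)
    (fun y hy => (k₃ y hy).2)
  have t (V : Type) [AddCommGroup V] [IsAddTorsionFree V] (H : Submodule ℤ V) :
      Module.IsTorsionFree ℤ H := inferInstance
  refine ⟨E.restrict hH, ⟨hE.restrict hH, Module.Finite.iff_fg.2 h₁, Module.Finite.iff_fg.2 h₂,
    Module.Finite.iff_fg.2 h₃, t _ H₁, t _ H₂, t _ H₃⟩,
    restrict_tensor_isomorphic T hH j hj.1 hj.2.1 hj.2.2 r₁ r₂ r₃ (l₁ H₁ i₁).1 (l₂ H₂ i₂).1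
      (l₃ H₃ i₃).1,
    restrict_tensor_isomorphic T' hH j' hj'.1 hj'.2.1 hj'.2.2 r₁' r₂' r₃' (l₁ H₁ i₁).2
      (l₂ H₂ i₂).2 (l₃ H₃ i₃).2⟩

theorem exists_tensor_zLoc_isomorphic {M₂ : CubicDiagram (ZLoc 2)} {M₃ : CubicDiagram (ZLoc 3)}
    (h₂ : M₂.IsTorsionFreeAModule) (h₃ : M₃.IsTorsionFreeAModule)
    (h : (M₂.tensor ℚ).Isomorphic (M₃.tensor ℚ)) :
    ∃ D : CubicDiagram ℤ, D.IsTorsionFreeAModule ∧ (D.tensor (ZLoc 2)).Isomorphic M₂ ∧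
      (D.tensor (ZLoc 3)).Isomorphic M₃ := by
  have a {p : ℕ} [Fact p.Prime] {M : CubicDiagram (ZLoc p)} (hM : M.IsTorsionFreeAModule) :
      IsAddTorsionFree M.V₁ ∧ IsAddTorsionFree M.V₂ ∧ IsAddTorsionFree M.V₃ := by
    have := charZero_zLoc p
    obtain ⟨-, -, -, -, t₁, t₂, t₃⟩ := hM
    exact ⟨isAddTorsionFree_of_charZero (ZLoc p) M.V₁, isAddTorsionFree_of_charZero (ZLoc p) M.V₂,
      isAddTorsionFree_of_charZero (ZLoc p) M.V₃⟩
  obtain ⟨a₁, a₂, a₃⟩ := a h₂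
  obtain ⟨b₁, b₂, b₃⟩ := a h₃
  obtain ⟨e₁, e₂, e₃, i, j, k, l, m, n⟩ := h
  let f : AddHom M₂ (M₃.tensor ℚ) :=
    { f₁ := e₁.toAddMonoidHom.comp (M₂.toTensor ℚ).f₁
      f₂ := e₂.toAddMonoidHom.comp (M₂.toTensor ℚ).f₂
      f₃ := e₃.toAddMonoidHom.comp (M₂.toTensor ℚ).f₃
      h := fun x => i ((M₂.toTensor ℚ).f₁ x)
      p := fun x => j ((M₂.toTensor ℚ).f₂ x)
      h₁ := fun x => k ((M₂.toTensor ℚ).f₂ x)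
      h₂ := fun x => l ((M₂.toTensor ℚ).f₂ x)
      p₁ := fun x => m ((M₂.toTensor ℚ).f₃ x)
      p₂ := fun x => n ((M₂.toTensor ℚ).f₃ x) }
  have key {X V W : Type} [AddCommGroup X] [AddCommGroup V] [AddCommGroup W] [Module ℚ V]
      [Module ℚ W] (e : V ≃ₗ[ℚ] W) (g : X →+ V) (hg : ∀ y : V, ∃ n : ℤ, n ≠ 0 ∧ n • y ∈ g.range)
      (y : W) : ∃ n : ℤ, n ≠ 0 ∧ n • y ∈ (e.toAddMonoidHom.comp g).range := by
    obtain ⟨n, hn, x, hx⟩ := hg (e.symm y)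
    refine ⟨n, hn, x, ?_⟩
    change e (g x) = n • y
    rw [hx, map_zsmul, e.apply_symm_apply]
  obtain ⟨c₁, c₂, c₃⟩ := M₂.toTensor_injective
  obtain ⟨d₁, d₂, d₃⟩ := M₂.exists_smul_mem_range_toTensor
  have t (V : Type) [AddCommGroup V] [Module ℚ V] : IsAddTorsionFree V :=
    isAddTorsionFree_of_charZero ℚ V
  have := t (M₃.tensor ℚ).V₁
  have := t (M₃.tensor ℚ).V₂
  have := t (M₃.tensor ℚ).V₃
  refine exists_tensor_isomorphic (Ideal.span {((2 : ℕ) : ℤ)}).primeCompl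
    (Ideal.span {((3 : ℕ) : ℤ)}).primeCompl (h₃.isAModule.tensor ℚ) (zero_notMem_primeCompl 2)
    (zero_notMem_primeCompl 3) (fun n hn => ?_) h₂ h₃ f (M₃.toTensor ℚ)
    ⟨e₁.injective.comp c₁, e₂.injective.comp c₂, e₃.injective.comp c₃⟩ M₃.toTensor_injective
    ⟨key e₁ _ d₁, key e₂ _ d₂, key e₃ _ d₃⟩ M₃.exists_smul_mem_range_toTensor
  -- Write `n` as a power of 2 times an odd `m`: the odd factor is a denominator for `ℤ_(2)`, the
  -- power of 2 one for `ℤ_(3)`.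
  obtain ⟨m, hk, hm⟩ :=
    (Int.finiteMultiplicity_iff.2 ⟨by simp, hn⟩ :
      FiniteMultiplicity (2 : ℤ) n).exists_eq_pow_mul_and_not_dvd
  refine ⟨m, fun h => hm (Ideal.mem_span_singleton.1 h), _, fun h => ?_,
    hk.trans (mul_comm _ _)⟩
  have := Int.prime_three.dvd_of_dvd_pow (Ideal.mem_span_singleton.1 h)
  norm_num at this

end CubicDiagram
end

/-! ### Cross-effects of functors on the groups `ℤ ^ n` and the relations of `𝐀`. -/

noncomputable section

/-! ### Maps between the groups `ℤ ^ n` given by maps of the index sets -/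

/-- The map that adds up the coordinates in the fibres of `a`. -/
def upHom {m n : ℕ} (a : Fin m → Fin n) : (Fin m → ℤ) →+ (Fin n → ℤ) where
  toFun y j := ∑ i with a i = j, y i
  map_zero' := by
    funext j
    simp
  map_add' x y := by
    funext j
    simp [Finset.sum_add_distrib]

/-- The map that copies the coordinates along `b`. -/
def downHom {m n : ℕ} (b : Fin n → Fin m) : (Fin m → ℤ) →+ (Fin n → ℤ) where
  toFun x i := x (b i)
  map_zero' := rfl
  map_add' _ _ := rfl

/-- The projection to the coordinates in `S`. -/
def projHom {m : ℕ} (S : Finset (Fin m)) : (Fin m → ℤ) →+ (Fin m → ℤ) where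
  toFun x i := if i ∈ S then x i else 0
  map_zero' := by
    funext i
    simp
  map_add' x y := by
    funext i
    by_cases h : i ∈ S <;> simp [h]

theorem upHom_apply {m n : ℕ} (a : Fin m → Fin n) (x : Fin m → ℤ) (j : Fin n) :
    upHom a x j = ∑ i with a i = j, x i := rfl

theorem downHom_apply {m n : ℕ} (b : Fin n → Fin m) (x : Fin m → ℤ) (i : Fin n) :
    downHom b x i = x (b i) := rfl

theorem projHom_apply {m : ℕ} (S : Finset (Fin m)) (x : Fin m → ℤ) (i : Fin m) :
    projHom S x i = if i ∈ S then x i else 0 := rfl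

theorem upHom_comp {m n k : ℕ} (c : Fin n → Fin k) (a : Fin m → Fin n) :
    (upHom c).comp (upHom a) = upHom (c ∘ a) := by
  refine AddMonoidHom.ext fun x => funext fun j => ?_
  simp only [AddMonoidHom.comp_apply, upHom_apply, Function.comp_apply]
  rw [Finset.sum_sigma']
  exact Finset.sum_bij' (fun i _ => i.2) (fun i _ => ⟨a i, i⟩) (fun i hi => by aesop)
    (fun i hi => by aesop) (fun i hi => by aesop) (fun i hi => by aesop) (fun i hi => by aesop)

theorem downHom_comp {m n k : ℕ} (c : Fin k → Fin n) (b : Fin n → Fin m) :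
    (downHom c).comp (downHom b) = downHom (b ∘ c) := rfl

theorem projHom_comp {m : ℕ} (S T : Finset (Fin m)) :
    (projHom S).comp (projHom T) = projHom (S ∩ T) := by
  refine AddMonoidHom.ext fun x => funext fun i => ?_
  simp only [AddMonoidHom.comp_apply, projHom_apply, Finset.mem_inter, ite_and]

theorem projHom_univ (m : ℕ) : projHom (Finset.univ : Finset (Fin m)) = AddMonoidHom.id _ := by
  refine AddMonoidHom.ext fun x => funext fun i => ?_
  simp [projHom_apply]

theorem projHom_comp_upHom {m n : ℕ} (T : Finset (Fin n)) (a : Fin m → Fin n) :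
    (projHom T).comp (upHom a) = (upHom a).comp (projHom {i | a i ∈ T}) := by
  refine AddMonoidHom.ext fun x => funext fun j => ?_
  simp only [AddMonoidHom.comp_apply, projHom_apply, upHom_apply, Finset.mem_filter,
    Finset.mem_univ, true_and]
  split_ifs with h
  · exact Finset.sum_congr rfl fun i hi => by simp [(Finset.mem_filter.1 hi).2, h]
  · exact (Finset.sum_eq_zero fun i hi => by simp [(Finset.mem_filter.1 hi).2, h]).symm

theorem downHom_comp_projHom {m n : ℕ} (b : Fin n → Fin m) (T : Finset (Fin m)) :
    (downHom b).comp (projHom T) = (projHom {i | b i ∈ T}).comp (downHom b) := by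
  refine AddMonoidHom.ext fun x => funext fun i => ?_
  simp [projHom_apply, downHom_apply]

theorem upHom_comp_downHom {m n : ℕ} {ι : Fin n → Fin m} (hι : Function.Injective ι) :
    (upHom ι).comp (downHom ι) = projHom (Finset.univ.image ι) := by
  refine AddMonoidHom.ext fun x => funext fun j => ?_
  simp only [AddMonoidHom.comp_apply, projHom_apply, upHom_apply, downHom_apply,
    Finset.mem_image, Finset.mem_univ, true_and]
  split_ifs with h
  · obtain ⟨i, rfl⟩ := h
    rw [Finset.sum_eq_single i]
    · intro b hb hbi
      exact absurd (hι (Finset.mem_filter.1 hb).2) hbi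
    · simp
  · refine Finset.sum_eq_zero fun i hi => absurd ⟨i, (Finset.mem_filter.1 hi).2⟩ h

theorem upHom_comp_projHom_comp_downHom {m n : ℕ} {ι : Fin n → Fin m}
    (hι : Function.Injective ι) (U : Finset (Fin n)) :
    (upHom ι).comp ((projHom U).comp (downHom ι)) = projHom (U.image ι) := by
  have hU : ({i | ι i ∈ U.image ι} : Finset (Fin n)) = U := by
    ext i
    simp [hι.eq_iff]
  have h := projHom_comp_upHom (U.image ι) ι
  rw [hU] at h
  rw [← AddMonoidHom.comp_assoc, ← h, AddMonoidHom.comp_assoc, upHom_comp_downHom hι,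
    projHom_comp, Finset.inter_eq_left.2 (Finset.image_subset_image (Finset.subset_univ U))]

theorem upHom_eq_downHom {m : ℕ} (σ : Equiv.Perm (Fin m)) : upHom σ = downHom σ.symm := by
  refine AddMonoidHom.ext fun x => funext fun j => ?_
  rw [upHom_apply, downHom_apply, Finset.sum_eq_single (σ.symm j)]
  · intro b hb hbi
    exact absurd (by simpa [Equiv.eq_symm_apply] using hb) hbi
  · simp

/-! ### Deviations -/

section functor

variable (F : FreeAb ⥤ FreeAb)

/-- The action of a functor on the homomorphisms between the groups `ℤ ^ n`. -/
def act {m n : ℕ} (f : (Fin m → ℤ) →+ (Fin n → ℤ)) :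
    (F.obj (FreeAb.pow m)).obj →+ (F.obj (FreeAb.pow n)).obj :=
  mapHom F (FreeAb.ofHom (X := FreeAb.pow m) (Y := FreeAb.pow n) f)

theorem mapHom_comp {X Y Z : FreeAb} (f : X ⟶ Y) (g : Y ⟶ Z) :
    mapHom F (f ≫ g) = (mapHom F g).comp (mapHom F f) := by
  simp [mapHom]

theorem mapHom_id (X : FreeAb) : mapHom F (𝟙 X) = AddMonoidHom.id _ := by
  simp [mapHom]

theorem act_comp {m n k : ℕ} (g : (Fin n → ℤ) →+ (Fin k → ℤ)) (f : (Fin m → ℤ) →+ (Fin n → ℤ)) :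
    act F (g.comp f) = (act F g).comp (act F f) :=
  mapHom_comp F (FreeAb.ofHom (X := FreeAb.pow m) (Y := FreeAb.pow n) f)
    (FreeAb.ofHom (X := FreeAb.pow n) (Y := FreeAb.pow k) g)

theorem act_id (m : ℕ) : act F (AddMonoidHom.id (Fin m → ℤ)) = AddMonoidHom.id _ :=
  mapHom_id F (FreeAb.pow m)

theorem act_act {m n k : ℕ} (g : (Fin n → ℤ) →+ (Fin k → ℤ)) (f : (Fin m → ℤ) →+ (Fin n → ℤ))
    (x : (F.obj (FreeAb.pow m)).obj) : act F g (act F f x) = act F (g.comp f) x := by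
  rw [act_comp]; rfl

/-- The deviation `f(S)` on `F(ℤ ^ m)`. -/
def dev {m : ℕ} (S : Finset (Fin m)) :
    (F.obj (FreeAb.pow m)).obj →+ (F.obj (FreeAb.pow m)).obj :=
  deviation F (fun _ : Fin m => FreeAb.int) S

theorem dev_eq {m : ℕ} (S : Finset (Fin m)) :
    dev F S = ∑ T ∈ S.powerset, (-1 : ℤ) ^ (S.card - T.card) • act F (projHom T) := rfl

theorem dev_apply {m : ℕ} (S : Finset (Fin m)) (x : (F.obj (FreeAb.pow m)).obj) :
    dev F S x = ∑ T ∈ S.powerset, (-1 : ℤ) ^ (S.card - T.card) • act F (projHom T) x := by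
  rw [dev_eq, AddMonoidHom.finsetSum_apply]; rfl

theorem sum_dev {m : ℕ} (x : (F.obj (FreeAb.pow m)).obj) : ∑ T, dev F T x = x := by
  have h := sum_deviation F (fun _ : Fin m => FreeAb.int) Finset.univ
  rw [Finset.powerset_univ] at h
  have h' := DFunLike.congr_fun h x
  rw [AddMonoidHom.finsetSum_apply] at h'
  refine h'.trans ?_
  change act F (projHom Finset.univ) x = x
  rw [projHom_univ, act_id]
  rfl

/-- The deviation is supported on its index set. -/
theorem dev_image {m n : ℕ} {ι : Fin n → Fin m} (hι : Function.Injective ι)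
    (x : (F.obj (FreeAb.pow m)).obj) : dev F (Finset.univ.image ι) x =
      act F (upHom ι) (dev F Finset.univ (act F (downHom ι) x)) := by
  rw [dev_apply, dev_apply, map_sum, Finset.powerset_univ, Finset.powerset_image,
    Finset.powerset_univ, Finset.sum_image (Finset.image_injective hι).injOn]
  refine Finset.sum_congr rfl fun U _ => ?_
  rw [map_zsmul, act_act, act_act, AddMonoidHom.comp_assoc, upHom_comp_projHom_comp_downHom hι,
    Finset.card_image_of_injective _ hι, Finset.card_image_of_injective _ hι]

/-- For an index `i` outside `T`, the terms of the alternating sum for `U` and `U ∪ {i}` involve the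
same projection after intersection with `T` and have opposite signs. -/
theorem dev_univ_act_projHom {m : ℕ} {T : Finset (Fin m)} (hT : T ≠ Finset.univ)
    (x : (F.obj (FreeAb.pow m)).obj) : dev F Finset.univ (act F (projHom T) x) = 0 := by
  obtain ⟨i, hi⟩ : ∃ i, i ∉ T := by
    by_contra! h
    exact hT (Finset.eq_univ_iff_forall.2 h)
  rw [dev_apply, ← Finset.insert_erase (Finset.mem_univ i),
    Finset.sum_powerset_insert (Finset.notMem_erase _ _), ← Finset.sum_add_distrib]
  refine Finset.sum_eq_zero fun U hU => ?_
  have hiU : i ∉ U := fun h => Finset.notMem_erase i _ (Finset.mem_powerset.1 hU h)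
  have hc : U.card < m := by
    have := Finset.card_lt_univ_of_notMem hiU
    simpa using this
  rw [act_act, act_act, projHom_comp, projHom_comp, Finset.insert_inter_of_notMem hi,
    Finset.insert_erase (Finset.mem_univ i), Finset.card_insert_of_notMem hiU, Finset.card_univ,
    Fintype.card_fin, ← add_smul]
  obtain ⟨k, hk⟩ := Nat.exists_eq_add_of_lt hc
  have h1 : m - U.card = k + 1 := by omega
  have h2 : m - (U.card + 1) = k := by omega
  rw [h1, h2, pow_succ]
  simp

theorem act_projHom_dev_univ {m : ℕ} {T : Finset (Fin m)} (hT : T ≠ Finset.univ)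
    (x : (F.obj (FreeAb.pow m)).obj) : act F (projHom T) (dev F Finset.univ x) = 0 := by
  rw [← dev_univ_act_projHom F hT x, dev_apply, dev_apply, map_sum]
  refine Finset.sum_congr rfl fun U _ => ?_
  rw [map_zsmul, act_act, act_act, projHom_comp, projHom_comp, Finset.inter_comm]

theorem dev_univ_dev_univ {m : ℕ} (x : (F.obj (FreeAb.pow m)).obj) :
    dev F Finset.univ (dev F Finset.univ x) = dev F Finset.univ x := by
  conv_lhs => rw [dev_apply]
  rw [Finset.sum_eq_single Finset.univ]
  · simp [projHom_univ, act_id]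
  · intro T _ hT
    rw [act_projHom_dev_univ F hT, smul_zero]
  · simp

/-- If `b` misses a coordinate, `downHom b` factors through the projection onto the remaining ones,
which kills the cross-effect. -/
theorem act_downHom_eq_zero {m n : ℕ} {b : Fin n → Fin m} (hb : ¬ Function.Surjective b)
    {x : (F.obj (FreeAb.pow m)).obj} (hx : dev F Finset.univ x = x) :
    act F (downHom b) x = 0 := by
  have hT : Finset.univ.image b ≠ Finset.univ := fun h => hb (by
    intro j
    have : j ∈ Finset.univ.image b := h ▸ Finset.mem_univ j
    simpa using this)
  have h : downHom b = (downHom b).comp (projHom (Finset.univ.image b)) := by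
    rw [downHom_comp_projHom]
    refine AddMonoidHom.ext fun x => funext fun i => ?_
    simp [projHom_apply]
  rw [h, ← act_act, ← hx, act_projHom_dev_univ F hT, map_zero]

theorem dev_univ_act_upHom_eq_zero {m n : ℕ} {a : Fin m → Fin n} (ha : ¬ Function.Surjective a)
    (x : (F.obj (FreeAb.pow m)).obj) : dev F Finset.univ (act F (upHom a) x) = 0 := by
  have hT : Finset.univ.image a ≠ Finset.univ := fun h => ha (by
    intro j
    have : j ∈ Finset.univ.image a := h ▸ Finset.mem_univ j
    simpa using this)
  have h : upHom a = (projHom (Finset.univ.image a)).comp (upHom a) := by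
    rw [projHom_comp_upHom]
    refine AddMonoidHom.ext fun x => funext fun i => ?_
    simp [projHom_apply, upHom_apply]
  rw [h, ← act_act, dev_univ_act_projHom F hT]

/-- For surjective `a`, the preimage of a proper subset is proper, so all other terms of the
deviation vanish. The image of a cross-effect thus needs no further projection, which makes
`crossUp` functorial for surjections. -/
theorem dev_univ_act_upHom {m n : ℕ} {a : Fin m → Fin n} (ha : Function.Surjective a)
    {x : (F.obj (FreeAb.pow m)).obj} (hx : dev F Finset.univ x = x) :
    dev F Finset.univ (act F (upHom a) x) = act F (upHom a) x := by
  rw [dev_apply, Finset.sum_eq_single Finset.univ]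
  · simp [projHom_univ, act_id]
  · intro T _ hT
    rw [act_act, projHom_comp_upHom, ← act_act, ← hx, act_projHom_dev_univ F, map_zero, smul_zero]
    intro h
    refine hT (Finset.eq_univ_iff_forall.2 fun j => ?_)
    obtain ⟨i, rfl⟩ := ha j
    exact (Finset.mem_filter.1 (h.ge (Finset.mem_univ i))).2
  · simp

/-- The dual of `dev_univ_act_upHom`: an intermediate projection onto the cross-effect may be
omitted before `downHom b` for surjective `b`. -/
theorem dev_univ_act_downHom_dev_univ {m n : ℕ} {b : Fin n → Fin m} (hb : Function.Surjective b)
    (x : (F.obj (FreeAb.pow m)).obj) :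
    dev F Finset.univ (act F (downHom b) (dev F Finset.univ x)) =
      dev F Finset.univ (act F (downHom b) x) := by
  rw [dev_apply F Finset.univ x, map_sum, map_sum, Finset.sum_eq_single Finset.univ]
  · simp [projHom_univ, act_id]
  · intro T _ hT
    rw [map_zsmul, map_zsmul, act_act, downHom_comp_projHom, ← act_act, dev_univ_act_projHom F,
      smul_zero]
    intro h
    refine hT (Finset.eq_univ_iff_forall.2 fun j => ?_)
    obtain ⟨i, rfl⟩ := hb j
    exact (Finset.mem_filter.1 (h.ge (Finset.mem_univ i))).2
  · simp

theorem mem_crossZ_iff {m : ℕ} {x : (F.obj (FreeAb.pow m)).obj} :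
    x ∈ crossZ F m ↔ dev F Finset.univ x = x :=
  ⟨fun ⟨y, hy⟩ => hy ▸ dev_univ_dev_univ F y, fun h => ⟨x, h⟩⟩

end functor

end

/-! ### Calculus of spans of finite sets on cross-effects. -/

noncomputable section

section functor

variable (F : FreeAb ⥤ FreeAb)

/-- The map between cross-effects that is induced by `upHom r`. -/
def crossUp {m n : ℕ} (r : Fin m → Fin n) :
    (F.obj (FreeAb.pow m)).obj →+ (F.obj (FreeAb.pow n)).obj :=
  (dev F Finset.univ).comp (act F (upHom r))

/-- The map between cross-effects that is induced by `downHom l`. -/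
def crossDown {m n : ℕ} (l : Fin n → Fin m) :
    (F.obj (FreeAb.pow m)).obj →+ (F.obj (FreeAb.pow n)).obj :=
  (dev F Finset.univ).comp (act F (downHom l))

variable {F}

theorem crossUp_mem {m n : ℕ} (r : Fin m → Fin n) (x : (F.obj (FreeAb.pow m)).obj) :
    crossUp F r x ∈ crossZ F n := ⟨_, rfl⟩

theorem crossDown_mem {m n : ℕ} (l : Fin n → Fin m) (x : (F.obj (FreeAb.pow m)).obj) :
    crossDown F l x ∈ crossZ F n := ⟨_, rfl⟩

theorem crossUp_id {m : ℕ} {x : (F.obj (FreeAb.pow m)).obj} (hx : x ∈ crossZ F m) :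
    crossUp F id x = x := by
  have h : upHom (id : Fin m → Fin m) = AddMonoidHom.id _ := by
    refine AddMonoidHom.ext fun x => funext fun i => ?_
    simp [upHom_apply, Finset.filter_eq']
  change dev F Finset.univ (act F (upHom id) x) = x
  rw [h, act_id]
  exact (mem_crossZ_iff F).1 hx

theorem crossDown_id {m : ℕ} {x : (F.obj (FreeAb.pow m)).obj} (hx : x ∈ crossZ F m) :
    crossDown F id x = x := by
  change dev F Finset.univ (act F (AddMonoidHom.id _) x) = x
  rw [act_id]
  exact (mem_crossZ_iff F).1 hx

theorem crossUp_crossUp {m n k : ℕ} {a : Fin m → Fin n} (c : Fin n → Fin k)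
    (ha : Function.Surjective a) {x : (F.obj (FreeAb.pow m)).obj} (hx : x ∈ crossZ F m) :
    crossUp F c (crossUp F a x) = crossUp F (c ∘ a) x := by
  change dev F Finset.univ (act F (upHom c) (dev F Finset.univ (act F (upHom a) x))) =
    dev F Finset.univ (act F (upHom (c ∘ a)) x)
  rw [dev_univ_act_upHom F ha ((mem_crossZ_iff F).1 hx), act_act, upHom_comp]

theorem crossDown_crossDown {m n k : ℕ} {b : Fin k → Fin n} (l : Fin n → Fin m)
    (hb : Function.Surjective b) (x : (F.obj (FreeAb.pow m)).obj) :
    crossDown F b (crossDown F l x) = crossDown F (l ∘ b) x := by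
  change dev F Finset.univ (act F (downHom b) (dev F Finset.univ (act F (downHom l) x))) =
    dev F Finset.univ (act F (downHom (l ∘ b)) x)
  rw [dev_univ_act_downHom_dev_univ F hb, act_act, downHom_comp]

theorem crossUp_perm {m : ℕ} (σ : Equiv.Perm (Fin m)) (x : (F.obj (FreeAb.pow m)).obj) :
    crossUp F σ x = crossDown F σ.symm x := by
  unfold crossUp crossDown
  rw [upHom_eq_downHom]

/-- A span of finite sets may be reindexed. -/
theorem crossUp_crossDown_congr {j k n : ℕ} (σ : Equiv.Perm (Fin n)) {r r' : Fin n → Fin k}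
    {l l' : Fin n → Fin j} (hr : r = r' ∘ σ) (hl : l = l' ∘ σ)
    (x : (F.obj (FreeAb.pow j)).obj) :
    crossUp F r (crossDown F l x) = crossUp F r' (crossDown F l' x) := by
  have h : l' = l ∘ σ.symm := by
    rw [hl, Function.comp_assoc, Equiv.self_comp_symm, Function.comp_id]
  rw [h, ← crossDown_crossDown l σ.symm.surjective, ← crossUp_perm, hr,
    crossUp_crossUp r' σ.surjective (crossDown_mem _ _)]

theorem crossUp_perm_crossDown {j n : ℕ} (σ : Equiv.Perm (Fin n)) {l l' : Fin n → Fin j}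
    (hl : l = l' ∘ σ) (x : (F.obj (FreeAb.pow j)).obj) :
    crossUp F σ (crossDown F l x) = crossDown F l' x := by
  rw [crossUp_crossDown_congr σ (r' := id) (Function.id_comp _).symm hl,
    crossUp_id (crossDown_mem _ _)]

theorem crossUp_eq_zero {m n : ℕ} {r : Fin m → Fin n} (hr : ¬ Function.Surjective r)
    (x : (F.obj (FreeAb.pow m)).obj) : crossUp F r x = 0 :=
  dev_univ_act_upHom_eq_zero F hr x

theorem crossDown_eq_zero {m n : ℕ} {l : Fin n → Fin m} (hl : ¬ Function.Surjective l)
    {x : (F.obj (FreeAb.pow m)).obj} (hx : x ∈ crossZ F m) : crossDown F l x = 0 :=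
  (congrArg (dev F Finset.univ)
    (act_downHom_eq_zero F hl ((mem_crossZ_iff F).1 hx))).trans (map_zero _)

theorem crossDown_crossUp {m n k : ℕ} {a : Fin m → Fin k} (ha : Function.Surjective a)
    (b : Fin n → Fin k) {x : (F.obj (FreeAb.pow m)).obj} (hx : x ∈ crossZ F m) :
    crossDown F b (crossUp F a x) =
      dev F Finset.univ (act F ((downHom b).comp (upHom a)) x) := by
  change dev F Finset.univ (act F (downHom b) (dev F Finset.univ (act F (upHom a) x))) = _
  rw [dev_univ_act_upHom F ha ((mem_crossZ_iff F).1 hx), act_act]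

theorem dev_univ_act_upHom_dev_image {j k n t : ℕ} {ι : Fin t → Fin n}
    (hι : Function.Injective ι) (r : Fin n → Fin k) (l : Fin n → Fin j)
    (x : (F.obj (FreeAb.pow j)).obj) :
    dev F Finset.univ (act F (upHom r) (dev F (Finset.univ.image ι) (act F (downHom l) x))) =
      crossUp F (r ∘ ι) (crossDown F (l ∘ ι) x) := by
  rw [dev_image F hι, act_act, act_act, upHom_comp, downHom_comp]
  rfl

end functor

namespace TorsionFreeCubicModule

variable (M : TorsionFreeCubicModule)

theorem eq_zero_of_mem_crossZ {m : ℕ} (hm : 3 < m) {x : (M.F.obj (FreeAb.pow m)).obj}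
    (hx : x ∈ crossZ M.F m) : x = 0 := by
  have h := M.crossEffect_eq_bot m hm fun _ => FreeAb.int
  exact (AddSubgroup.mem_bot (G := (M.F.obj (FreeAb.pow m)).obj)).1 (h ▸ hx)

theorem act_zero {m n : ℕ} : act M.F (0 : (Fin m → ℤ) →+ (Fin n → ℤ)) = 0 :=
  congrArg (fun f => f.hom.hom) (M.map_zero (FreeAb.pow m) (FreeAb.pow n))

theorem eq_zero_of_pow_zero (x : (M.F.obj (FreeAb.pow 0)).obj) : x = 0 := by
  have h : AddMonoidHom.id (Fin 0 → ℤ) = 0 := by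
    refine AddMonoidHom.ext fun x => funext fun i => i.elim0
  have h' := congrArg (fun f => act M.F f x) h
  simpa [act_id, act_zero] using h'

/-- The action of a span of finite sets on cross-effects is the sum over the parts of the span that
have at most three elements and map onto both sides. -/
theorem dev_univ_act_span {j k n : ℕ} (r : Fin n → Fin k) (l : Fin n → Fin j)
    {x : (M.F.obj (FreeAb.pow j)).obj} (hx : x ∈ crossZ M.F j) :
    dev M.F Finset.univ (act M.F ((upHom r).comp (downHom l)) x) =
      ∑ T : Finset (Fin n) with T.card ≤ 3 ∧ T.image r = Finset.univ ∧ T.image l = Finset.univ,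
        dev M.F Finset.univ (act M.F (upHom r) (dev M.F T (act M.F (downHom l) x))) := by
  rw [← act_act]
  conv_lhs => rw [← sum_dev M.F (act M.F (downHom l) x), map_sum, map_sum]
  symm
  refine Finset.sum_subset_zero_on_sdiff (Finset.filter_subset _ _) (fun T hT => ?_)
    fun T _ => rfl
  have hT' : T = Finset.univ.image (T.orderEmbOfFin rfl) := by
    apply Finset.coe_injective
    rw [Finset.coe_image, Finset.coe_univ, Set.image_univ, Finset.range_orderEmbOfFin]
  have himg {p : ℕ} (f : Fin n → Fin p) (hs : Function.Surjective (f ∘ T.orderEmbOfFin rfl)) :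
      T.image f = Finset.univ := by
    refine Finset.eq_univ_iff_forall.2 fun y => ?_
    obtain ⟨i, hi⟩ := hs y
    exact Finset.mem_image.2 ⟨_, T.orderEmbOfFin_mem rfl i, hi⟩
  conv_lhs => rw [hT']
  rw [dev_univ_act_upHom_dev_image (T.orderEmbOfFin rfl).injective]
  -- The summand of `T` passes through the cross-effect of order `T.card`, which is zero beyond 3;
  -- otherwise it vanishes as soon as one leg restricted to `T` is not surjective.
  by_cases h3 : 3 < T.card
  · rw [M.eq_zero_of_mem_crossZ h3 (crossDown_mem _ _), _root_.map_zero]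
  by_cases hr : Function.Surjective (r ∘ T.orderEmbOfFin rfl)
  · by_cases hl : Function.Surjective (l ∘ T.orderEmbOfFin rfl)
    · exact absurd (Finset.mem_filter.2 ⟨Finset.mem_univ _, not_lt.1 h3, himg r hr, himg l hl⟩)
        (Finset.mem_sdiff.1 hT).2
    · rw [crossDown_eq_zero hl hx, _root_.map_zero]
  · rw [crossUp_eq_zero hr]

/-! ### The relations between the structure maps of the diagram of a cubic module -/

section relations

/-- The composite is the span given by the fibre product of the two surjections over `Fin 2`. It has
four elements, and a subset onto both ends must contain all of them, which exceeds the degree. -/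
theorem crossDown_crossUp_eq_zero₁ {x : (M.F.obj (FreeAb.pow 3)).obj} (hx : x ∈ crossZ M.F 3) :
    crossDown M.F (![0, 0, 1] : Fin 3 → Fin 2) (crossUp M.F (![0, 1, 1] : Fin 3 → Fin 2) x) =
      0 := by
  have h : (downHom (![0, 0, 1] : Fin 3 → Fin 2)).comp (upHom (![0, 1, 1] : Fin 3 → Fin 2)) =
      (upHom (![0, 1, 2, 2] : Fin 4 → Fin 3)).comp (downHom (![0, 0, 1, 2] : Fin 4 → Fin 3)) := by
    refine AddMonoidHom.ext fun x => funext fun i => ?_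
    fin_cases i <;> simp [upHom_apply, downHom_apply, Finset.sum_filter, Fin.sum_univ_succ]
  rw [crossDown_crossUp (by decide) _ hx, h, dev_univ_act_span M _ _ hx]
  exact Finset.sum_eq_zero fun T hT => absurd hT (by revert T; decide)

theorem crossDown_crossUp_eq_zero₂ {x : (M.F.obj (FreeAb.pow 3)).obj} (hx : x ∈ crossZ M.F 3) :
    crossDown M.F (![0, 1, 1] : Fin 3 → Fin 2) (crossUp M.F (![0, 0, 1] : Fin 3 → Fin 2) x) =
      0 := by
  have h : (downHom (![0, 1, 1] : Fin 3 → Fin 2)).comp (upHom (![0, 0, 1] : Fin 3 → Fin 2)) =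
      (upHom (![0, 0, 1, 2] : Fin 4 → Fin 3)).comp (downHom (![0, 1, 2, 2] : Fin 4 → Fin 3)) := by
    refine AddMonoidHom.ext fun x => funext fun i => ?_
    fin_cases i <;> simp [upHom_apply, downHom_apply, Finset.sum_filter, Fin.sum_univ_succ]
  rw [crossDown_crossUp (by decide) _ hx, h, dev_univ_act_span M _ _ hx]
  exact Finset.sum_eq_zero fun T hT => absurd hT (by revert T; decide)

/-- The fibre product has five elements, and just two of its subsets with at most three elements map
onto both ends: the graphs of the identity and of the transposition of the first two indices. -/
theorem crossDown_crossUp₁ {x : (M.F.obj (FreeAb.pow 3)).obj} (hx : x ∈ crossZ M.F 3) :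
    crossDown M.F (![0, 0, 1] : Fin 3 → Fin 2) (crossUp M.F (![0, 0, 1] : Fin 3 → Fin 2) x) =
      x + crossUp M.F (![1, 0, 2] : Fin 3 → Fin 3) x := by
  have h : (downHom (![0, 0, 1] : Fin 3 → Fin 2)).comp (upHom (![0, 0, 1] : Fin 3 → Fin 2)) =
      (upHom (![0, 1, 0, 1, 2] : Fin 5 → Fin 3)).comp
        (downHom (![0, 0, 1, 1, 2] : Fin 5 → Fin 3)) := by
    refine AddMonoidHom.ext fun x => funext fun i => ?_
    fin_cases i <;> simp [upHom_apply, downHom_apply, Finset.sum_filter, Fin.sum_univ_succ]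
  have hf : ({T : Finset (Fin 5) | T.card ≤ 3 ∧
      T.image (![0, 1, 0, 1, 2] : Fin 5 → Fin 3) = Finset.univ ∧
      T.image (![0, 0, 1, 1, 2] : Fin 5 → Fin 3) = Finset.univ} : Finset (Finset (Fin 5))) =
      {Finset.univ.image (![0, 3, 4] : Fin 3 → Fin 5),
        Finset.univ.image (![1, 2, 4] : Fin 3 → Fin 5)} := by decide
  rw [crossDown_crossUp (by decide) _ hx, h, dev_univ_act_span M _ _ hx, hf,
    Finset.sum_pair (by decide), dev_univ_act_upHom_dev_image (by decide),
    dev_univ_act_upHom_dev_image (by decide),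
    show (![0, 0, 1, 1, 2] : Fin 5 → Fin 3) ∘ (![0, 3, 4] : Fin 3 → Fin 5) = id by decide,
    show (![0, 0, 1, 1, 2] : Fin 5 → Fin 3) ∘ (![1, 2, 4] : Fin 3 → Fin 5) = id by decide,
    show (![0, 1, 0, 1, 2] : Fin 5 → Fin 3) ∘ (![0, 3, 4] : Fin 3 → Fin 5) = id by decide,
    show (![0, 1, 0, 1, 2] : Fin 5 → Fin 3) ∘ (![1, 2, 4] : Fin 3 → Fin 5) = ![1, 0, 2] by decide,
    crossDown_id hx, crossUp_id hx]

theorem crossDown_crossUp₂ {x : (M.F.obj (FreeAb.pow 3)).obj} (hx : x ∈ crossZ M.F 3) :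
    crossDown M.F (![0, 1, 1] : Fin 3 → Fin 2) (crossUp M.F (![0, 1, 1] : Fin 3 → Fin 2) x) =
      x + crossUp M.F (![0, 2, 1] : Fin 3 → Fin 3) x := by
  have h : (downHom (![0, 1, 1] : Fin 3 → Fin 2)).comp (upHom (![0, 1, 1] : Fin 3 → Fin 2)) =
      (upHom (![0, 1, 2, 1, 2] : Fin 5 → Fin 3)).comp
        (downHom (![0, 1, 1, 2, 2] : Fin 5 → Fin 3)) := by
    refine AddMonoidHom.ext fun x => funext fun i => ?_
    fin_cases i <;> simp [upHom_apply, downHom_apply, Finset.sum_filter, Fin.sum_univ_succ]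
  have hf : ({T : Finset (Fin 5) | T.card ≤ 3 ∧
      T.image (![0, 1, 2, 1, 2] : Fin 5 → Fin 3) = Finset.univ ∧
      T.image (![0, 1, 1, 2, 2] : Fin 5 → Fin 3) = Finset.univ} : Finset (Finset (Fin 5))) =
      {Finset.univ.image (![0, 1, 4] : Fin 3 → Fin 5),
        Finset.univ.image (![0, 2, 3] : Fin 3 → Fin 5)} := by decide
  rw [crossDown_crossUp (by decide) _ hx, h, dev_univ_act_span M _ _ hx, hf,
    Finset.sum_pair (by decide), dev_univ_act_upHom_dev_image (by decide),
    dev_univ_act_upHom_dev_image (by decide),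
    show (![0, 1, 1, 2, 2] : Fin 5 → Fin 3) ∘ (![0, 1, 4] : Fin 3 → Fin 5) = id by decide,
    show (![0, 1, 1, 2, 2] : Fin 5 → Fin 3) ∘ (![0, 2, 3] : Fin 3 → Fin 5) = id by decide,
    show (![0, 1, 2, 1, 2] : Fin 5 → Fin 3) ∘ (![0, 1, 4] : Fin 3 → Fin 5) = id by decide,
    show (![0, 1, 2, 1, 2] : Fin 5 → Fin 3) ∘ (![0, 2, 3] : Fin 3 → Fin 5) = ![0, 2, 1] by decide,
    crossDown_id hx, crossUp_id hx]

/-- The fibre product over a point is `Fin 2 × Fin 2`. The admissible subsets are its two diagonals,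
which give the identity and the swap, and its four subsets with three elements. -/
theorem crossDown_crossUp₀ {x : (M.F.obj (FreeAb.pow 2)).obj} (hx : x ∈ crossZ M.F 2) :
    crossDown M.F (![0, 0] : Fin 2 → Fin 1) (crossUp M.F (![0, 0] : Fin 2 → Fin 1) x) =
      x + crossUp M.F (![1, 0] : Fin 2 → Fin 2) x +
        crossUp M.F (![0, 1, 0] : Fin 3 → Fin 2) (crossDown M.F (![0, 0, 1] : Fin 3 → Fin 2) x) +
        crossUp M.F (![0, 1, 1] : Fin 3 → Fin 2) (crossDown M.F (![0, 0, 1] : Fin 3 → Fin 2) x) +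
        crossUp M.F (![0, 0, 1] : Fin 3 → Fin 2) (crossDown M.F (![0, 1, 1] : Fin 3 → Fin 2) x) +
        crossUp M.F (![1, 0, 1] : Fin 3 → Fin 2)
          (crossDown M.F (![0, 1, 1] : Fin 3 → Fin 2) x) := by
  have h : (downHom (![0, 0] : Fin 2 → Fin 1)).comp (upHom (![0, 0] : Fin 2 → Fin 1)) =
      (upHom (![0, 1, 0, 1] : Fin 4 → Fin 2)).comp (downHom (![0, 0, 1, 1] : Fin 4 → Fin 2)) := by
    refine AddMonoidHom.ext fun x => funext fun i => ?_
    fin_cases i <;> simp [upHom_apply, downHom_apply, Finset.sum_filter, Fin.sum_univ_succ]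
  have hf : ({T : Finset (Fin 4) | T.card ≤ 3 ∧
      T.image (![0, 1, 0, 1] : Fin 4 → Fin 2) = Finset.univ ∧
      T.image (![0, 0, 1, 1] : Fin 4 → Fin 2) = Finset.univ} : Finset (Finset (Fin 4))) =
      {Finset.univ.image (![0, 3] : Fin 2 → Fin 4), Finset.univ.image (![1, 2] : Fin 2 → Fin 4),
        Finset.univ.image (![0, 1, 2] : Fin 3 → Fin 4),
        Finset.univ.image (![0, 1, 3] : Fin 3 → Fin 4),
        Finset.univ.image (![0, 2, 3] : Fin 3 → Fin 4),
        Finset.univ.image (![1, 2, 3] : Fin 3 → Fin 4)} := by decide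
  rw [crossDown_crossUp (by decide) _ hx, h, dev_univ_act_span M _ _ hx, hf,
    Finset.sum_insert (by decide), Finset.sum_insert (by decide), Finset.sum_insert (by decide),
    Finset.sum_insert (by decide), Finset.sum_pair (by decide)]
  simp only [dev_univ_act_upHom_dev_image
    (show Function.Injective (![0, 3] : Fin 2 → Fin 4) by decide), dev_univ_act_upHom_dev_image
    (show Function.Injective (![1, 2] : Fin 2 → Fin 4) by decide), dev_univ_act_upHom_dev_image
    (show Function.Injective (![0, 1, 2] : Fin 3 → Fin 4) by decide), dev_univ_act_upHom_dev_image
    (show Function.Injective (![0, 1, 3] : Fin 3 → Fin 4) by decide), dev_univ_act_upHom_dev_image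
    (show Function.Injective (![0, 2, 3] : Fin 3 → Fin 4) by decide), dev_univ_act_upHom_dev_image
    (show Function.Injective (![1, 2, 3] : Fin 3 → Fin 4) by decide)]
  rw [show (![0, 0, 1, 1] : Fin 4 → Fin 2) ∘ (![0, 3] : Fin 2 → Fin 4) = id by decide,
    show (![0, 0, 1, 1] : Fin 4 → Fin 2) ∘ (![1, 2] : Fin 2 → Fin 4) = id by decide,
    show (![0, 0, 1, 1] : Fin 4 → Fin 2) ∘ (![0, 1, 2] : Fin 3 → Fin 4) = ![0, 0, 1] by decide,
    show (![0, 0, 1, 1] : Fin 4 → Fin 2) ∘ (![0, 1, 3] : Fin 3 → Fin 4) = ![0, 0, 1] by decide,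
    show (![0, 0, 1, 1] : Fin 4 → Fin 2) ∘ (![0, 2, 3] : Fin 3 → Fin 4) = ![0, 1, 1] by decide,
    show (![0, 0, 1, 1] : Fin 4 → Fin 2) ∘ (![1, 2, 3] : Fin 3 → Fin 4) = ![0, 1, 1] by decide,
    show (![0, 1, 0, 1] : Fin 4 → Fin 2) ∘ (![0, 3] : Fin 2 → Fin 4) = id by decide,
    show (![0, 1, 0, 1] : Fin 4 → Fin 2) ∘ (![1, 2] : Fin 2 → Fin 4) = ![1, 0] by decide,
    show (![0, 1, 0, 1] : Fin 4 → Fin 2) ∘ (![0, 1, 2] : Fin 3 → Fin 4) = ![0, 1, 0] by decide,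
    show (![0, 1, 0, 1] : Fin 4 → Fin 2) ∘ (![0, 1, 3] : Fin 3 → Fin 4) = ![0, 1, 1] by decide,
    show (![0, 1, 0, 1] : Fin 4 → Fin 2) ∘ (![0, 2, 3] : Fin 3 → Fin 4) = ![0, 0, 1] by decide,
    show (![0, 1, 0, 1] : Fin 4 → Fin 2) ∘ (![1, 2, 3] : Fin 3 → Fin 4) = ![1, 0, 1] by decide,
    crossDown_id hx, crossUp_id hx]
  abel

end relations

end TorsionFreeCubicModule

end

noncomputable section

namespace CubicDiagram

theorem isAModule_mk {V₁ V₂ V₃ : Type} [AddCommGroup V₁] [AddCommGroup V₂] [AddCommGroup V₃]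
    {h : V₁ →+ V₂} {p : V₂ →+ V₁} {h₁ h₂ : V₂ →+ V₃} {p₁ p₂ : V₃ →+ V₂}
    (r₁ : ∀ x, h₁ (p₂ x) = 0) (r₂ : ∀ x, h₂ (p₁ x) = 0)
    (r₃ : ∀ x, h₁ (h x) = h₂ (h x)) (r₄ : ∀ x, p (p₁ x) = p (p₂ x))
    (r₅ : ∀ x, h₁ (p₁ (h₁ x)) = h₁ x + h₁ x)
    (r₆ : ∀ x, h₂ (p₂ (h₂ x)) = h₂ x + h₂ x)
    (r₇ : ∀ x, p₁ (h₁ (p₁ x)) = p₁ x + p₁ x)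
    (r₈ : ∀ x, p₂ (h₂ (p₂ x)) = p₂ x + p₂ x)
    (r₉ : ∀ x, h (p (h x)) = (h x + (p₁ (h₁ (h x)) + p₂ (h₁ (h x)))) +
      (h x + (p₁ (h₁ (h x)) + p₂ (h₁ (h x)))))
    (r₁₀ : ∀ x, p (h (p x)) = (p x + p (p₁ (h₁ x + h₂ x))) + (p x + p (p₁ (h₁ x + h₂ x))))
    (r₁₁ : ∀ x, h₁ (h (p x)) + h₁ x + h₂ x =
      h₁ (p₁ (h₂ (p₂ (h₁ x)))) + h₂ (p₂ (h₁ (p₁ (h₂ x)))))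
    (r₁₂ : ∀ x, h (p (p₁ x)) + p₁ x + p₂ x =
      p₁ (h₂ (p₂ (h₁ (p₁ x)))) + p₂ (h₁ (p₁ (h₂ (p₂ x))))) :
    (CubicDiagram.mk (ModuleCat.of ℤ V₁) (ModuleCat.of ℤ V₂) (ModuleCat.of ℤ V₃)
      h.toIntLinearMap p.toIntLinearMap h₁.toIntLinearMap h₂.toIntLinearMap p₁.toIntLinearMap
      p₂.toIntLinearMap).IsAModule := by
  constructor <;> refine LinearMap.ext fun x => ?_
  · exact r₁ x
  · exact r₂ x
  · exact r₃ x
  · exact r₄ x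
  · exact (r₅ x).trans (two_smul ℤ _).symm
  · exact (r₆ x).trans (two_smul ℤ _).symm
  · exact (r₇ x).trans (two_smul ℤ _).symm
  · exact (r₈ x).trans (two_smul ℤ _).symm
  · exact (r₉ x).trans (two_smul ℤ _).symm
  · exact (r₁₀ x).trans (two_smul ℤ _).symm
  · exact r₁₁ x
  · exact r₁₂ x

end CubicDiagram

namespace TorsionFreeCubicModule

variable (M : TorsionFreeCubicModule)

theorem predAbove_zero_one : (0 : Fin 1).predAbove = ![0, 0] := by decide

theorem predAbove_zero_two : (0 : Fin 2).predAbove = ![0, 0, 1] := by decide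

theorem predAbove_one_two : (1 : Fin 2).predAbove = ![0, 1, 1] := by decide

section

variable {M}

theorem crossUp_crossUp_of_eq {m n k : ℕ} {a : Fin m → Fin n} {c : Fin n → Fin k}
    {d : Fin m → Fin k} {x : (M.F.obj (FreeAb.pow m)).obj} (hx : x ∈ crossZ M.F m)
    (ha : Function.Surjective a) (hd : c ∘ a = d) :
    crossUp M.F c (crossUp M.F a x) = crossUp M.F d x := by
  rw [crossUp_crossUp c ha hx, hd]

theorem crossDown_crossDown_of_eq {m n k : ℕ} {b : Fin k → Fin n} {l : Fin n → Fin m}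
    {d : Fin k → Fin m} (x : (M.F.obj (FreeAb.pow m)).obj)
    (hb : Function.Surjective b) (hd : l ∘ b = d) :
    crossDown M.F b (crossDown M.F l x) = crossDown M.F d x := by
  rw [crossDown_crossDown l hb x, hd]

/-- The transposition of the first two indices. -/
def swap₁ : Equiv.Perm (Fin 3) := ⟨![1, 0, 2], ![1, 0, 2], by decide, by decide⟩

/-- The transposition of the last two indices. -/
def swap₂ : Equiv.Perm (Fin 3) := ⟨![0, 2, 1], ![0, 2, 1], by decide, by decide⟩

/-- A cyclic permutation of three indices. -/
def cycle₁ : Equiv.Perm (Fin 3) := ⟨![1, 2, 0], ![2, 0, 1], by decide, by decide⟩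

/-- The inverse cyclic permutation of three indices. -/
def cycle₂ : Equiv.Perm (Fin 3) := ⟨![2, 0, 1], ![1, 2, 0], by decide, by decide⟩

/-- The transposition of two indices. -/
def swap : Equiv.Perm (Fin 2) := ⟨![1, 0], ![1, 0], by decide, by decide⟩

end


section coe

variable (F : FreeAb ⥤ FreeAb)

/-- The map `h` of the diagram of a functor. -/
def structH₀ : crossZ F 1 →+ crossZ F 2 := crossH F (0 : Fin 1)

/-- The map `p` of the diagram of a functor. -/
def structP₀ : crossZ F 2 →+ crossZ F 1 := crossP F (0 : Fin 1)

/-- The map `h₁` of the diagram of a functor. -/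
def structH₁ : crossZ F 2 →+ crossZ F 3 := crossH F (0 : Fin 2)

/-- The map `h₂` of the diagram of a functor. -/
def structH₂ : crossZ F 2 →+ crossZ F 3 := crossH F (1 : Fin 2)

/-- The map `p₁` of the diagram of a functor. -/
def structP₁ : crossZ F 3 →+ crossZ F 2 := crossP F (0 : Fin 2)

/-- The map `p₂` of the diagram of a functor. -/
def structP₂ : crossZ F 3 →+ crossZ F 2 := crossP F (1 : Fin 2)

theorem coe_structH₀ (x : crossZ F 1) :
    (structH₀ F x : (F.obj (FreeAb.pow 2)).obj) = crossDown F (![0, 0] : Fin 2 → Fin 1) x := by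
  rw [← predAbove_zero_one]
  rfl

theorem coe_structP₀ (x : crossZ F 2) :
    (structP₀ F x : (F.obj (FreeAb.pow 1)).obj) = crossUp F (![0, 0] : Fin 2 → Fin 1) x := by
  rw [← predAbove_zero_one]
  rfl

theorem coe_structH₁ (x : crossZ F 2) :
    (structH₁ F x : (F.obj (FreeAb.pow 3)).obj) = crossDown F (![0, 0, 1] : Fin 3 → Fin 2) x := by
  rw [← predAbove_zero_two]
  rfl

theorem coe_structH₂ (x : crossZ F 2) :
    (structH₂ F x : (F.obj (FreeAb.pow 3)).obj) = crossDown F (![0, 1, 1] : Fin 3 → Fin 2) x := by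
  rw [← predAbove_one_two]
  rfl

theorem coe_structP₁ (x : crossZ F 3) :
    (structP₁ F x : (F.obj (FreeAb.pow 2)).obj) = crossUp F (![0, 0, 1] : Fin 3 → Fin 2) x := by
  rw [← predAbove_zero_two]
  rfl

theorem coe_structP₂ (x : crossZ F 3) :
    (structP₂ F x : (F.obj (FreeAb.pow 2)).obj) = crossUp F (![0, 1, 1] : Fin 3 → Fin 2) x := by
  rw [← predAbove_one_two]
  rfl

end coe

section apply

variable {x : (M.F.obj (FreeAb.pow 2)).obj} {y : (M.F.obj (FreeAb.pow 3)).obj}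

theorem crossDown_swap : crossDown M.F ![1, 0] x = crossUp M.F ![1, 0] x :=
  (crossUp_perm swap x).symm

theorem crossUp_three_crossDown {j : ℕ} (l : Fin 3 → Fin j) (z : (M.F.obj (FreeAb.pow j)).obj) :
    crossUp M.F ![1, 0, 2] (crossDown M.F l z) = crossDown M.F ![l 1, l 0, l 2] z ∧
    crossUp M.F ![0, 2, 1] (crossDown M.F l z) = crossDown M.F ![l 0, l 2, l 1] z ∧
    crossUp M.F ![1, 2, 0] (crossDown M.F l z) = crossDown M.F ![l 2, l 0, l 1] z ∧
    crossUp M.F ![2, 0, 1] (crossDown M.F l z) = crossDown M.F ![l 1, l 2, l 0] z := by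
  refine ⟨crossUp_perm_crossDown swap₁ ?_ z, crossUp_perm_crossDown swap₂ ?_ z,
    crossUp_perm_crossDown cycle₁ ?_ z, crossUp_perm_crossDown cycle₂ ?_ z⟩ <;>
  · funext i
    fin_cases i <;> rfl

end apply

theorem structH_structP_eq_zero₁ (x : crossZ M.F 3) : structH₁ M.F (structP₂ M.F x) = 0 := by
  refine Subtype.ext ?_
  rw [coe_structH₁, coe_structP₂]
  exact M.crossDown_crossUp_eq_zero₁ x.2

theorem structH_structP_eq_zero₂ (x : crossZ M.F 3) : structH₂ M.F (structP₁ M.F x) = 0 := by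
  refine Subtype.ext ?_
  rw [coe_structH₂, coe_structP₁]
  exact M.crossDown_crossUp_eq_zero₂ x.2

theorem structH_structH (x : crossZ M.F 1) : structH₁ M.F (structH₀ M.F x) =
    structH₂ M.F (structH₀ M.F x) := by
  refine Subtype.ext ?_
  rw [coe_structH₁, coe_structH₂, coe_structH₀,
    crossDown_crossDown_of_eq (d := ![0, 0, 0]) _ (by decide) (by decide),
    crossDown_crossDown_of_eq (d := ![0, 0, 0]) _ (by decide) (by decide)]

theorem structP_structP (x : crossZ M.F 3) : structP₀ M.F (structP₁ M.F x) =
    structP₀ M.F (structP₂ M.F x) := by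
  refine Subtype.ext ?_
  rw [coe_structP₀, coe_structP₀, coe_structP₁, coe_structP₂,
    crossUp_crossUp_of_eq (d := ![0, 0, 0]) x.2 (by decide) (by decide),
    crossUp_crossUp_of_eq (d := ![0, 0, 0]) x.2 (by decide) (by decide)]

theorem structH_structP_structH₁ (x : crossZ M.F 2) : structH₁ M.F (structP₁ M.F
    (structH₁ M.F x)) = structH₁ M.F x + structH₁ M.F x := by
  have s₁ {j : ℕ} (l : Fin 3 → Fin j) (z) := (M.crossUp_three_crossDown l z).1
  refine Subtype.ext ?_
  rw [AddSubgroup.coe_add, coe_structH₁, coe_structP₁, coe_structH₁,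
    M.crossDown_crossUp₁ (crossDown_mem _ _), s₁]
  rfl

theorem structH_structP_structH₂ (x : crossZ M.F 2) : structH₂ M.F (structP₂ M.F
    (structH₂ M.F x)) = structH₂ M.F x + structH₂ M.F x := by
  have s₂ {j : ℕ} (l : Fin 3 → Fin j) (z) := (M.crossUp_three_crossDown l z).2.1
  refine Subtype.ext ?_
  rw [AddSubgroup.coe_add, coe_structH₂, coe_structP₂, coe_structH₂,
    M.crossDown_crossUp₂ (crossDown_mem _ _), s₂]
  rfl

theorem structP_structH_structP₁ (x : crossZ M.F 3) : structP₁ M.F (structH₁ M.F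
    (structP₁ M.F x)) = structP₁ M.F x + structP₁ M.F x := by
  refine Subtype.ext ?_
  rw [AddSubgroup.coe_add, coe_structP₁, coe_structH₁, coe_structP₁,
    M.crossDown_crossUp₁ x.2, _root_.map_add,
    crossUp_crossUp_of_eq (d := ![0, 0, 1]) x.2 (by decide) (by decide)]

theorem structP_structH_structP₂ (x : crossZ M.F 3) : structP₂ M.F (structH₂ M.F
    (structP₂ M.F x)) = structP₂ M.F x + structP₂ M.F x := by
  refine Subtype.ext ?_
  rw [AddSubgroup.coe_add, coe_structP₂, coe_structH₂, coe_structP₂,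
    M.crossDown_crossUp₂ x.2, _root_.map_add,
    crossUp_crossUp_of_eq (d := ![0, 1, 1]) x.2 (by decide) (by decide)]

/-- On the image of `h` the swap acts trivially and every further copy map to `F_3` becomes the one
to a single point, so the six terms of `crossDown_crossUp₀` coincide in pairs. This is the factor 2.
-/
theorem structH_structP_structH₀ (x : crossZ M.F 1) : structH₀ M.F (structP₀ M.F
    (structH₀ M.F x)) =
    (structH₀ M.F x + (structP₁ M.F (structH₁ M.F
      (structH₀ M.F x)) + structP₂ M.F (structH₁ M.F
      (structH₀ M.F x)))) +
    (structH₀ M.F x + (structP₁ M.F (structH₁ M.F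
      (structH₀ M.F x)) + structP₂ M.F (structH₁ M.F
      (structH₀ M.F x)))) := by
  have s₁ {j : ℕ} (l : Fin 3 → Fin j) (z) := (M.crossUp_three_crossDown l z).1
  have s₂ {j : ℕ} (l : Fin 3 → Fin j) (z) := (M.crossUp_three_crossDown l z).2.1
  have m {k j : ℕ} (l : Fin k → Fin j) (z) : crossDown M.F l z ∈ crossZ M.F k := crossDown_mem l z
  have u (x) (hx : x ∈ crossZ M.F 2) := M.crossDown_crossUp₀ hx
  have v₁ (r : Fin 3 → Fin 2) (y : (M.F.obj (FreeAb.pow 3)).obj) (hy : y ∈ crossZ M.F 3) :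
      crossUp M.F r (crossUp M.F ![1, 0, 2] y) = crossUp M.F ![r 1, r 0, r 2] y :=
    crossUp_crossUp_of_eq hy (by decide) (by funext i; fin_cases i <;> rfl)
  have v₂ (r : Fin 3 → Fin 2) (y : (M.F.obj (FreeAb.pow 3)).obj) (hy : y ∈ crossZ M.F 3) :
      crossUp M.F r (crossUp M.F ![0, 2, 1] y) = crossUp M.F ![r 0, r 2, r 1] y :=
    crossUp_crossUp_of_eq hy (by decide) (by funext i; fin_cases i <;> rfl)
  have w₁ (y : (M.F.obj (FreeAb.pow 3)).obj) (hy : y ∈ crossZ M.F 3) :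
      crossUp M.F (![0, 1, 0] : Fin 3 → Fin 2) y =
        crossUp M.F (![0, 0, 1] : Fin 3 → Fin 2) (crossUp M.F ![0, 2, 1] y) :=
    (v₂ ![0, 0, 1] y hy).symm
  have w₂ (y : (M.F.obj (FreeAb.pow 3)).obj) (hy : y ∈ crossZ M.F 3) :
      crossUp M.F (![1, 0, 1] : Fin 3 → Fin 2) y =
        crossUp M.F (![0, 1, 1] : Fin 3 → Fin 2) (crossUp M.F ![1, 0, 2] y) :=
    (v₁ ![0, 1, 1] y hy).symm
  have w₄ (l : Fin 3 → Fin 2) (hl : Function.Surjective l) (x : (M.F.obj (FreeAb.pow 1)).obj) :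
      crossDown M.F l (crossDown M.F (![0, 0] : Fin 2 → Fin 1) x) =
        crossDown M.F ![0, 0, 0] x := crossDown_crossDown_of_eq x hl (Subsingleton.elim _ _)
  refine Subtype.ext ?_
  have t : crossUp M.F ![1, 0] (crossDown M.F (![0, 0] : Fin 2 → Fin 1) x) =
      crossDown M.F (![0, 0] : Fin 2 → Fin 1) (x : (M.F.obj (FreeAb.pow 1)).obj) :=
    crossUp_perm_crossDown swap (Subsingleton.elim _ _) _
  simp only [AddSubgroup.coe_add, coe_structH₀, coe_structP₀, coe_structH₁, coe_structP₁,
    coe_structP₂, u _ (m _ _), w₁ _ (m _ _), w₂ _ (m _ _), t, s₁, s₂,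
    w₄ ![0, 0, 1] (by decide), w₄ ![0, 1, 1] (by decide), Matrix.cons_val]
  abel

theorem structP_structH_structP₀ (x : crossZ M.F 2) : structP₀ M.F (structH₀ M.F
    (structP₀ M.F x)) =
    (structP₀ M.F x + (structP₀ M.F (structP₁ M.F
      (structH₁ M.F x)) + structP₀ M.F (structP₁ M.F
      (structH₂ M.F x)))) +
    (structP₀ M.F x + (structP₀ M.F (structP₁ M.F
      (structH₁ M.F x)) + structP₀ M.F (structP₁ M.F
      (structH₂ M.F x)))) := by
  have m {k j : ℕ} (l : Fin k → Fin j) (z) : crossDown M.F l z ∈ crossZ M.F k := crossDown_mem l z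
  have u (x) (hx : x ∈ crossZ M.F 2) := M.crossDown_crossUp₀ hx
  have w₃ (r : Fin 3 → Fin 2) (hr : Function.Surjective r) (y : (M.F.obj (FreeAb.pow 3)).obj)
      (hy : y ∈ crossZ M.F 3) : crossUp M.F (![0, 0] : Fin 2 → Fin 1) (crossUp M.F r y) =
        crossUp M.F ![0, 0, 0] y := crossUp_crossUp_of_eq hy hr (Subsingleton.elim _ _)
  refine Subtype.ext ?_
  have t : crossUp M.F (![0, 0] : Fin 2 → Fin 1) (crossUp M.F ![1, 0] x) =
      crossUp M.F (![0, 0] : Fin 2 → Fin 1) (x : (M.F.obj (FreeAb.pow 2)).obj) :=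
    crossUp_crossUp_of_eq x.2 (by decide) (Subsingleton.elim _ _)
  simp only [AddSubgroup.coe_add, coe_structH₀, coe_structP₀, coe_structH₁, coe_structP₁,
    coe_structH₂, u _ x.2, t, _root_.map_add, w₃ ![0, 0, 1] (by decide) _ (m _ _),
    w₃ ![0, 1, 1] (by decide) _ (m _ _), w₃ ![0, 1, 0] (by decide) _ (m _ _),
    w₃ ![1, 0, 1] (by decide) _ (m _ _)]
  abel

/-- Both sides are expanded into `crossDown` along surjections of three points onto two. The map `h₁
h p` contributes each of the six once, and the two extra terms match the repetitions on the right.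
-/
theorem structH_structH_structP (x : crossZ M.F 2) : structH₁ M.F (structH₀ M.F
    (structP₀ M.F x)) + structH₁ M.F x + structH₂ M.F x =
    structH₁ M.F (structP₁ M.F (structH₂ M.F
      (structP₂ M.F (structH₁ M.F x)))) +
    structH₂ M.F (structP₂ M.F (structH₁ M.F
      (structP₁ M.F (structH₂ M.F x)))) := by
  have s₁ {j : ℕ} (l : Fin 3 → Fin j) (z) := (M.crossUp_three_crossDown l z).1
  have s₂ {j : ℕ} (l : Fin 3 → Fin j) (z) := (M.crossUp_three_crossDown l z).2.1
  have m {k j : ℕ} (l : Fin k → Fin j) (z) : crossDown M.F l z ∈ crossZ M.F k := crossDown_mem l z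
  have u (x) (hx : x ∈ crossZ M.F 2) := M.crossDown_crossUp₀ hx
  have v₁ (r : Fin 3 → Fin 2) (y : (M.F.obj (FreeAb.pow 3)).obj) (hy : y ∈ crossZ M.F 3) :
      crossUp M.F r (crossUp M.F ![1, 0, 2] y) = crossUp M.F ![r 1, r 0, r 2] y :=
    crossUp_crossUp_of_eq hy (by decide) (by funext i; fin_cases i <;> rfl)
  have v₂ (r : Fin 3 → Fin 2) (y : (M.F.obj (FreeAb.pow 3)).obj) (hy : y ∈ crossZ M.F 3) :
      crossUp M.F r (crossUp M.F ![0, 2, 1] y) = crossUp M.F ![r 0, r 2, r 1] y :=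
    crossUp_crossUp_of_eq hy (by decide) (by funext i; fin_cases i <;> rfl)
  have w₁ (y : (M.F.obj (FreeAb.pow 3)).obj) (hy : y ∈ crossZ M.F 3) :
      crossUp M.F (![0, 1, 0] : Fin 3 → Fin 2) y =
        crossUp M.F (![0, 0, 1] : Fin 3 → Fin 2) (crossUp M.F ![0, 2, 1] y) :=
    (v₂ ![0, 0, 1] y hy).symm
  have w₂ (y : (M.F.obj (FreeAb.pow 3)).obj) (hy : y ∈ crossZ M.F 3) :
      crossUp M.F (![1, 0, 1] : Fin 3 → Fin 2) y =
        crossUp M.F (![0, 1, 1] : Fin 3 → Fin 2) (crossUp M.F ![1, 0, 2] y) :=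
    (v₁ ![0, 1, 1] y hy).symm
  have e₁ (y) (hy : y ∈ crossZ M.F 3) := M.crossDown_crossUp₁ hy
  have e₂ (y) (hy : y ∈ crossZ M.F 3) := M.crossDown_crossUp₂ hy
  have z₁ (y) (hy : y ∈ crossZ M.F 3) := M.crossDown_crossUp_eq_zero₁ hy
  refine Subtype.ext ?_
  have t : crossDown M.F (![0, 0, 1] : Fin 3 → Fin 2) (crossUp M.F ![1, 0] x) =
      crossDown M.F ![1, 1, 0] (x : (M.F.obj (FreeAb.pow 2)).obj) := by
    rw [← crossDown_swap]
    exact crossDown_crossDown_of_eq _ (by decide) (by decide)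
  simp only [AddSubgroup.coe_add, coe_structH₀, coe_structP₀, coe_structH₁, coe_structP₁,
    coe_structH₂, coe_structP₂, u _ x.2, t, _root_.map_add, w₁ _ (m _ _), w₂ _ (m _ _), s₁, s₂,
    e₁ _ (m _ _), e₂ _ (m _ _), z₁ _ (m _ _), Matrix.cons_val]
  abel

/-- The dual expansion, into `crossUp` along the surjections of three points onto two. -/
theorem structH_structP_structP (x : crossZ M.F 3) : structH₀ M.F (structP₀ M.F
    (structP₁ M.F x)) + structP₁ M.F x + structP₂ M.F x =
    structP₁ M.F (structH₂ M.F (structP₂ M.F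
      (structH₁ M.F (structP₁ M.F x)))) +
    structP₂ M.F (structH₁ M.F (structP₁ M.F
      (structH₂ M.F (structP₂ M.F x)))) := by
  have u (x) (hx : x ∈ crossZ M.F 2) := M.crossDown_crossUp₀ hx
  have v₁ (r : Fin 3 → Fin 2) (y : (M.F.obj (FreeAb.pow 3)).obj) (hy : y ∈ crossZ M.F 3) :
      crossUp M.F r (crossUp M.F ![1, 0, 2] y) = crossUp M.F ![r 1, r 0, r 2] y :=
    crossUp_crossUp_of_eq hy (by decide) (by funext i; fin_cases i <;> rfl)
  have v₂ (r : Fin 3 → Fin 2) (y : (M.F.obj (FreeAb.pow 3)).obj) (hy : y ∈ crossZ M.F 3) :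
      crossUp M.F r (crossUp M.F ![0, 2, 1] y) = crossUp M.F ![r 0, r 2, r 1] y :=
    crossUp_crossUp_of_eq hy (by decide) (by funext i; fin_cases i <;> rfl)
  have e₁ (y) (hy : y ∈ crossZ M.F 3) := M.crossDown_crossUp₁ hy
  have e₂ (y) (hy : y ∈ crossZ M.F 3) := M.crossDown_crossUp₂ hy
  have z₂ (y) (hy : y ∈ crossZ M.F 3) := M.crossDown_crossUp_eq_zero₂ hy
  refine Subtype.ext ?_
  have t : crossUp M.F (![1, 0] : Fin 2 → Fin 2) (crossUp M.F (![0, 0, 1] : Fin 3 → Fin 2) x) =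
      crossUp M.F (![1, 1, 0] : Fin 3 → Fin 2) (x : (M.F.obj (FreeAb.pow 3)).obj) :=
    crossUp_crossUp_of_eq (a := ![0, 0, 1]) (c := ![1, 0]) (d := ![1, 1, 0]) x.2
      (by decide) (by decide)
  have m' (r : Fin 3 → Fin 3) : crossUp M.F r x ∈ crossZ M.F 3 := crossUp_mem _ _
  simp only [AddSubgroup.coe_add, coe_structH₀, coe_structP₀, coe_structH₁, coe_structP₁,
    coe_structH₂, coe_structP₂]
  simp only [u _ (crossUp_mem _ _), t, e₁ _ x.2, e₂ _ x.2, z₂ _ x.2]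
  rw [e₂ _ (add_mem x.2 (m' _)), e₁ _ (add_mem x.2 (m' _))]
  simp only [_root_.map_add, v₁ _ _ x.2, v₂ _ _ x.2, v₁ _ _ (m' _), v₂ _ _ (m' _),
    _root_.map_zero, Matrix.cons_val]
  abel

set_option maxHeartbeats 2000000 in
theorem diagram_isAModule : M.diagram.IsAModule := by
  have r (x : crossZ M.F 2) : structP₀ M.F (structH₀ M.F (structP₀ M.F x)) =
      (structP₀ M.F x + structP₀ M.F (structP₁ M.F (structH₁ M.F x + structH₂ M.F x))) +
      (structP₀ M.F x + structP₀ M.F (structP₁ M.F (structH₁ M.F x + structH₂ M.F x))) := by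
    rw [M.structP_structH_structP₀, _root_.map_add, _root_.map_add]
  have key := CubicDiagram.isAModule_mk M.structH_structP_eq_zero₁ M.structH_structP_eq_zero₂
    M.structH_structH M.structP_structP M.structH_structP_structH₁ M.structH_structP_structH₂
    M.structP_structH_structP₁ M.structP_structH_structP₂ M.structH_structP_structH₀ r
    M.structH_structH_structP M.structH_structP_structP
  exact key

end TorsionFreeCubicModule

end

/-! ### Cubic functors are determined by their diagrams. -/

noncomputable section

/-! ### Homomorphisms between the groups `ℤ ^ n` as differences of spans -/

/-- A homomorphism that is given by a span of finite sets. -/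
def IsSpan {j k : ℕ} (φ : (Fin j → ℤ) →+ (Fin k → ℤ)) : Prop :=
  ∃ (n : ℕ) (r : Fin n → Fin k) (l : Fin n → Fin j), φ = (upHom r).comp (downHom l)

theorem isSpan_zero {j k : ℕ} : IsSpan (0 : (Fin j → ℤ) →+ (Fin k → ℤ)) :=
  ⟨0, Fin.elim0, Fin.elim0, AddMonoidHom.ext fun x => funext fun i => by simp [upHom_apply]⟩

theorem IsSpan.add {j k : ℕ} {φ ψ : (Fin j → ℤ) →+ (Fin k → ℤ)} (hφ : IsSpan φ) (hψ : IsSpan ψ) :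
    IsSpan (φ + ψ) := by
  obtain ⟨n, r, l, rfl⟩ := hφ
  obtain ⟨n', r', l', rfl⟩ := hψ
  refine ⟨n + n', Fin.append r r', Fin.append l l',
    AddMonoidHom.ext fun x => funext fun i => ?_⟩
  simp [upHom_apply, downHom_apply, Finset.sum_filter, Fin.sum_univ_add]

theorem IsSpan.nsmul {j k : ℕ} {φ : (Fin j → ℤ) →+ (Fin k → ℤ)} (hφ : IsSpan φ) (n : ℕ) :
    IsSpan (n • φ) := by
  induction n with
  | zero => simpa using isSpan_zero
  | succ n ih => rw [succ_nsmul]; exact ih.add hφ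

theorem IsSpan.sum {j k : ℕ} {ι : Type*} {s : Finset ι} {φ : ι → (Fin j → ℤ) →+ (Fin k → ℤ)}
    (hφ : ∀ i ∈ s, IsSpan (φ i)) : IsSpan (∑ i ∈ s, φ i) :=
  Finset.sum_induction φ IsSpan (fun _ _ => IsSpan.add) isSpan_zero hφ

/-- The elementary homomorphism that maps the basis vector `a` to the basis vector `b`. -/
theorem isSpan_single_comp_eval {j k : ℕ} (a : Fin j) (b : Fin k) :
    IsSpan ((AddMonoidHom.single (fun _ : Fin k => ℤ) b).comp
      (Pi.evalAddMonoidHom (fun _ : Fin j => ℤ) a)) := by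
  refine ⟨1, fun _ => b, fun _ => a, AddMonoidHom.ext fun x => funext fun i => ?_⟩
  by_cases h : b = i
  · subst h
    simp [upHom_apply, downHom_apply]
  · simp [upHom_apply, downHom_apply, h]

/-- A span has a matrix with nonnegative entries, and conversely such a matrix is a sum of
elementary spans; a general matrix is split into its positive and negative parts. -/
theorem exists_isSpan_sub {j k : ℕ} (φ : (Fin j → ℤ) →+ (Fin k → ℤ)) :
    ∃ φ₁ φ₂, IsSpan φ₁ ∧ IsSpan φ₂ ∧ φ = φ₁ - φ₂ := by
  let e (a : Fin j) (b : Fin k) : (Fin j → ℤ) →+ (Fin k → ℤ) :=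
    (AddMonoidHom.single (fun _ : Fin k => ℤ) b).comp (Pi.evalAddMonoidHom (fun _ : Fin j => ℤ) a)
  have h : φ = ∑ a, ∑ b, φ (Pi.single a 1) b • e a b := by
    ext a b
    simp only [AddMonoidHom.comp_apply, AddMonoidHom.finsetSum_apply, Finset.sum_apply,
      AddMonoidHom.smul_apply, Pi.smul_apply, AddMonoidHom.single_apply, e,
      Pi.evalAddMonoidHom_apply]
    rw [Finset.sum_eq_single a, Finset.sum_eq_single b]
    · simp
    · intro c _ hc
      simp [Pi.single_eq_of_ne (Ne.symm hc)]
    · simp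
    · intro c _ hc
      simp [Pi.single_eq_of_ne hc]
    · simp
  refine ⟨∑ a, ∑ b, (φ (Pi.single a 1) b).toNat • e a b,
    ∑ a, ∑ b, (-φ (Pi.single a 1) b).toNat • e a b,
    IsSpan.sum fun a _ => IsSpan.sum fun b _ => (isSpan_single_comp_eval a b).nsmul _,
    IsSpan.sum fun a _ => IsSpan.sum fun b _ => (isSpan_single_comp_eval a b).nsmul _, ?_⟩
  conv_lhs => rw [h]
  rw [← Finset.sum_sub_distrib]
  refine Finset.sum_congr rfl fun a _ => ?_
  rw [← Finset.sum_sub_distrib]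
  refine Finset.sum_congr rfl fun b _ => ?_
  rw [← natCast_zsmul, ← natCast_zsmul, ← sub_smul]
  congr 1
  omega

/-! ### Families of subgroups of the cross-effects -/

/-- A family of subgroups of the cross-effects that is stable under the structure maps. -/
structure IsStableFamily (F : FreeAb ⥤ FreeAb)
    (R : ∀ k, AddSubgroup (F.obj (FreeAb.pow k)).obj) : Prop where
  le : ∀ k, R k ≤ crossZ F k
  down₀ : ∀ x ∈ R 1, crossDown F (![0, 0] : Fin 2 → Fin 1) x ∈ R 2
  up₀ : ∀ x ∈ R 2, crossUp F (![0, 0] : Fin 2 → Fin 1) x ∈ R 1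
  down₁ : ∀ x ∈ R 2, crossDown F (![0, 0, 1] : Fin 3 → Fin 2) x ∈ R 3
  down₂ : ∀ x ∈ R 2, crossDown F (![0, 1, 1] : Fin 3 → Fin 2) x ∈ R 3
  up₁ : ∀ x ∈ R 3, crossUp F (![0, 0, 1] : Fin 3 → Fin 2) x ∈ R 2
  up₂ : ∀ x ∈ R 3, crossUp F (![0, 1, 1] : Fin 3 → Fin 2) x ∈ R 2

namespace IsStableFamily

open TorsionFreeCubicModule

variable {M : TorsionFreeCubicModule} {R : ∀ k, AddSubgroup (M.F.obj (FreeAb.pow k)).obj}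
  (hR : IsStableFamily M.F R)

/-- Stability under permutations need not be assumed: this transposition is `h₁ p₁ - 1`. -/
theorem swap₁_mem (hR : IsStableFamily M.F R) {x} (hx : x ∈ R 3) :
    crossUp M.F (![1, 0, 2] : Fin 3 → Fin 3) x ∈ R 3 := by
  have h := M.crossDown_crossUp₁ (hR.le 3 hx)
  rw [← sub_eq_iff_eq_add'] at h
  rw [← h]
  exact sub_mem (hR.down₁ _ (hR.up₁ _ hx)) hx

theorem swap₂_mem (hR : IsStableFamily M.F R) {x} (hx : x ∈ R 3) :
    crossUp M.F (![0, 2, 1] : Fin 3 → Fin 3) x ∈ R 3 := by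
  have h := M.crossDown_crossUp₂ (hR.le 3 hx)
  rw [← sub_eq_iff_eq_add'] at h
  rw [← h]
  exact sub_mem (hR.down₂ _ (hR.up₂ _ hx)) hx

theorem crossUp_three_mem (hR : IsStableFamily M.F R) {r : Fin 3 → Fin 3}
    (hr : Function.Surjective r) {x} (hx : x ∈ R 3) : crossUp M.F r x ∈ R 3 := by
  have a : Function.Surjective (![1, 0, 2] : Fin 3 → Fin 3) := by decide
  have b : Function.Surjective (![0, 2, 1] : Fin 3 → Fin 3) := by decide
  have h : ∀ r : Fin 3 → Fin 3, Function.Surjective r → r = id ∨ r = ![1, 0, 2] ∨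
      r = ![0, 2, 1] ∨ r = ![1, 0, 2] ∘ ![0, 2, 1] ∨ r = ![0, 2, 1] ∘ ![1, 0, 2] ∨
      r = ![1, 0, 2] ∘ ![0, 2, 1] ∘ ![1, 0, 2] := by decide
  rcases h r hr with rfl | rfl | rfl | rfl | rfl | rfl
  · rwa [crossUp_id (hR.le 3 hx)]
  · exact hR.swap₁_mem hx
  · exact hR.swap₂_mem hx
  · rw [← crossUp_crossUp _ b (hR.le 3 hx)]
    exact hR.swap₁_mem (hR.swap₂_mem hx)
  · rw [← crossUp_crossUp _ a (hR.le 3 hx)]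
    exact hR.swap₂_mem (hR.swap₁_mem hx)
  · rw [← crossUp_crossUp _ (b.comp a) (hR.le 3 hx), ← crossUp_crossUp _ a (hR.le 3 hx)]
    exact hR.swap₁_mem (hR.swap₂_mem (hR.swap₁_mem hx))

theorem surjective_three_two : ∀ r : Fin 3 → Fin 2, Function.Surjective r →
    ∃ s : Fin 3 → Fin 3, Function.Surjective s ∧ (r = ![0, 0, 1] ∘ s ∨ r = ![0, 1, 1] ∘ s) := by
  decide

theorem crossUp_three_two_mem (hR : IsStableFamily M.F R) {r : Fin 3 → Fin 2}
    (hr : Function.Surjective r) {x} (hx : x ∈ R 3) : crossUp M.F r x ∈ R 2 := by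
  obtain ⟨s, hs, rfl | rfl⟩ := surjective_three_two r hr
  · rw [← crossUp_crossUp _ hs (hR.le 3 hx)]
    exact hR.up₁ _ (hR.crossUp_three_mem hs hx)
  · rw [← crossUp_crossUp _ hs (hR.le 3 hx)]
    exact hR.up₂ _ (hR.crossUp_three_mem hs hx)

/-- By `crossDown_crossUp₀` the swap is `h p - 1` minus terms that pass through `F_3`, where all
surjections are already under control. -/
theorem swap_mem (hR : IsStableFamily M.F R) {x} (hx : x ∈ R 2) :
    crossUp M.F (![1, 0] : Fin 2 → Fin 2) x ∈ R 2 := by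
  have h := M.crossDown_crossUp₀ (hR.le 2 hx)
  have h' : crossUp M.F (![1, 0] : Fin 2 → Fin 2) x =
      crossDown M.F (![0, 0] : Fin 2 → Fin 1) (crossUp M.F (![0, 0] : Fin 2 → Fin 1) x) - x -
        crossUp M.F (![0, 1, 0] : Fin 3 → Fin 2) (crossDown M.F (![0, 0, 1] : Fin 3 → Fin 2) x) -
        crossUp M.F (![0, 1, 1] : Fin 3 → Fin 2) (crossDown M.F (![0, 0, 1] : Fin 3 → Fin 2) x) -
        crossUp M.F (![0, 0, 1] : Fin 3 → Fin 2) (crossDown M.F (![0, 1, 1] : Fin 3 → Fin 2) x) -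
        crossUp M.F (![1, 0, 1] : Fin 3 → Fin 2)
          (crossDown M.F (![0, 1, 1] : Fin 3 → Fin 2) x) := by
    rw [h]
    abel
  rw [h']
  exact sub_mem (sub_mem (sub_mem (sub_mem (sub_mem (hR.down₀ _ (hR.up₀ _ hx)) hx)
    (hR.crossUp_three_two_mem (by decide) (hR.down₁ _ hx)))
    (hR.crossUp_three_two_mem (by decide) (hR.down₁ _ hx)))
    (hR.crossUp_three_two_mem (by decide) (hR.down₂ _ hx)))
    (hR.crossUp_three_two_mem (by decide) (hR.down₂ _ hx))

theorem crossUp_two_mem (hR : IsStableFamily M.F R) {r : Fin 2 → Fin 2}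
    (hr : Function.Surjective r) {x} (hx : x ∈ R 2) : crossUp M.F r x ∈ R 2 := by
  have h : ∀ r : Fin 2 → Fin 2, Function.Surjective r → r = id ∨ r = ![1, 0] := by decide
  rcases h r hr with rfl | rfl
  · rwa [crossUp_id (hR.le 2 hx)]
  · exact hR.swap_mem hx

theorem mem_of_crossZ {k : ℕ} (hk : k = 0 ∨ 3 < k) {x}
    (hx : x ∈ crossZ M.F k) : x ∈ R k := by
  obtain rfl | hk := hk
  · rw [M.eq_zero_of_pow_zero x]
    exact zero_mem _
  · rw [M.eq_zero_of_mem_crossZ hk hx]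
    exact zero_mem _

/-- Non-surjective maps act by zero and cross-effects of order 0 or above 3 vanish, so only
surjections between sets of one to three elements remain. They are composites of permutations and
the given structure maps. -/
theorem crossUp_mem (hR : IsStableFamily M.F R) {t k : ℕ} (r : Fin t → Fin k) {x}
    (hx : x ∈ R t) : crossUp M.F r x ∈ R k := by
  by_cases hr : Function.Surjective r
  swap
  · rw [crossUp_eq_zero hr]
    exact zero_mem _
  by_cases hk : k = 0 ∨ 3 < k
  · exact mem_of_crossZ hk (_root_.crossUp_mem r x)
  have hkt : k ≤ t := by simpa using Fintype.card_le_of_surjective r hr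
  by_cases ht : 3 < t
  · rw [M.eq_zero_of_mem_crossZ ht (hR.le _ hx), _root_.map_zero]
    exact zero_mem _
  push Not at hk ht
  obtain ⟨hk0, hk3⟩ := hk
  replace hk0 := Nat.pos_of_ne_zero hk0
  interval_cases t <;> interval_cases k
  · rwa [Subsingleton.elim r id, crossUp_id (hR.le 1 hx)]
  · rw [show r = ![0, 0] from Subsingleton.elim _ _]
    exact hR.up₀ _ hx
  · exact hR.crossUp_two_mem hr hx
  · rw [show r = ![0, 0] ∘ ![0, 0, 1] from Subsingleton.elim _ _,
      ← crossUp_crossUp _ (by decide) (hR.le 3 hx)]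
    exact hR.up₀ _ (hR.up₁ _ hx)
  · exact hR.crossUp_three_two_mem hr hx
  · exact hR.crossUp_three_mem hr hx

theorem crossDown_perm_mem (hR : IsStableFamily M.F R) {t : ℕ} {s : Fin t → Fin t}
    (hs : Function.Surjective s) {x} (hx : x ∈ R t) : crossDown M.F s x ∈ R t := by
  have h := crossUp_perm (Equiv.ofBijective s ⟨Finite.injective_iff_surjective.2 hs, hs⟩).symm x
  rw [Equiv.symm_symm] at h
  exact h ▸ hR.crossUp_mem _ hx

theorem crossDown_mem (hR : IsStableFamily M.F R) {t k : ℕ} (l : Fin t → Fin k) {x}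
    (hx : x ∈ R k) : crossDown M.F l x ∈ R t := by
  by_cases hl : Function.Surjective l
  swap
  · rw [crossDown_eq_zero hl (hR.le _ hx)]
    exact zero_mem _
  by_cases ht : t = 0 ∨ 3 < t
  · exact mem_of_crossZ ht (_root_.crossDown_mem l x)
  have hkt : k ≤ t := by simpa using Fintype.card_le_of_surjective l hl
  obtain rfl | hk := Nat.eq_zero_or_pos k
  · rw [M.eq_zero_of_pow_zero x, _root_.map_zero]
    exact zero_mem _
  push Not at ht
  obtain ⟨ht0, ht3⟩ := ht
  interval_cases t <;> interval_cases k
  · exact hR.crossDown_perm_mem hl hx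
  · rw [show l = ![0, 0] from Subsingleton.elim _ _]
    exact hR.down₀ _ hx
  · exact hR.crossDown_perm_mem hl hx
  · rw [show l = ![0, 0] ∘ ![0, 0, 1] from Subsingleton.elim _ _,
      ← crossDown_crossDown _ (by decide)]
    exact hR.down₁ _ (hR.down₀ _ hx)
  · obtain ⟨s, hs, rfl | rfl⟩ := surjective_three_two l hl
    · rw [← crossDown_crossDown _ hs]
      exact hR.crossDown_perm_mem hs (hR.down₁ _ hx)
    · rw [← crossDown_crossDown _ hs]
      exact hR.crossDown_perm_mem hs (hR.down₂ _ hx)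
  · exact hR.crossDown_perm_mem hl hx

/-- Splitting the value at the apex of the span into cross-effects turns the action into a sum of
terms `crossUp (crossDown x)`. -/
theorem dev_act_mem_of_isSpan (hR : IsStableFamily M.F R) {j k : ℕ}
    {φ : (Fin j → ℤ) →+ (Fin k → ℤ)} (hφ : IsSpan φ) {x} (hx : x ∈ R j) :
    dev M.F Finset.univ (act M.F φ x) ∈ R k := by
  obtain ⟨n, r, l, rfl⟩ := hφ
  rw [← act_act, ← sum_dev M.F (act M.F (downHom l) x), _root_.map_sum, _root_.map_sum]
  refine sum_mem fun T _ => ?_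
  have hT : T = Finset.univ.image (T.orderEmbOfFin rfl) := by
    apply Finset.coe_injective
    rw [Finset.coe_image, Finset.coe_univ, Set.image_univ, Finset.range_orderEmbOfFin]
  rw [hT, dev_univ_act_upHom_dev_image (T.orderEmbOfFin rfl).injective]
  exact hR.crossUp_mem _ (hR.crossDown_mem _ hx)

end IsStableFamily

/-- Polynomial functors of degree at most three: the alternating sum over the partial sums of four
homomorphisms. -/
theorem TorsionFreeCubicModule.sum_act_sum_eq_zero (M : TorsionFreeCubicModule) {j k : ℕ}
    (ψ : Fin 4 → (Fin j → ℤ) →+ (Fin k → ℤ)) (x : (M.F.obj (FreeAb.pow j)).obj) :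
    ∑ T : Finset (Fin 4), (-1 : ℤ) ^ (4 - T.card) • act M.F (∑ i ∈ T, ψ i) x = 0 := by
  -- The composite of `(ψ₀, …, ψ₃)`, the idempotent of `T` on the fourfold sum, and the addition map
  -- is the partial sum over `T`. The identity is thus the image of the vanishing fourth
  -- cross-effect.
  let A : Fin 4 → FreeAb := fun _ => FreeAb.pow k
  let f : FreeAb.pow j ⟶ FreeAb.sum A := FreeAb.ofHom (X := FreeAb.pow j) (Y := FreeAb.sum A)
    (show (Fin j → ℤ) →+ (Fin 4 → Fin k → ℤ) from AddMonoidHom.mk' (fun x i => ψ i x)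
      (fun x y => funext fun i => (ψ i).map_add x y))
  let g : FreeAb.sum A ⟶ FreeAb.pow k := FreeAb.ofHom (X := FreeAb.sum A) (Y := FreeAb.pow k)
    (show (Fin 4 → Fin k → ℤ) →+ (Fin k → ℤ) from AddMonoidHom.mk' (fun y => ∑ i, y i)
      (fun x y => by simp [Finset.sum_add_distrib]))
  have h (T : Finset (Fin 4)) : f ≫ FreeAb.idem A T ≫ g =
      FreeAb.ofHom (X := FreeAb.pow j) (Y := FreeAb.pow k) (∑ i ∈ T, ψ i) := by
    refine ObjectProperty.hom_ext _ (AddCommGrpCat.hom_ext (AddMonoidHom.ext fun x => ?_))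
    have aux (x : Fin j → ℤ) : ∑ i, (if i ∈ T then ψ i x else 0) = (∑ i ∈ T, ψ i) x := by
      rw [AddMonoidHom.finsetSum_apply, Finset.sum_ite_mem, Finset.univ_inter]
    exact aux x
  have h0 : deviation M.F A Finset.univ (mapHom M.F f x) = 0 := by
    have h1 := M.crossEffect_eq_bot 4 (by norm_num) A
    have h2 : deviation M.F A Finset.univ (mapHom M.F f x) ∈ crossEffect M.F A := ⟨_, rfl⟩
    rw [h1] at h2
    exact AddSubgroup.mem_bot.1 h2
  have h1 := congrArg (mapHom M.F g) h0
  rw [_root_.map_zero] at h1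
  rw [← h1]
  unfold deviation
  rw [AddMonoidHom.finsetSum_apply, _root_.map_sum, Finset.powerset_univ]
  refine Finset.sum_congr rfl fun T _ => ?_
  change _ = mapHom M.F g (((-1 : ℤ) ^ (Finset.univ.card - T.card)) •
    mapHom M.F (FreeAb.idem A T) (mapHom M.F f x))
  rw [map_zsmul]
  congr 1
  refine (congrArg (fun f => mapHom M.F f x) (h T)).symm.trans ?_
  rw [mapHom_comp, mapHom_comp]
  rfl

namespace IsStableFamily

variable {M : TorsionFreeCubicModule} {R : ∀ k, AddSubgroup (M.F.obj (FreeAb.pow k)).obj}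

/-- A stable family is stable under all homomorphisms. -/
theorem dev_act_mem (hR : IsStableFamily M.F R) {j k : ℕ} (φ : (Fin j → ℤ) →+ (Fin k → ℤ)) {x}
    (hx : x ∈ R j) : dev M.F Finset.univ (act M.F φ x) ∈ R k := by
  obtain ⟨φ₁, φ₂, h₁, h₂, rfl⟩ := exists_isSpan_sub φ
  -- With this choice every partial sum except the one over `{0}` is a span, since one copy of `φ₂`
  -- already turns `φ₁ - φ₂` into `φ₁`. The cubic relation then expresses the action of `φ₁ - φ₂` by
  -- actions of spans.
  let ψ : Fin 4 → (Fin j → ℤ) →+ (Fin k → ℤ) := ![φ₁ - φ₂, φ₂, φ₂, φ₂]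
  have hψ (i) (hi : i ≠ 0) : IsSpan (ψ i) := by
    fin_cases i
    · exact absurd rfl hi
    all_goals exact h₂
  have hψ' (T : Finset (Fin 4)) (hT : T ≠ {0}) : IsSpan (∑ i ∈ T, ψ i) := by
    by_cases h0 : 0 ∈ T
    · obtain ⟨i, hi, hi0⟩ : ∃ i ∈ T, i ≠ 0 := by
        by_contra! h
        exact hT (Finset.eq_singleton_iff_unique_mem.2 ⟨h0, h⟩)
      have hi' : i ∈ T.erase 0 := Finset.mem_erase.2 ⟨hi0, hi⟩
      rw [← Finset.add_sum_erase _ _ h0, ← Finset.add_sum_erase _ _ hi', ← add_assoc]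
      have : ψ 0 + ψ i = φ₁ := by
        have hi2 : ψ i = φ₂ := by
          fin_cases i
          · exact absurd rfl hi0
          all_goals rfl
        rw [hi2]
        exact sub_add_cancel _ _
      rw [this]
      exact h₁.add (IsSpan.sum fun a ha =>
        hψ a (Finset.mem_erase.1 (Finset.mem_erase.1 ha).2).1)
    · exact IsSpan.sum fun a ha => hψ a fun h => h0 (h ▸ ha)
  have h := M.sum_act_sum_eq_zero ψ x
  rw [← Finset.add_sum_erase _ _ (Finset.mem_univ {0})] at h
  have h' := congrArg (dev M.F Finset.univ) h
  have hφ : ∑ i ∈ {0}, ψ i = φ₁ - φ₂ := Finset.sum_singleton _ _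
  rw [hφ, _root_.map_zero, _root_.map_add, _root_.map_sum, _root_.map_zsmul] at h'
  have h3 : (-1 : ℤ) ^ (4 - ({0} : Finset (Fin 4)).card) = -1 := by simp
  rw [h3, neg_smul, one_smul, neg_add_eq_zero] at h'
  rw [h']
  refine sum_mem fun T hT => ?_
  rw [map_zsmul]
  exact zsmul_mem (hR.dev_act_mem_of_isSpan (hψ' T (Finset.mem_erase.1 hT).1) hx) _

end IsStableFamily

end

noncomputable section

/-! ### Subfunctors that are given by stable families -/

theorem dev_mapHom_eq {F : FreeAb ⥤ FreeAb} {j k : ℕ} (φ : FreeAb.pow j ⟶ FreeAb.pow k) (x) :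
    dev F Finset.univ (mapHom F φ x) =
      dev F Finset.univ (act F (show (Fin j → ℤ) →+ (Fin k → ℤ) from φ.hom.hom) x) := rfl

section stableSub

variable (F : FreeAb ⥤ FreeAb) (R : ∀ k, AddSubgroup (F.obj (FreeAb.pow k)).obj)

/-- The largest subfunctor of `F` whose cross-effects are contained in a given family. -/
def stableSub (X : FreeAb) : AddSubgroup (F.obj X).obj where
  carrier := {z | ∀ (k : ℕ) (φ : X ⟶ FreeAb.pow k), dev F Finset.univ (mapHom F φ z) ∈ R k}
  zero_mem' k φ := by
    rw [map_zero, map_zero]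
    exact zero_mem _
  add_mem' hx hy k φ := by
    rw [map_add, map_add]
    exact add_mem (hx k φ) (hy k φ)
  neg_mem' hx k φ := by
    rw [map_neg, map_neg]
    exact neg_mem (hx k φ)

variable {F R}

theorem mapHom_mem_stableSub {X Y : FreeAb} (ψ : X ⟶ Y) {z : (F.obj X).obj}
    (hz : z ∈ stableSub F R X) : mapHom F ψ z ∈ stableSub F R Y := fun k φ => by
  have h := hz k (ψ ≫ φ)
  rw [mapHom_comp] at h
  exact h

/-- The largest subfunctor with cross-effects inside `R` really attains `R`: stability under all
homomorphisms puts every image of `R j` into it. -/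
theorem IsStableFamily.mapHom_mem_stableSub {M : TorsionFreeCubicModule}
    {R : ∀ k, AddSubgroup (M.F.obj (FreeAb.pow k)).obj} (hR : IsStableFamily M.F R) {j : ℕ}
    {X : FreeAb} (ψ : FreeAb.pow j ⟶ X) {x : (M.F.obj (FreeAb.pow j)).obj} (hx : x ∈ R j) :
    mapHom M.F ψ x ∈ stableSub M.F R X := fun k φ => by
  have h := hR.dev_act_mem (show (Fin j → ℤ) →+ (Fin k → ℤ) from (ψ ≫ φ).hom.hom) hx
  rw [← dev_mapHom_eq, mapHom_comp] at h
  exact h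

end stableSub

/-- Deviations are natural. -/
theorem map_deviation {F G : FreeAb ⥤ FreeAb} {m : ℕ} {A : Fin m → FreeAb} {S : Finset (Fin m)}
    (g : (F.obj (FreeAb.sum A)).obj →+ (G.obj (FreeAb.sum A)).obj)
    (hg : ∀ T z, g (mapHom F (FreeAb.idem A T) z) = mapHom G (FreeAb.idem A T) (g z)) (z) :
    g (deviation F A S z) = deviation G A S (g z) := by
  unfold deviation
  simp only [AddMonoidHom.finsetSum_apply, AddMonoidHom.smul_apply, map_sum, map_zsmul, hg]

/-- The decomposition of the values of functors into cross-effects. -/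
theorem exists_eq_sum_mapHom_dev (X : FreeAb) : ∃ (n : ℕ) (d : Finset (Fin n) → ℕ)
    (a : ∀ T, X ⟶ FreeAb.pow (d T)) (b : ∀ T, FreeAb.pow (d T) ⟶ X),
    ∀ (F : FreeAb ⥤ FreeAb) (z : (F.obj X).obj),
      ∑ T, mapHom F (b T) (dev F Finset.univ (mapHom F (a T) z)) = z := by
  obtain ⟨n, ⟨e⟩⟩ : ∃ n : ℕ, Nonempty (X.obj ≃+ (Fin n → ℤ)) :=
    ⟨_, ⟨(Module.finBasis ℤ X.obj).equivFun.toAddEquiv⟩⟩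
  let i : X ⟶ FreeAb.pow n := FreeAb.ofHom (X := X) (Y := FreeAb.pow n) e.toAddMonoidHom
  let j : FreeAb.pow n ⟶ X := FreeAb.ofHom (X := FreeAb.pow n) (Y := X) e.symm.toAddMonoidHom
  have hij : i ≫ j = 𝟙 X :=
    ObjectProperty.hom_ext _ (AddCommGrpCat.hom_ext (AddMonoidHom.ext e.symm_apply_apply))
  refine ⟨n, fun T => T.card, fun T => i ≫ FreeAb.ofHom (X := FreeAb.pow n)
    (Y := FreeAb.pow T.card) (downHom (T.orderEmbOfFin rfl)), fun T => FreeAb.ofHom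
    (X := FreeAb.pow T.card) (Y := FreeAb.pow n) (upHom (T.orderEmbOfFin rfl)) ≫ j,
    fun F z => ?_⟩
  have h : mapHom F j (∑ T, dev F T (mapHom F i z)) = z := by
    rw [sum_dev, ← AddMonoidHom.comp_apply, ← mapHom_comp, hij, mapHom_id]
    rfl
  rw [map_sum] at h
  refine Eq.trans (Finset.sum_congr rfl fun T _ => ?_) h
  have hT : T = Finset.univ.image (T.orderEmbOfFin rfl) := by
    apply Finset.coe_injective
    rw [Finset.coe_image, Finset.coe_univ, Set.image_univ, Finset.range_orderEmbOfFin]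
  have h' := dev_image F (T.orderEmbOfFin rfl).injective (mapHom F i z)
  rw [← hT] at h'
  rw [h', mapHom_comp, mapHom_comp]
  rfl

namespace TorsionFreeCubicModule

/-! ### Products of cubic modules -/

section prod

variable (F G : FreeAb ⥤ FreeAb)

/-- The product of two functors. -/
def prodFunctor : FreeAb ⥤ FreeAb where
  obj X := ⟨AddCommGrpCat.of ((F.obj X).obj × (G.obj X).obj),
    inferInstanceAs (Module.Finite ℤ ((F.obj X).obj × (G.obj X).obj)),
    inferInstanceAs (Module.Free ℤ ((F.obj X).obj × (G.obj X).obj))⟩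
  map {X Y} f := ObjectProperty.homMk
    (AddCommGrpCat.ofHom ((mapHom F f).prodMap (mapHom G f)))
  map_id X := by
    rw [mapHom_id, mapHom_id]
    rfl
  map_comp f g := by
    rw [mapHom_comp, mapHom_comp]
    rfl

theorem deviation_prodFunctor {m : ℕ} (A : Fin m → FreeAb) (S : Finset (Fin m))
    (z : (F.obj (FreeAb.sum A)).obj × (G.obj (FreeAb.sum A)).obj) :
    deviation (prodFunctor F G) A S z = (deviation F A S z.1, deviation G A S z.2) :=
  Prod.ext
    (map_deviation (F := prodFunctor F G) (G := F) (AddMonoidHom.fst _ _) (fun _ _ => rfl) z)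
    (map_deviation (F := prodFunctor F G) (G := G) (AddMonoidHom.snd _ _) (fun _ _ => rfl) z)

end prod

variable (M N : TorsionFreeCubicModule)

/-- The product of two cubic modules. -/
def prod : TorsionFreeCubicModule where
  F := prodFunctor M.F N.F
  map_zero X Y := by
    refine ObjectProperty.hom_ext _ (AddCommGrpCat.hom_ext (AddMonoidHom.ext fun z => ?_))
    change (mapHom M.F 0 z.1, mapHom N.F 0 z.2) = 0
    unfold mapHom
    rw [M.map_zero, N.map_zero]
    rfl
  crossEffect_eq_bot m hm A := by
    rw [eq_bot_iff]
    rintro _ ⟨z, rfl⟩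
    have h₁ : deviation M.F A Finset.univ z.1 ∈ crossEffect M.F A := ⟨_, rfl⟩
    have h₂ : deviation N.F A Finset.univ z.2 ∈ crossEffect N.F A := ⟨_, rfl⟩
    rw [M.crossEffect_eq_bot m hm, AddSubgroup.mem_bot] at h₁
    rw [N.crossEffect_eq_bot m hm, AddSubgroup.mem_bot] at h₂
    exact (deviation_prodFunctor M.F N.F A Finset.univ z).trans (Prod.ext h₁ h₂)

variable {M N}

theorem dev_prod {m : ℕ} {S : Finset (Fin m)} (z : ((M.prod N).F.obj (FreeAb.pow m)).obj) :
    dev (M.prod N).F S z = (dev M.F S z.1, dev N.F S z.2) :=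
  deviation_prodFunctor M.F N.F _ S z

/-- Cubic modules are isomorphic if there is a stable family of graphs of bijections between their
cross-effects. -/
theorem isomorphic_of_isStableFamily
    {R : ∀ k, AddSubgroup ((M.prod N).F.obj (FreeAb.pow k)).obj}
    (hR : IsStableFamily (M.prod N).F R)
    (h₁ : ∀ k, ∀ x ∈ crossZ M.F k, ∃ y, (show ((M.prod N).F.obj (FreeAb.pow k)).obj from
      (x, y)) ∈ R k)
    (h₂ : ∀ k, ∀ y ∈ crossZ N.F k, ∃ x, (show ((M.prod N).F.obj (FreeAb.pow k)).obj from
      (x, y)) ∈ R k)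
    (h₃ : ∀ k, ∀ z ∈ R k, z.1 = 0 → z.2 = 0) (h₄ : ∀ k, ∀ z ∈ R k, z.2 = 0 → z.1 = 0) :
    M.Isomorphic N := by
  -- The subfunctor `Γ` of the product is a graph of bijections. Injectivity and surjectivity of
  -- both projections follow from those on cross-effects, because every value decomposes naturally
  -- into cross-effects. Naturality holds because `Γ` is a subfunctor.
  let Γ (X : FreeAb) : AddSubgroup ((M.F.obj X).obj × (N.F.obj X).obj) :=
    stableSub (M.prod N).F R X
  have map {X Y : FreeAb} (f : X ⟶ Y) (z) (hz : z ∈ Γ X) :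
      (mapHom M.F f z.1, mapHom N.F f z.2) ∈ Γ Y := mapHom_mem_stableSub f hz
  have dev_mem {X : FreeAb} (z) (hz : z ∈ Γ X) (k : ℕ) (φ : X ⟶ FreeAb.pow k) :
      (show ((M.prod N).F.obj (FreeAb.pow k)).obj from
        (dev M.F Finset.univ (mapHom M.F φ z.1), dev N.F Finset.univ (mapHom N.F φ z.2))) ∈
        R k := by
    have h := hz k φ
    rwa [dev_prod] at h
  have i₁ (X : FreeAb) (z) (hz : z ∈ Γ X) (h0 : z.1 = 0) : z.2 = 0 := by
    obtain ⟨n, d, a, b, hab⟩ := exists_eq_sum_mapHom_dev X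
    rw [← hab N.F z.2]
    refine Finset.sum_eq_zero fun T _ => ?_
    have h := h₃ _ _ (dev_mem z hz (d T) (a T)) (by
      change dev M.F _ (mapHom M.F (a T) z.1) = 0
      rw [h0, _root_.map_zero, _root_.map_zero])
    exact (congrArg _ h).trans (_root_.map_zero _)
  have i₂ (X : FreeAb) (z) (hz : z ∈ Γ X) (h0 : z.2 = 0) : z.1 = 0 := by
    obtain ⟨n, d, a, b, hab⟩ := exists_eq_sum_mapHom_dev X
    rw [← hab M.F z.1]
    refine Finset.sum_eq_zero fun T _ => ?_
    have h := h₄ _ _ (dev_mem z hz (d T) (a T)) (by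
      change dev N.F _ (mapHom N.F (a T) z.2) = 0
      rw [h0, _root_.map_zero, _root_.map_zero])
    exact (congrArg _ h).trans (_root_.map_zero _)
  have s₁ (X : FreeAb) (u) : ∃ z ∈ Γ X, z.1 = u := by
    obtain ⟨n, d, a, b, hab⟩ := exists_eq_sum_mapHom_dev X
    choose y hy using fun T => h₁ (d T) (dev M.F Finset.univ (mapHom M.F (a T) u)) ⟨_, rfl⟩
    refine ⟨∑ T, (mapHom M.F (b T) (dev M.F Finset.univ (mapHom M.F (a T) u)),
      mapHom N.F (b T) (y T)), sum_mem fun T _ => hR.mapHom_mem_stableSub (b T) (hy T), ?_⟩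
    rw [Prod.fst_sum]
    exact hab M.F u
  have s₂ (X : FreeAb) (w) : ∃ z ∈ Γ X, z.2 = w := by
    obtain ⟨n, d, a, b, hab⟩ := exists_eq_sum_mapHom_dev X
    choose x hx using fun T => h₂ (d T) (dev N.F Finset.univ (mapHom N.F (a T) w)) ⟨_, rfl⟩
    refine ⟨∑ T, (mapHom M.F (b T) (x T),
      mapHom N.F (b T) (dev N.F Finset.univ (mapHom N.F (a T) w))),
      sum_mem fun T _ => hR.mapHom_mem_stableSub (b T) (hx T), ?_⟩
    rw [Prod.snd_sum]
    exact hab N.F w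
  let f₁ (X : FreeAb) : Γ X ≃+ (M.F.obj X).obj :=
    AddEquiv.ofBijective ((AddMonoidHom.fst _ _).comp (Γ X).subtype)
      ⟨(injective_iff_map_eq_zero _).2 fun z h => Subtype.ext (Prod.ext h (i₁ X z z.2 h)),
        fun u => let ⟨z, hz, h⟩ := s₁ X u; ⟨⟨z, hz⟩, h⟩⟩
  let f₂ (X : FreeAb) : Γ X ≃+ (N.F.obj X).obj :=
    AddEquiv.ofBijective ((AddMonoidHom.snd _ _).comp (Γ X).subtype)
      ⟨(injective_iff_map_eq_zero _).2 fun z h => Subtype.ext (Prod.ext (i₂ X z z.2 h) h),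
        fun u => let ⟨z, hz, h⟩ := s₂ X u; ⟨⟨z, hz⟩, h⟩⟩
  let e (X : FreeAb) : (M.F.obj X).obj ≃+ (N.F.obj X).obj := (f₁ X).symm.trans (f₂ X)
  refine ⟨NatIso.ofComponents (fun X => ⟨FreeAb.ofHom (e X).toAddMonoidHom,
    FreeAb.ofHom (e X).symm.toAddMonoidHom,
    ObjectProperty.hom_ext _ (AddCommGrpCat.hom_ext (AddMonoidHom.ext (e X).symm_apply_apply)),
    ObjectProperty.hom_ext _ (AddCommGrpCat.hom_ext (AddMonoidHom.ext (e X).apply_symm_apply))⟩)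
    fun {X Y} f => ObjectProperty.hom_ext _ (AddCommGrpCat.hom_ext (AddMonoidHom.ext fun u => ?_))⟩
  change e Y (mapHom M.F f u) = mapHom N.F f (e X u)
  obtain ⟨z, rfl⟩ := (f₁ X).surjective u
  have h : mapHom M.F f (f₁ X z) = f₁ Y ⟨_, map f z z.2⟩ := rfl
  rw [h]
  simp only [e, AddEquiv.trans_apply, AddEquiv.symm_apply_apply]
  rfl

end TorsionFreeCubicModule
end

noncomputable section

theorem CubicDiagram.isomorphic_of_addEquiv {D E : CubicDiagram ℤ} (e₁ : D.V₁ ≃+ E.V₁)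
    (e₂ : D.V₂ ≃+ E.V₂) (e₃ : D.V₃ ≃+ E.V₃) (h : ∀ x, e₂ (D.h x) = E.h (e₁ x))
    (p : ∀ x, e₁ (D.p x) = E.p (e₂ x)) (h₁ : ∀ x, e₃ (D.h₁ x) = E.h₁ (e₂ x))
    (h₂ : ∀ x, e₃ (D.h₂ x) = E.h₂ (e₂ x)) (p₁ : ∀ x, e₂ (D.p₁ x) = E.p₁ (e₃ x))
    (p₂ : ∀ x, e₂ (D.p₂ x) = E.p₂ (e₃ x)) : D.Isomorphic E :=
  ⟨{ e₁ with map_smul' := (intLinearMap e₁.toAddMonoidHom).map_smul },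
    { e₂ with map_smul' := (intLinearMap e₂.toAddMonoidHom).map_smul },
    { e₃ with map_smul' := (intLinearMap e₃.toAddMonoidHom).map_smul }, h, p, h₁, h₂, p₁, p₂⟩

namespace TorsionFreeCubicModule

/-! ### Isomorphisms of cubic modules and of their diagrams -/

variable {M N : TorsionFreeCubicModule}

theorem crossUp_prod {m n : ℕ} (r : Fin m → Fin n) (z : ((M.prod N).F.obj (FreeAb.pow m)).obj) :
    crossUp (M.prod N).F r z = (crossUp M.F r z.1, crossUp N.F r z.2) :=
  dev_prod _

theorem crossDown_prod {m n : ℕ} (r : Fin n → Fin m)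
    (z : ((M.prod N).F.obj (FreeAb.pow m)).obj) :
    crossDown (M.prod N).F r z = (crossDown M.F r z.1, crossDown N.F r z.2) :=
  dev_prod _

/-- The graph of a homomorphism between cross-effects. -/
def crossGraph {k : ℕ} (f : crossZ M.F k →+ crossZ N.F k) :
    AddSubgroup ((M.prod N).F.obj (FreeAb.pow k)).obj :=
  ((crossZ M.F k).subtype.prod ((crossZ N.F k).subtype.comp f)).range

theorem mk_mem_crossGraph {k : ℕ} (f : crossZ M.F k →+ crossZ N.F k) {x : crossZ M.F k}
    {y : crossZ N.F k} (h : f x = y) : (show ((M.prod N).F.obj (FreeAb.pow k)).obj from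
      ((x : (M.F.obj (FreeAb.pow k)).obj), (y : (N.F.obj (FreeAb.pow k)).obj))) ∈
      crossGraph f :=
  ⟨x, by rw [← h]; rfl⟩

theorem mem_crossGraph {k : ℕ} (f : crossZ M.F k →+ crossZ N.F k)
    {z : ((M.prod N).F.obj (FreeAb.pow k)).obj} {x : crossZ M.F k}
    {y : crossZ N.F k} (h : f x = y) (hz : z = (show ((M.prod N).F.obj (FreeAb.pow k)).obj from
      ((x : (M.F.obj (FreeAb.pow k)).obj), (y : (N.F.obj (FreeAb.pow k)).obj)))) :
    z ∈ crossGraph f := by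
  rw [hz]
  exact mk_mem_crossGraph f h

theorem crossGraph_le {k : ℕ} (f : crossZ M.F k →+ crossZ N.F k) :
    crossGraph f ≤ crossZ (M.prod N).F k := by
  rintro _ ⟨x, rfl⟩
  exact (mem_crossZ_iff _).2 <| (dev_prod _).trans (Prod.ext ((mem_crossZ_iff _).1 x.2)
    ((mem_crossZ_iff _).1 (f x).2))

/-- Compatibility with the structure maps says precisely that the graphs of `e₁`, `e₂`, `e₃` form a
stable family in the product. In all other orders the cross-effects are zero, so the trivial
subgroup is the graph there. -/
theorem isomorphic_of_crossZ (e₁ : crossZ M.F 1 ≃+ crossZ N.F 1)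
    (e₂ : crossZ M.F 2 ≃+ crossZ N.F 2) (e₃ : crossZ M.F 3 ≃+ crossZ N.F 3)
    (h : ∀ x, e₂ (structH₀ M.F x) = structH₀ N.F (e₁ x))
    (p : ∀ x, e₁ (structP₀ M.F x) = structP₀ N.F (e₂ x))
    (h₁ : ∀ x, e₃ (structH₁ M.F x) = structH₁ N.F (e₂ x))
    (h₂ : ∀ x, e₃ (structH₂ M.F x) = structH₂ N.F (e₂ x))
    (p₁ : ∀ x, e₂ (structP₁ M.F x) = structP₁ N.F (e₃ x))
    (p₂ : ∀ x, e₂ (structP₂ M.F x) = structP₂ N.F (e₃ x)) : M.Isomorphic N := by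
  let R : ∀ k, AddSubgroup ((M.prod N).F.obj (FreeAb.pow k)).obj
    | 1 => crossGraph e₁.toAddMonoidHom
    | 2 => crossGraph e₂.toAddMonoidHom
    | 3 => crossGraph e₃.toAddMonoidHom
    | _ => ⊥
  have hR : IsStableFamily (M.prod N).F R := by
    refine ⟨?_, ?_, ?_, ?_, ?_, ?_, ?_⟩
    · rintro (_ | _ | _ | _ | k)
      exacts [bot_le, crossGraph_le _, crossGraph_le _, crossGraph_le _, bot_le]
    · rintro _ ⟨x, rfl⟩
      exact mem_crossGraph e₂.toAddMonoidHom (h x)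
        ((crossDown_prod _ _).trans (Prod.ext (coe_structH₀ _ _).symm (coe_structH₀ _ _).symm))
    · rintro _ ⟨x, rfl⟩
      exact mem_crossGraph e₁.toAddMonoidHom (p x)
        ((crossUp_prod _ _).trans (Prod.ext (coe_structP₀ _ _).symm (coe_structP₀ _ _).symm))
    · rintro _ ⟨x, rfl⟩
      exact mem_crossGraph e₃.toAddMonoidHom (h₁ x)
        ((crossDown_prod _ _).trans (Prod.ext (coe_structH₁ _ _).symm (coe_structH₁ _ _).symm))
    · rintro _ ⟨x, rfl⟩
      exact mem_crossGraph e₃.toAddMonoidHom (h₂ x)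
        ((crossDown_prod _ _).trans (Prod.ext (coe_structH₂ _ _).symm (coe_structH₂ _ _).symm))
    · rintro _ ⟨x, rfl⟩
      exact mem_crossGraph e₂.toAddMonoidHom (p₁ x)
        ((crossUp_prod _ _).trans (Prod.ext (coe_structP₁ _ _).symm (coe_structP₁ _ _).symm))
    · rintro _ ⟨x, rfl⟩
      exact mem_crossGraph e₂.toAddMonoidHom (p₂ x)
        ((crossUp_prod _ _).trans (Prod.ext (coe_structP₂ _ _).symm (coe_structP₂ _ _).symm))
  have fst {k : ℕ} (e : crossZ M.F k ≃+ crossZ N.F k) (x) (hx : x ∈ crossZ M.F k) :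
      ∃ y, (show ((M.prod N).F.obj (FreeAb.pow k)).obj from (x, y)) ∈
        crossGraph e.toAddMonoidHom :=
    ⟨_, mk_mem_crossGraph e.toAddMonoidHom (x := ⟨x, hx⟩) rfl⟩
  have snd {k : ℕ} (e : crossZ M.F k ≃+ crossZ N.F k) (y) (hy : y ∈ crossZ N.F k) :
      ∃ x, (show ((M.prod N).F.obj (FreeAb.pow k)).obj from (x, y)) ∈
        crossGraph e.toAddMonoidHom :=
    ⟨_, mk_mem_crossGraph e.toAddMonoidHom (y := ⟨y, hy⟩) (e.apply_symm_apply _)⟩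
  have inj {k : ℕ} (e : crossZ M.F k ≃+ crossZ N.F k) (z) (hz : z ∈ crossGraph e.toAddMonoidHom)
      (h0 : z.1 = 0) : z.2 = 0 := by
    obtain ⟨x, rfl⟩ := hz
    have hx : x = 0 := Subtype.ext h0
    subst hx
    exact congrArg Subtype.val (_root_.map_zero e)
  have inj' {k : ℕ} (e : crossZ M.F k ≃+ crossZ N.F k) (z)
      (hz : z ∈ crossGraph e.toAddMonoidHom) (h0 : z.2 = 0) : z.1 = 0 := by
    obtain ⟨x, rfl⟩ := hz
    have hx : e x = 0 := Subtype.ext h0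
    rw [EmbeddingLike.map_eq_zero_iff] at hx
    subst hx
    rfl
  refine isomorphic_of_isStableFamily hR ?_ ?_ ?_ ?_
  · rintro (_ | _ | _ | _ | k) x hx
    exacts [⟨0, Prod.ext (M.eq_zero_of_pow_zero x) rfl⟩, fst e₁ x hx, fst e₂ x hx, fst e₃ x hx,
      ⟨0, Prod.ext (M.eq_zero_of_mem_crossZ (by omega) hx) rfl⟩]
  · rintro (_ | _ | _ | _ | k) x hx
    exacts [⟨0, Prod.ext rfl (N.eq_zero_of_pow_zero x)⟩, snd e₁ x hx, snd e₂ x hx, snd e₃ x hx,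
      ⟨0, Prod.ext rfl (N.eq_zero_of_mem_crossZ (by omega) hx)⟩]
  · rintro (_ | _ | _ | _ | k) z hz
    exacts [fun _ => congrArg Prod.snd (show z = 0 from hz), inj e₁ z hz, inj e₂ z hz,
      inj e₃ z hz, fun _ => congrArg Prod.snd (show z = 0 from hz)]
  · rintro (_ | _ | _ | _ | k) z hz
    exacts [fun _ => congrArg Prod.fst (show z = 0 from hz), inj' e₁ z hz, inj' e₂ z hz,
      inj' e₃ z hz, fun _ => congrArg Prod.fst (show z = 0 from hz)]

theorem isomorphic_of_diagram (i : M.diagram.Isomorphic N.diagram) : M.Isomorphic N := by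
  obtain ⟨e₁, e₂, e₃, h, p, h₁, h₂, p₁, p₂⟩ := i
  exact isomorphic_of_crossZ e₁.toAddEquiv e₂.toAddEquiv e₃.toAddEquiv h p h₁ h₂ p₁ p₂

section natIso

variable {F G : FreeAb ⥤ FreeAb}

/-- The components of a natural transformation. -/
def appHom (α : F ⟶ G) (X : FreeAb) : (F.obj X).obj →+ (G.obj X).obj := (α.app X).hom.hom

theorem appHom_mapHom (α : F ⟶ G) {X Y : FreeAb} (f : X ⟶ Y) (z) :
    appHom α Y (mapHom F f z) = mapHom G f (appHom α X z) :=
  congrArg (fun g : F.obj X ⟶ G.obj Y => g.hom.hom z) (α.naturality f)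

theorem appHom_mem_crossZ (α : F ⟶ G) {k : ℕ} {x} (hx : x ∈ crossZ F k) :
    appHom α (FreeAb.pow k) x ∈ crossZ G k := by
  obtain ⟨z, rfl⟩ := hx
  exact ⟨_, (map_deviation _ (fun _ z => appHom_mapHom α _ z) z).symm⟩

/-- A natural isomorphism induces isomorphisms of the cross-effects. -/
def crossZCongr (α : F ≅ G) (k : ℕ) : crossZ F k ≃+ crossZ G k where
  toFun x := ⟨appHom α.hom _ x, appHom_mem_crossZ α.hom x.2⟩
  invFun x := ⟨appHom α.inv _ x, appHom_mem_crossZ α.inv x.2⟩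
  left_inv x := Subtype.ext
    (congrArg (fun g : F.obj _ ⟶ F.obj _ => g.hom.hom (x : (F.obj (FreeAb.pow k)).obj))
      (α.hom_inv_id_app (FreeAb.pow k)))
  right_inv x := Subtype.ext
    (congrArg (fun g : G.obj _ ⟶ G.obj _ => g.hom.hom (x : (G.obj (FreeAb.pow k)).obj))
      (α.inv_hom_id_app (FreeAb.pow k)))
  map_add' _ _ := Subtype.ext (_root_.map_add (appHom α.hom _) _ _)

theorem crossZCongr_crossH (α : F ≅ G) {m : ℕ} (k : Fin m) (x : crossZ F m) :
    crossZCongr α (m + 1) (crossH F k x) = crossH G k (crossZCongr α m x) :=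
  Subtype.ext ((map_deviation _ (fun _ z => appHom_mapHom α.hom _ z) _).trans
    (congrArg _ (appHom_mapHom α.hom _ _)))

theorem crossZCongr_crossP (α : F ≅ G) {m : ℕ} (k : Fin m) (x : crossZ F (m + 1)) :
    crossZCongr α m (crossP F k x) = crossP G k (crossZCongr α (m + 1) x) :=
  Subtype.ext ((map_deviation _ (fun _ z => appHom_mapHom α.hom _ z) _).trans
    (congrArg _ (appHom_mapHom α.hom _ _)))

end natIso

theorem Isomorphic.diagram (i : M.Isomorphic N) : M.diagram.Isomorphic N.diagram := by
  obtain ⟨α⟩ := i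
  exact CubicDiagram.isomorphic_of_addEquiv (D := M.diagram) (E := N.diagram)
    (crossZCongr α 1) (crossZCongr α 2) (crossZCongr α 3)
    (crossZCongr_crossH α 0) (crossZCongr_crossP α 0) (crossZCongr_crossH α 0)
    (crossZCongr_crossH α 1) (crossZCongr_crossP α 0) (crossZCongr_crossP α 1)

theorem finite_crossZ (F : FreeAb ⥤ FreeAb) (k : ℕ) : Module.Finite ℤ (crossZ F k) :=
  Module.Finite.of_injective (CubicDiagram.intLinearMap (crossZ F k).subtype) Subtype.val_injective

theorem isTorsionFree_crossZ (F : FreeAb ⥤ FreeAb) (k : ℕ) :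
    Module.IsTorsionFree ℤ (crossZ F k) :=
  Subtype.val_injective.moduleIsTorsionFree (CubicDiagram.intLinearMap (crossZ F k).subtype)
    (CubicDiagram.intLinearMap (crossZ F k).subtype).map_smul

theorem diagram_isTorsionFreeAModule (M : TorsionFreeCubicModule) :
    M.diagram.IsTorsionFreeAModule :=
  ⟨M.diagram_isAModule, finite_crossZ M.F 1, finite_crossZ M.F 2, finite_crossZ M.F 3,
    isTorsionFree_crossZ M.F 1, isTorsionFree_crossZ M.F 2, isTorsionFree_crossZ M.F 3⟩

end TorsionFreeCubicModule
end

noncomputable section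

theorem free_addSubgroup {A : Type} [AddCommGroup A] [Module.Finite ℤ A] [Module.Free ℤ A]
    (H : AddSubgroup A) : Module.Finite ℤ H ∧ Module.Free ℤ H :=
  ⟨inferInstanceAs (Module.Finite ℤ (AddSubgroup.toIntSubmodule H)),
    inferInstanceAs (Module.Free ℤ (AddSubgroup.toIntSubmodule H))⟩

namespace TorsionFreeCubicModule

/-! ### Cubic submodules -/

variable (M : TorsionFreeCubicModule) (R : ∀ k, AddSubgroup (M.F.obj (FreeAb.pow k)).obj)

/-- The functor of the largest subgroups with cross-effects in a given family. -/
def subFunctor : FreeAb ⥤ FreeAb where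
  obj X := ⟨AddCommGrpCat.of (stableSub M.F R X), free_addSubgroup (stableSub M.F R X)⟩
  map {X Y} f := ObjectProperty.homMk (AddCommGrpCat.ofHom
    (((mapHom M.F f).comp (stableSub M.F R X).subtype).codRestrict (stableSub M.F R Y)
      fun z => mapHom_mem_stableSub f z.2))
  map_id X := ObjectProperty.hom_ext _ (AddCommGrpCat.hom_ext (AddMonoidHom.ext fun z =>
    Subtype.ext (DFunLike.congr_fun (mapHom_id M.F X) (z : (M.F.obj X).obj))))
  map_comp {X _ _} f g := ObjectProperty.hom_ext _ (AddCommGrpCat.hom_ext (AddMonoidHom.ext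
    fun z => Subtype.ext (DFunLike.congr_fun (mapHom_comp M.F f g)
      ((z : stableSub M.F R X) : (M.F.obj X).obj))))

/-- The inclusion of the subfunctor. -/
def subVal (X : FreeAb) : ((M.subFunctor R).obj X).obj →+ (M.F.obj X).obj :=
  (stableSub M.F R X).subtype

theorem subVal_injective (X : FreeAb) : Function.Injective (M.subVal R X) :=
  Subtype.val_injective

theorem subVal_deviation {m : ℕ} (A : Fin m → FreeAb) (S : Finset (Fin m)) (z) :
    M.subVal R _ (deviation (M.subFunctor R) A S z) = deviation M.F A S (M.subVal R _ z) :=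
  map_deviation _ (fun _ _ => rfl) z

theorem subVal_dev {m : ℕ} (S : Finset (Fin m)) (z) :
    M.subVal R _ (dev (M.subFunctor R) S z) = dev M.F S (M.subVal R _ z) :=
  M.subVal_deviation R _ S z

theorem subVal_crossDown {m n : ℕ} (l : Fin n → Fin m) (z) :
    M.subVal R _ (crossDown (M.subFunctor R) l z) = crossDown M.F l (M.subVal R _ z) :=
  M.subVal_dev R _ _

theorem subVal_crossUp {m n : ℕ} (r : Fin m → Fin n) (z) :
    M.subVal R _ (crossUp (M.subFunctor R) r z) = crossUp M.F r (M.subVal R _ z) :=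
  M.subVal_dev R _ _

/-- The largest cubic submodule with cross-effects in a given family. -/
def sub : TorsionFreeCubicModule where
  F := M.subFunctor R
  map_zero X Y := ObjectProperty.hom_ext _ (AddCommGrpCat.hom_ext (AddMonoidHom.ext fun z =>
    M.subVal_injective R Y (congrArg (fun g : M.F.obj X ⟶ M.F.obj Y => g.hom.hom (M.subVal R X z))
      (M.map_zero X Y))))
  crossEffect_eq_bot m hm A := by
    rw [eq_bot_iff]
    rintro _ ⟨z, rfl⟩
    have h : deviation M.F A Finset.univ (M.subVal R _ z) ∈ crossEffect M.F A := ⟨_, rfl⟩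
    rw [M.crossEffect_eq_bot m hm, AddSubgroup.mem_bot] at h
    exact M.subVal_injective R _ ((M.subVal_deviation R A _ z).trans h)

variable {M R}

theorem subVal_mem_of_mem_crossZ {k : ℕ} {z : ((M.subFunctor R).obj (FreeAb.pow k)).obj}
    (hz : z ∈ crossZ (M.subFunctor R) k) : M.subVal R _ z ∈ R k := by
  have h : dev M.F Finset.univ (mapHom M.F (𝟙 (FreeAb.pow k)) (M.subVal R _ z)) ∈ R k := z.2 k (𝟙 _)
  rw [mapHom_id, AddMonoidHom.id_apply, ← subVal_dev, (mem_crossZ_iff _).1 hz] at h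
  exact h

theorem mem_stableSub_of_mem (hR : IsStableFamily M.F R) {k : ℕ} {x} (hx : x ∈ R k) :
    x ∈ stableSub M.F R (FreeAb.pow k) := by
  have h := hR.mapHom_mem_stableSub (𝟙 (FreeAb.pow k)) hx
  rwa [mapHom_id] at h

theorem mem_crossZ_of_subVal_mem (hR : IsStableFamily M.F R) {k : ℕ}
    {z : ((M.subFunctor R).obj (FreeAb.pow k)).obj} (hz : M.subVal R _ z ∈ R k) :
    z ∈ crossZ (M.subFunctor R) k :=
  (mem_crossZ_iff _).2 (M.subVal_injective R _
    ((M.subVal_dev R _ z).trans ((mem_crossZ_iff _).1 (hR.le k hz))))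

/-- The cross-effects of the cubic submodule that belongs to a stable family. -/
def crossZSubEquiv (hR : IsStableFamily M.F R) {k : ℕ} {V : Type} [AddCommGroup V]
    (θ : V →+ (M.F.obj (FreeAb.pow k)).obj) (hθ : Function.Injective θ) (h : R k = θ.range) :
    V ≃+ crossZ (M.subFunctor R) k :=
  AddEquiv.ofBijective
    ((θ.codRestrict (stableSub M.F R (FreeAb.pow k))
      fun x => mem_stableSub_of_mem hR (h ▸ ⟨x, rfl⟩)).codRestrict
      (crossZ (M.subFunctor R) k)
      fun x => mem_crossZ_of_subVal_mem hR (show θ x ∈ R k from h ▸ ⟨x, rfl⟩))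
    ⟨fun x y hxy => hθ (congrArg (fun z : crossZ (M.subFunctor R) k => M.subVal R _ z.1) hxy),
      fun z => by
        have hz := subVal_mem_of_mem_crossZ z.2
        rw [h] at hz
        obtain ⟨x, hx⟩ := hz
        exact ⟨x, Subtype.ext (M.subVal_injective R _ hx)⟩⟩

/-- A diagram that is embedded into the cross-effects of a cubic module is the diagram of a cubic
module. -/
theorem exists_isomorphic_diagram (M : TorsionFreeCubicModule) (D : CubicDiagram ℤ)
    (θ₁ : D.V₁ →+ (M.F.obj (FreeAb.pow 1)).obj) (θ₂ : D.V₂ →+ (M.F.obj (FreeAb.pow 2)).obj)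
    (θ₃ : D.V₃ →+ (M.F.obj (FreeAb.pow 3)).obj)
    (i₁ : Function.Injective θ₁) (i₂ : Function.Injective θ₂) (i₃ : Function.Injective θ₃)
    (m₁ : ∀ x, θ₁ x ∈ crossZ M.F 1) (m₂ : ∀ x, θ₂ x ∈ crossZ M.F 2)
    (m₃ : ∀ x, θ₃ x ∈ crossZ M.F 3)
    (h : ∀ x, θ₂ (D.h x) = crossDown M.F (![0, 0] : Fin 2 → Fin 1) (θ₁ x))
    (p : ∀ x, θ₁ (D.p x) = crossUp M.F (![0, 0] : Fin 2 → Fin 1) (θ₂ x))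
    (h₁ : ∀ x, θ₃ (D.h₁ x) = crossDown M.F (![0, 0, 1] : Fin 3 → Fin 2) (θ₂ x))
    (h₂ : ∀ x, θ₃ (D.h₂ x) = crossDown M.F (![0, 1, 1] : Fin 3 → Fin 2) (θ₂ x))
    (p₁ : ∀ x, θ₂ (D.p₁ x) = crossUp M.F (![0, 0, 1] : Fin 3 → Fin 2) (θ₃ x))
    (p₂ : ∀ x, θ₂ (D.p₂ x) = crossUp M.F (![0, 1, 1] : Fin 3 → Fin 2) (θ₃ x)) :
    ∃ N : TorsionFreeCubicModule, D.Isomorphic N.diagram := by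
  -- The images of the three embeddings form a stable family, and the subfunctor that belongs to it
  -- has exactly these cross-effects.
  let R : ∀ k, AddSubgroup (M.F.obj (FreeAb.pow k)).obj
    | 1 => θ₁.range
    | 2 => θ₂.range
    | 3 => θ₃.range
    | _ => ⊥
  have hR : IsStableFamily M.F R := by
    refine ⟨?_, ?_, ?_, ?_, ?_, ?_, ?_⟩
    · rintro (_ | _ | _ | _ | k)
      · exact bot_le
      · rintro _ ⟨x, rfl⟩
        exact m₁ x
      · rintro _ ⟨x, rfl⟩
        exact m₂ x
      · rintro _ ⟨x, rfl⟩
        exact m₃ x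
      · exact bot_le
    · rintro _ ⟨x, rfl⟩
      exact ⟨_, h x⟩
    · rintro _ ⟨x, rfl⟩
      exact ⟨_, p x⟩
    · rintro _ ⟨x, rfl⟩
      exact ⟨_, h₁ x⟩
    · rintro _ ⟨x, rfl⟩
      exact ⟨_, h₂ x⟩
    · rintro _ ⟨x, rfl⟩
      exact ⟨_, p₁ x⟩
    · rintro _ ⟨x, rfl⟩
      exact ⟨_, p₂ x⟩
  let e₁ : D.V₁ ≃+ crossZ (M.subFunctor R) 1 := crossZSubEquiv hR θ₁ i₁ rfl
  let e₂ : D.V₂ ≃+ crossZ (M.subFunctor R) 2 := crossZSubEquiv hR θ₂ i₂ rfl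
  let e₃ : D.V₃ ≃+ crossZ (M.subFunctor R) 3 := crossZSubEquiv hR θ₃ i₃ rfl
  refine ⟨M.sub R, CubicDiagram.isomorphic_of_addEquiv (E := (M.sub R).diagram) e₁ e₂ e₃
    ?_ ?_ ?_ ?_ ?_ ?_⟩
  · refine fun x => Subtype.ext (M.subVal_injective R _ ?_)
    refine (h x).trans (Eq.trans ?_ (congrArg _ (coe_structH₀ _ (e₁ x)).symm))
    rw [subVal_crossDown]
    rfl
  · refine fun x => Subtype.ext (M.subVal_injective R _ ?_)
    refine (p x).trans (Eq.trans ?_ (congrArg _ (coe_structP₀ _ (e₂ x)).symm))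
    rw [subVal_crossUp]
    rfl
  · refine fun x => Subtype.ext (M.subVal_injective R _ ?_)
    refine (h₁ x).trans (Eq.trans ?_ (congrArg _ (coe_structH₁ _ (e₂ x)).symm))
    rw [subVal_crossDown]
    rfl
  · refine fun x => Subtype.ext (M.subVal_injective R _ ?_)
    refine (h₂ x).trans (Eq.trans ?_ (congrArg _ (coe_structH₂ _ (e₂ x)).symm))
    rw [subVal_crossDown]
    rfl
  · refine fun x => Subtype.ext (M.subVal_injective R _ ?_)
    refine (p₁ x).trans (Eq.trans ?_ (congrArg _ (coe_structP₁ _ (e₃ x)).symm))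
    rw [subVal_crossUp]
    rfl
  · refine fun x => Subtype.ext (M.subVal_injective R _ ?_)
    refine (p₂ x).trans (Eq.trans ?_ (congrArg _ (coe_structP₂ _ (e₃ x)).symm))
    rw [subVal_crossUp]
    rfl

end TorsionFreeCubicModule
end

/-! ### Realization of every torsion free `𝐀`-module by a subfunctor of a sum of tensor powers with
coefficients. -/

noncomputable section

/-! ### Tensor powers with coefficients, as groups of multilinear maps on dual groups -/

theorem finite_free_int {V : Type} [AddCommGroup V] {i : Module ℤ V} (hV : Module.Finite ℤ V)
    (hV' : Module.Free ℤ V) : @Module.Finite ℤ V _ _ (AddCommGroup.toIntModule V) ∧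
      @Module.Free ℤ V _ _ (AddCommGroup.toIntModule V) := by
  obtain rfl : i = AddCommGroup.toIntModule V := Subsingleton.elim _ _
  exact ⟨hV, hV'⟩

/-- The `d`-linear maps from the dual of `X` to `V`. -/
abbrev DualMap (d : ℕ) (V : Type) [AddCommGroup V] (X : FreeAb) : Type :=
  MultilinearMap ℤ (fun _ : Fin d => X.obj →ₗ[ℤ] ℤ) V

section

variable (d : ℕ) (V : Type) [AddCommGroup V] [Module.Finite ℤ V] [Module.Free ℤ V]

/-- The functor of `d`-linear maps from the dual group to `V`. -/
def dualMapFunctor : FreeAb ⥤ FreeAb where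
  obj X := ⟨AddCommGrpCat.of (DualMap d V X),
    finite_free_int (inferInstance : Module.Finite ℤ (DualMap d V X))
      (inferInstance : Module.Free ℤ (DualMap d V X))⟩
  map {X Y} f := ObjectProperty.homMk (AddCommGrpCat.ofHom
    { toFun := fun g : DualMap d V X =>
        (g.compLinearMap fun _ => LinearMap.lcomp ℤ ℤ f.hom.hom.toIntLinearMap : DualMap d V Y)
      map_zero' := rfl
      map_add' := fun _ _ => rfl })
  map_id _ := rfl
  map_comp _ _ := rfl

variable {d V}

/-- The value of an element of the functor. -/
def dualEval {X : FreeAb} (g : ((dualMapFunctor d V).obj X).obj)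
    (v : Fin d → (X.obj →ₗ[ℤ] ℤ)) : V :=
  (show DualMap d V X from g) v

theorem dualEval_mapHom {X Y : FreeAb} (f : X ⟶ Y) (g) (v : Fin d → (Y.obj →ₗ[ℤ] ℤ)) :
    dualEval (mapHom (dualMapFunctor d V) f g) v =
      dualEval g fun j => v j ∘ₗ f.hom.hom.toIntLinearMap := rfl

theorem dualEval_add {X : FreeAb} (f g : ((dualMapFunctor d V).obj X).obj)
    (v : Fin d → (X.obj →ₗ[ℤ] ℤ)) : dualEval (f + g) v = dualEval f v + dualEval g v := rfl

theorem dualEval_sum {X : FreeAb} {ι : Type} (s : Finset ι)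
    (f : ι → ((dualMapFunctor d V).obj X).obj) (v : Fin d → (X.obj →ₗ[ℤ] ℤ)) :
    dualEval (∑ i ∈ s, f i) v = ∑ i ∈ s, dualEval (f i) v :=
  map_sum (AddMonoidHom.mk' (fun f : ((dualMapFunctor d V).obj X).obj => dualEval f v)
    fun f g => dualEval_add f g v) f s

/-- The coordinate function of a summand of a direct sum. -/
def summand {m : ℕ} {A : Fin m → FreeAb} (v : (FreeAb.sum A).obj →ₗ[ℤ] ℤ) (i : Fin m) :
    (FreeAb.sum A).obj →ₗ[ℤ] ℤ :=
  v ∘ₗ (FreeAb.idem A {i}).hom.hom.toIntLinearMap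

theorem comp_idem {m : ℕ} {A : Fin m → FreeAb} (v : (FreeAb.sum A).obj →ₗ[ℤ] ℤ)
    (S : Finset (Fin m)) :
    v ∘ₗ (FreeAb.idem A S).hom.hom.toIntLinearMap = ∑ i ∈ S, summand v i := by
  have h (x : ∀ i, (A i).obj) : (show ∀ i, (A i).obj from (FreeAb.idem A S).hom.hom x) =
      ∑ i ∈ S, (show ∀ i, (A i).obj from (FreeAb.idem A {i}).hom.hom x) := by
    funext j
    rw [Finset.sum_apply]
    change (if j ∈ S then x j else 0) = ∑ i ∈ S, if j ∈ ({i} : Finset (Fin m)) then x j else 0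
    simp
  refine LinearMap.ext fun x => ?_
  rw [LinearMap.sum_apply]
  exact (congrArg v (h x)).trans (map_sum v _ _)

/-- Multilinear expansion of `F(e_S)` runs over the index maps `r` with values in `S`. Grouping them
by their image solves the recursion for the deviations. In particular the deviation is zero if `S`
has more than `d` elements. -/
theorem dualEval_deviation {m : ℕ} (A : Fin m → FreeAb) (S : Finset (Fin m)) (g)
    (v : Fin d → ((FreeAb.sum A).obj →ₗ[ℤ] ℤ)) :
    dualEval (deviation (dualMapFunctor d V) A S g) v =
      ∑ r : Fin d → Fin m with Finset.univ.image r = S,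
        dualEval g fun j => summand (v j) (r j) := by
  induction S using Finset.strongInduction with
  | H S ih =>
    have h := congrArg (fun f => dualEval (f g) v) (sum_deviation (dualMapFunctor d V) A S)
    simp only [AddMonoidHom.finsetSum_apply, dualEval_sum, dualEval_mapHom, comp_idem] at h
    have h' : dualEval g (fun j => ∑ i ∈ S, summand (v j) i) =
        ∑ r ∈ Fintype.piFinset fun _ : Fin d => S, dualEval g fun j => summand (v j) (r j) :=
      MultilinearMap.map_sum_finset (show DualMap d V (FreeAb.sum A) from g) _ _
    have h'' : ∑ r ∈ Fintype.piFinset fun _ : Fin d => S,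
        dualEval g (fun j => summand (v j) (r j)) =
        ∑ T ∈ S.powerset, ∑ r : Fin d → Fin m with Finset.univ.image r = T,
          dualEval g fun j => summand (v j) (r j) := by
      rw [← Finset.sum_fiberwise_of_maps_to (t := S.powerset)
        (g := fun r : Fin d → Fin m => Finset.univ.image r)]
      · refine Finset.sum_congr rfl fun T hT => Finset.sum_congr ?_ fun _ _ => rfl
        ext r
        simp only [Finset.mem_filter, Fintype.mem_piFinset, Finset.mem_univ, true_and,
          and_iff_right_iff_imp]
        rintro rfl j
        exact Finset.mem_powerset.1 hT (Finset.mem_image_of_mem r (Finset.mem_univ j))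
      · intro r hr
        rw [Finset.mem_powerset, Finset.image_subset_iff]
        exact fun j _ => Fintype.mem_piFinset.1 hr j
    rw [h', h'', ← Finset.add_sum_erase _ _ (Finset.mem_powerset_self S),
      ← Finset.add_sum_erase _ _ (Finset.mem_powerset_self S),
      Finset.sum_congr rfl fun T (hT : T ∈ S.powerset.erase S) =>
        ih T (Finset.mem_ssubsets.1 hT)] at h
    exact add_right_cancel h

variable (V) in
/-- The cubic module of `d`-linear maps from the dual group to `V`. -/
def dualMapModule (hd : 0 < d) (hd' : d ≤ 3) : TorsionFreeCubicModule where
  F := dualMapFunctor d V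
  map_zero X Y := by
    refine ObjectProperty.hom_ext _ (AddCommGrpCat.hom_ext (AddMonoidHom.ext fun g => ?_))
    refine MultilinearMap.ext (f := (show DualMap d V Y from
      mapHom (dualMapFunctor d V) (0 : X ⟶ Y) g)) (f' := 0) fun v => ?_
    exact (show DualMap d V X from g).map_coord_zero (m := fun j => v j ∘ₗ
      (0 : X ⟶ Y).hom.hom.toIntLinearMap) ⟨0, hd⟩ (LinearMap.ext fun x => map_zero (v ⟨0, hd⟩))
  crossEffect_eq_bot m hm A := by
    rw [eq_bot_iff]
    rintro _ ⟨g, rfl⟩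
    -- No map from `d ≤ 3` indices is onto `m > 3` summands, so the expansion of the deviation is
    -- empty.
    refine MultilinearMap.ext (f := (show DualMap d V (FreeAb.sum A) from
      deviation (dualMapFunctor d V) A Finset.univ g)) (f' := 0) fun v => ?_
    refine (dualEval_deviation A Finset.univ g v).trans (Finset.sum_eq_zero fun r hr => ?_)
    have h := Finset.card_image_le (s := (Finset.univ : Finset (Fin d))) (f := r)
    rw [(Finset.mem_filter.1 hr).2, Finset.card_univ, Finset.card_univ, Fintype.card_fin,
      Fintype.card_fin] at h
    omega

/-! ### Coordinates -/

/-- The projections of `ℤ ^ k`. -/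
def powProj {k : ℕ} (i : Fin k) : (FreeAb.pow k).obj →ₗ[ℤ] ℤ :=
  (show (Fin k → ℤ) →+ ℤ from Pi.evalAddMonoidHom (fun _ => ℤ) i).toIntLinearMap

/-- The standard basis of `ℤ ^ k`. -/
def powBasis {k : ℕ} (i : Fin k) : (FreeAb.pow k).obj :=
  show Fin k → ℤ from Pi.single i 1

theorem powProj_powBasis {k : ℕ} (i j : Fin k) : powProj i (powBasis j) = if i = j then 1 else 0 :=
  Pi.single_apply j (1 : ℤ) i

theorem eq_sum_powProj {k : ℕ} (v : (FreeAb.pow k).obj →ₗ[ℤ] ℤ) :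
    v = ∑ i, v (powBasis i) • powProj i := by
  refine LinearMap.ext fun x => ?_
  have hx : x = ∑ i, powProj i x • powBasis i := by
    have h : (show Fin k → ℤ from x) = ∑ i, (show Fin k → ℤ from x) i • Pi.single i (1 : ℤ) := by
      rw [← pi_eq_sum_univ']
    exact h
  conv_lhs => rw [hx]
  rw [map_sum, LinearMap.sum_apply]
  refine Finset.sum_congr rfl fun i _ => ?_
  rw [map_smul, LinearMap.smul_apply, smul_eq_mul, smul_eq_mul, mul_comm]

/-- The coordinates of a multilinear map on the dual of `ℤ ^ k`. -/
def coord {k : ℕ} (g : ((dualMapFunctor d V).obj (FreeAb.pow k)).obj) (r : Fin d → Fin k) : V :=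
  dualEval g fun j => powProj (r j)

theorem dualEval_eq_sum {k : ℕ} (g : ((dualMapFunctor d V).obj (FreeAb.pow k)).obj)
    (v : Fin d → ((FreeAb.pow k).obj →ₗ[ℤ] ℤ)) :
    dualEval g v = ∑ r : Fin d → Fin k, (∏ j, v j (powBasis (r j))) • coord g r := by
  conv_lhs => rw [funext fun j => eq_sum_powProj (v j)]
  refine ((show DualMap d V (FreeAb.pow k) from g).map_sum _).trans
    (Finset.sum_congr rfl fun r _ => ?_)
  exact (show DualMap d V (FreeAb.pow k) from g).map_smul_univ _ _

theorem coord_ext {k : ℕ} {f g : ((dualMapFunctor d V).obj (FreeAb.pow k)).obj}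
    (h : ∀ r, coord f r = coord g r) : f = g := by
  refine MultilinearMap.ext (f := (show DualMap d V (FreeAb.pow k) from f))
    (f' := (show DualMap d V (FreeAb.pow k) from g)) fun v => ?_
  refine (dualEval_eq_sum f v).trans (Eq.trans ?_ (dualEval_eq_sum g v).symm)
  simp only [h]

/-- The multilinear map with given coordinates. -/
def ofCoord {k : ℕ} : ((Fin d → Fin k) → V) →+ ((dualMapFunctor d V).obj (FreeAb.pow k)).obj :=
  show ((Fin d → Fin k) → V) →+ DualMap d V (FreeAb.pow k) from
  { toFun := fun c => ∑ r : Fin d → Fin k, ((MultilinearMap.mkPiAlgebra ℤ (Fin d) ℤ).compLinearMap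
      fun j => LinearMap.applyₗ (powBasis (r j))).smulRight (c r)
    map_zero' := by
      ext v
      simp
    map_add' := fun c c' => by
      ext v
      simp [Finset.sum_add_distrib] }

theorem coord_ofCoord {k : ℕ} (c : (Fin d → Fin k) → V) (r : Fin d → Fin k) :
    coord (ofCoord c) r = c r := by
  have h : coord (ofCoord c) r =
      ∑ s : Fin d → Fin k, (∏ j, powProj (r j) (powBasis (s j))) • c s := by
    change (∑ s : Fin d → Fin k, ((MultilinearMap.mkPiAlgebra ℤ (Fin d) ℤ).compLinearMap
      fun j => LinearMap.applyₗ (powBasis (s j))).smulRight (c s)) _ = _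
    simp
  rw [h, Finset.sum_eq_single r]
  · simp [powProj_powBasis]
  · intro s _ hs
    obtain ⟨j, hj⟩ := Function.ne_iff.1 hs
    rw [Finset.prod_eq_zero (Finset.mem_univ j), zero_smul]
    rw [powProj_powBasis, if_neg (Ne.symm hj)]
  · simp

theorem coord_dev {k : ℕ} (g : ((dualMapFunctor d V).obj (FreeAb.pow k)).obj)
    (S : Finset (Fin k)) (r : Fin d → Fin k) :
    coord (dev (dualMapFunctor d V) S g) r =
      if Finset.univ.image r = S then coord g r else 0 := by
  refine (dualEval_deviation _ S g _).trans ?_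
  have h (i j : Fin k) : summand (A := fun _ : Fin k => FreeAb.int) (powProj i) j =
      if j = i then powProj i else 0 := by
    have h (y : Fin k → ℤ) : (if i ∈ ({j} : Finset (Fin k)) then y i else 0) =
        if j = i then y i else 0 := by
      simp only [Finset.mem_singleton, eq_comm]
    by_cases hij : j = i
    · rw [if_pos hij]
      exact LinearMap.ext fun x => (h x).trans (if_pos hij)
    · rw [if_neg hij]
      exact LinearMap.ext fun x => (h x).trans (if_neg hij)
  rw [Finset.sum_filter, Finset.sum_eq_single r]
  · simp only [h, if_true]
    rfl
  · intro s _ hs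
    obtain ⟨j, hj⟩ := Function.ne_iff.1 hs
    rw [ite_eq_right_iff]
    intro _
    refine (show DualMap d V (FreeAb.pow k) from g).map_coord_zero j ?_
    rw [h, if_neg hj]
  · simp

theorem coord_crossDown {k l : ℕ} (b : Fin l → Fin k)
    (g : ((dualMapFunctor d V).obj (FreeAb.pow k)).obj) (r : Fin d → Fin l) :
    coord (crossDown (dualMapFunctor d V) b g) r =
      if Finset.univ.image r = Finset.univ then coord g (b ∘ r) else 0 :=
  coord_dev _ _ r

theorem coord_crossUp {k l : ℕ} (a : Fin k → Fin l)
    (g : ((dualMapFunctor d V).obj (FreeAb.pow k)).obj) (r : Fin d → Fin l) :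
    coord (crossUp (dualMapFunctor d V) a g) r =
      if Finset.univ.image r = Finset.univ then
        ∑ s : Fin d → Fin k with a ∘ s = r, coord g s else 0 := by
  refine (coord_dev _ _ r).trans (if_congr Iff.rfl ?_ rfl)
  have h : coord (act (dualMapFunctor d V) (upHom a) g) r =
      dualEval g fun j => ∑ i with a i = r j, powProj i := by
    refine congrArg (dualEval g) (funext fun j => LinearMap.ext fun x => ?_)
    rw [LinearMap.sum_apply]
    rfl
  rw [h]
  refine ((show DualMap d V (FreeAb.pow k) from g).map_sum_finset _ _).trans
    (Finset.sum_congr ?_ fun _ _ => rfl)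
  ext s
  simp [Fintype.mem_piFinset, funext_iff]

end

end

noncomputable section

/-! ### The cubic module of linear, bilinear and trilinear maps on dual groups -/

theorem image_univ_eq_univ_iff {d k : ℕ} {r : Fin d → Fin k} :
    Finset.univ.image r = Finset.univ ↔ ∀ y, ∃ j, y = r j := by
  simp [Finset.ext_iff, eq_comm]

theorem sum_fin_three {k : ℕ} {V : Type} [AddCommMonoid V] (f : (Fin 3 → Fin k) → V) :
    ∑ s, f s = ∑ i, ∑ j, ∑ l, f ![i, j, l] := by
  let e : Fin k × Fin k × Fin k ≃ (Fin 3 → Fin k) :=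
    ⟨fun x => ![x.1, x.2.1, x.2.2], fun s => (s 0, s 1, s 2), fun _ => rfl, fun s => by
      ext j
      fin_cases j <;> rfl⟩
  rw [← e.sum_comp, Fintype.sum_prod_type]
  exact Finset.sum_congr rfl fun i _ => Fintype.sum_prod_type _

theorem sum_fin_two {k : ℕ} {V : Type} [AddCommMonoid V] (f : (Fin 2 → Fin k) → V) :
    ∑ s, f s = ∑ i, ∑ j, f ![i, j] := by
  rw [← (finTwoArrowEquiv (Fin k)).symm.sum_comp, Fintype.sum_prod_type]
  rfl

theorem sum_fin_one {k : ℕ} {V : Type} [AddCommMonoid V] (f : (Fin 1 → Fin k) → V) :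
    ∑ s, f s = ∑ i, f ![i] := by
  rw [← (Equiv.funUnique (Fin 1) (Fin k)).symm.sum_comp]
  refine Finset.sum_congr rfl fun i _ => congrArg f (funext fun j => ?_)
  fin_cases j
  rfl

namespace TorsionFreeCubicModule

variable {V₁ V₂ V₃ : Type} [AddCommGroup V₁] [AddCommGroup V₂] [AddCommGroup V₃]
  [Module.Finite ℤ V₁] [Module.Finite ℤ V₂] [Module.Finite ℤ V₃]
  [Module.Free ℤ V₁] [Module.Free ℤ V₂] [Module.Free ℤ V₃]

variable (V₁ V₂ V₃) in
/-- The cubic module of linear, bilinear and trilinear maps on dual groups. -/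
def ofMultilinear : TorsionFreeCubicModule :=
  (dualMapModule (d := 1) V₁ (by omega) (by omega)).prod
    ((dualMapModule (d := 2) V₂ (by omega) (by omega)).prod
      (dualMapModule (d := 3) V₃ (by omega) (by omega)))

/-- The element of the cubic module with given coordinates. -/
def ofCoords {k : ℕ} (c₁ : Fin k → V₁) (c₂ : Fin k → Fin k → V₂) (c₃ : Fin k → Fin k → Fin k → V₃) :
    ((ofMultilinear V₁ V₂ V₃).F.obj (FreeAb.pow k)).obj :=
  show ((dualMapFunctor 1 V₁).obj (FreeAb.pow k)).obj ×
    ((dualMapFunctor 2 V₂).obj (FreeAb.pow k)).obj × ((dualMapFunctor 3 V₃).obj (FreeAb.pow k)).obj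
    from (ofCoord fun r => c₁ (r 0), ofCoord fun r => c₂ (r 0) (r 1),
      ofCoord fun r => c₃ (r 0) (r 1) (r 2))

section

variable {k l : ℕ} {c₁ c₁' : Fin k → V₁} {c₂ c₂' : Fin k → Fin k → V₂}
  {c₃ c₃' : Fin k → Fin k → Fin k → V₃}

theorem ofCoords_add : ofCoords (c₁ + c₁') (c₂ + c₂') (c₃ + c₃') =
    ofCoords c₁ c₂ c₃ + ofCoords c₁' c₂' c₃' :=
  Prod.ext (ofCoord.map_add (fun r => c₁ (r 0)) fun r => c₁' (r 0))
    (Prod.ext (ofCoord.map_add (fun r => c₂ (r 0) (r 1)) fun r => c₂' (r 0) (r 1))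
      (ofCoord.map_add (fun r => c₃ (r 0) (r 1) (r 2)) fun r => c₃' (r 0) (r 1) (r 2)))

theorem eq_zero_of_ofCoords_eq_zero (h : ofCoords c₁ c₂ c₃ = 0) :
    (∀ i, c₁ i = 0) ∧ (∀ i j, c₂ i j = 0) ∧ ∀ i j l, c₃ i j l = 0 := by
  have h₁ := congrArg Prod.fst h
  have h₂ := congrArg (fun z => z.2.1) h
  have h₃ := congrArg (fun z => z.2.2) h
  exact ⟨fun i => (coord_ofCoord (fun r => c₁ (r 0)) ![i]).symm.trans
      (congrArg (fun g => coord g ![i]) h₁),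
    fun i j => (coord_ofCoord (fun r => c₂ (r 0) (r 1)) ![i, j]).symm.trans
      (congrArg (fun g => coord g ![i, j]) h₂),
    fun i j l => (coord_ofCoord (fun r => c₃ (r 0) (r 1) (r 2)) ![i, j, l]).symm.trans
      (congrArg (fun g => coord g ![i, j, l]) h₃)⟩

/-- The surjectivity of an index map is spelled out as a condition on its at most three values, so
that the hypotheses become finite case checks for concrete `b`. -/
theorem crossDown_ofCoords {b : Fin l → Fin k} {e₁ : Fin l → V₁} {e₂ : Fin l → Fin l → V₂}
    {e₃ : Fin l → Fin l → Fin l → V₃}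
    (h₁ : ∀ i, e₁ i = if ∀ y, y = i then c₁ (b i) else 0)
    (h₂ : ∀ i j, e₂ i j = if ∀ y, y = i ∨ y = j then c₂ (b i) (b j) else 0)
    (h₃ : ∀ i j l, e₃ i j l = if ∀ y, y = i ∨ y = j ∨ y = l then c₃ (b i) (b j) (b l) else 0) :
    ofCoords e₁ e₂ e₃ = crossDown (ofMultilinear V₁ V₂ V₃).F b (ofCoords c₁ c₂ c₃) := by
  refine Eq.trans ?_ (crossDown_prod _ _).symm
  refine Prod.ext (coord_ext fun r => ?_) (Eq.trans ?_ (crossDown_prod _ _).symm)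
  · refine Eq.trans ?_ (coord_crossDown b _ r).symm
    refine (coord_ofCoord (fun r => e₁ (r 0)) r).trans ((h₁ _).trans ?_)
    refine if_congr ?_ (coord_ofCoord (fun r => c₁ (r 0)) (b ∘ r)).symm rfl
    rw [image_univ_eq_univ_iff]
    simp [Fin.exists_fin_succ]
  · refine Prod.ext (coord_ext fun r => ?_) (coord_ext fun r => ?_)
    · refine Eq.trans ?_ (coord_crossDown b _ r).symm
      refine (coord_ofCoord (fun r => e₂ (r 0) (r 1)) r).trans ((h₂ _ _).trans ?_)
      refine if_congr ?_ (coord_ofCoord (fun r => c₂ (r 0) (r 1)) (b ∘ r)).symm rfl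
      rw [image_univ_eq_univ_iff]
      simp [Fin.exists_fin_succ]
    · refine Eq.trans ?_ (coord_crossDown b _ r).symm
      refine (coord_ofCoord (fun r => e₃ (r 0) (r 1) (r 2)) r).trans ((h₃ _ _ _).trans ?_)
      refine if_congr ?_ (coord_ofCoord (fun r => c₃ (r 0) (r 1) (r 2)) (b ∘ r)).symm rfl
      rw [image_univ_eq_univ_iff]
      simp [Fin.exists_fin_succ]

theorem crossUp_ofCoords {a : Fin k → Fin l} {e₁ : Fin l → V₁} {e₂ : Fin l → Fin l → V₂}
    {e₃ : Fin l → Fin l → Fin l → V₃}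
    (h₁ : ∀ i, e₁ i = if ∀ y, y = i then ∑ i', if a i' = i then c₁ i' else 0 else 0)
    (h₂ : ∀ i j, e₂ i j = if ∀ y, y = i ∨ y = j then
      ∑ i', ∑ j', if a i' = i ∧ a j' = j then c₂ i' j' else 0 else 0)
    (h₃ : ∀ i j l, e₃ i j l = if ∀ y, y = i ∨ y = j ∨ y = l then
      ∑ i', ∑ j', ∑ l', if a i' = i ∧ a j' = j ∧ a l' = l then c₃ i' j' l' else 0 else 0) :
    ofCoords e₁ e₂ e₃ = crossUp (ofMultilinear V₁ V₂ V₃).F a (ofCoords c₁ c₂ c₃) := by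
  refine Eq.trans ?_ (crossUp_prod _ _).symm
  refine Prod.ext (coord_ext fun r => ?_) (Eq.trans ?_ (crossUp_prod _ _).symm)
  · refine Eq.trans ?_ (coord_crossUp a _ r).symm
    refine (coord_ofCoord (fun r => e₁ (r 0)) r).trans ((h₁ _).trans ?_)
    refine if_congr ?_ ?_ rfl
    · rw [image_univ_eq_univ_iff]
      simp [Fin.exists_fin_succ]
    · rw [Finset.sum_filter, sum_fin_one]
      refine Finset.sum_congr rfl fun i _ =>
        if_congr ?_ (coord_ofCoord (fun r => c₁ (r 0)) ![i]).symm rfl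
      simp [funext_iff, Fin.forall_fin_succ]
  · refine Prod.ext (coord_ext fun r => ?_) (coord_ext fun r => ?_)
    · refine Eq.trans ?_ (coord_crossUp a _ r).symm
      refine (coord_ofCoord (fun r => e₂ (r 0) (r 1)) r).trans ((h₂ _ _).trans ?_)
      refine if_congr ?_ ?_ rfl
      · rw [image_univ_eq_univ_iff]
        simp [Fin.exists_fin_succ]
      · rw [Finset.sum_filter, sum_fin_two]
        refine Finset.sum_congr rfl fun i _ => Finset.sum_congr rfl fun j _ =>
          if_congr ?_ (coord_ofCoord (fun r => c₂ (r 0) (r 1)) ![i, j]).symm rfl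
        simp [funext_iff, Fin.forall_fin_succ]
    · refine Eq.trans ?_ (coord_crossUp a _ r).symm
      refine (coord_ofCoord (fun r => e₃ (r 0) (r 1) (r 2)) r).trans ((h₃ _ _ _).trans ?_)
      refine if_congr ?_ ?_ rfl
      · rw [image_univ_eq_univ_iff]
        simp [Fin.exists_fin_succ]
      · rw [Finset.sum_filter, sum_fin_three]
        refine Finset.sum_congr rfl fun i _ => Finset.sum_congr rfl fun j _ =>
          Finset.sum_congr rfl fun l _ => if_congr ?_
            (coord_ofCoord (fun r => c₃ (r 0) (r 1) (r 2)) ![i, j, l]).symm rfl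
        simp [funext_iff, Fin.forall_fin_succ]

theorem ofCoords_mem_crossZ (h₁ : ∀ i, ¬ (∀ y, y = i) → c₁ i = 0)
    (h₂ : ∀ i j, ¬ (∀ y, y = i ∨ y = j) → c₂ i j = 0)
    (h₃ : ∀ i j l, ¬ (∀ y, y = i ∨ y = j ∨ y = l) → c₃ i j l = 0) :
    ofCoords c₁ c₂ c₃ ∈ crossZ (ofMultilinear V₁ V₂ V₃).F k := by
  rw [crossDown_ofCoords (c₁ := c₁) (c₂ := c₂) (c₃ := c₃) (b := id)]
  · exact crossDown_mem _ _
  · intro i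
    split_ifs with h
    exacts [rfl, h₁ i h]
  · intro i j
    split_ifs with h
    exacts [rfl, h₂ i j h]
  · intro i j l
    split_ifs with h
    exacts [rfl, h₃ i j l h]

end

end TorsionFreeCubicModule
end

noncomputable section

/-! ### Realization of diagrams by cubic modules -/

namespace CubicDiagram

section

variable {R : Type} [CommRing R] (D : CubicDiagram R)

/-- The coordinate of the linear part of an element of `D.V₁`. -/
def coord₁₁ (x : D.V₁) : Fin 1 → D.V₁ := fun _ => D.lin x

/-- The coordinate of the bilinear part of an element of `D.V₁`. -/
def coord₁₂ (x : D.V₁) : Fin 1 → Fin 1 → D.V₂ := fun _ _ => D.bil (D.h x)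

/-- The coordinate of the trilinear part of an element of `D.V₁`. -/
def coord₁₃ (x : D.V₁) : Fin 1 → Fin 1 → Fin 1 → D.V₃ := fun _ _ _ => D.h₁ (D.h x)

/-- The coordinates of the bilinear part of an element of `D.V₂`. -/
def coord₂₂ (x : D.V₂) : Fin 2 → Fin 2 → D.V₂ :=
  ![![0, D.bil x], ![D.bil (D.h (D.p x)) - D.bil x, 0]]

/-- The coordinates of the trilinear part of an element of `D.V₂`. -/
def coord₂₃ (x : D.V₂) : Fin 2 → Fin 2 → Fin 2 → D.V₃ :=
  ![![![0, D.h₁ x], ![D.t₂ (D.h₁ x), D.h₂ x]],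
    ![![D.t₁ (D.t₂ (D.h₁ x)), D.t₁ (D.h₂ x)], ![D.t₂ (D.t₁ (D.h₂ x)), 0]]]

/-- The coordinates of an element of `D.V₃`. -/
def coord₃₃ (x : D.V₃) : Fin 3 → Fin 3 → Fin 3 → D.V₃ :=
  ![![![0, 0, 0], ![0, 0, x], ![0, D.t₂ x, 0]],
    ![![0, 0, D.t₁ x], ![0, 0, 0], ![D.t₂ (D.t₁ x), 0, 0]],
    ![![0, D.t₁ (D.t₂ x), 0], ![D.t₁ (D.t₂ (D.t₁ x)), 0, 0], ![0, 0, 0]]]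

theorem coord₁₁_add (x y : D.V₁) : D.coord₁₁ (x + y) = D.coord₁₁ x + D.coord₁₁ y :=
  funext fun _ => map_add D.lin x y

theorem coord₁₂_add (x y : D.V₁) : D.coord₁₂ (x + y) = D.coord₁₂ x + D.coord₁₂ y :=
  funext fun _ => funext fun _ => map_add (D.bil ∘ₗ D.h) x y

theorem coord₁₃_add (x y : D.V₁) : D.coord₁₃ (x + y) = D.coord₁₃ x + D.coord₁₃ y :=
  funext fun _ => funext fun _ => funext fun _ => map_add (D.h₁ ∘ₗ D.h) x y

theorem coord₂₂_add (x y : D.V₂) : D.coord₂₂ (x + y) = D.coord₂₂ x + D.coord₂₂ y := by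
  refine funext fun i => funext fun j => ?_
  revert i j
  simp [coord₂₂, Fin.forall_fin_succ]
  abel

theorem coord₂₃_add (x y : D.V₂) : D.coord₂₃ (x + y) = D.coord₂₃ x + D.coord₂₃ y := by
  refine funext fun i => funext fun j => funext fun l => ?_
  revert i j l
  simp [coord₂₃, Fin.forall_fin_succ]

theorem coord₃₃_add (x y : D.V₃) : D.coord₃₃ (x + y) = D.coord₃₃ x + D.coord₃₃ y := by
  refine funext fun i => funext fun j => funext fun l => ?_
  revert i j l
  simp [coord₃₃, Fin.forall_fin_succ]

theorem coord₂₂_eq_zero (x : D.V₂) (i j : Fin 2) : ¬ (∀ y, y = i ∨ y = j) →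
    D.coord₂₂ x i j = 0 := by
  revert i j
  simp [coord₂₂, Fin.forall_fin_succ]

theorem coord₂₃_eq_zero (x : D.V₂) (i j l : Fin 2) : ¬ (∀ y, y = i ∨ y = j ∨ y = l) →
    D.coord₂₃ x i j l = 0 := by
  revert i j l
  simp [coord₂₃, Fin.forall_fin_succ]

theorem coord₃₃_eq_zero (x : D.V₃) (i j l : Fin 3) : ¬ (∀ y, y = i ∨ y = j ∨ y = l) →
    D.coord₃₃ x i j l = 0 := by
  revert i j l
  simp [coord₃₃, Fin.forall_fin_succ]

/-- This and the lemmas below show that the coordinate families turn the structure maps of `D` into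
copying and adding of coordinates. The coordinates are translates under permutations of the
arguments: `t₁` and `t₂` generate them on the trilinear part, and `h p - 1` is the swap on the
bilinear part. -/
theorem coord₁₂_p (x : D.V₂) (i j : Fin 1) : D.coord₁₂ (D.p x) i j = if ∀ y, y = i ∨ y = j then
    ∑ i', ∑ j', if (![0, 0] : Fin 2 → Fin 1) i' = i ∧ (![0, 0] : Fin 2 → Fin 1) j' = j then
      D.coord₂₂ x i' j' else 0 else 0 := by
  obtain rfl : i = 0 := Subsingleton.elim _ _
  obtain rfl : j = 0 := Subsingleton.elim _ _
  simp [coord₁₂, coord₂₂, Fin.sum_univ_succ]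

variable [Fact D.IsAModule]

theorem coord₂₂_h (x : D.V₁) (i j : Fin 2) : D.coord₂₂ (D.h x) i j =
    if ∀ y, y = i ∨ y = j then D.coord₁₂ x ((![0, 0] : Fin 2 → Fin 1) i)
      ((![0, 0] : Fin 2 → Fin 1) j) else 0 := by
  have h : D.bil (D.h (D.p (D.h x))) - D.bil (D.h x) = D.bil (D.h x) := by
    rw [bil_h_p_h]; module
  revert i j
  simp only [coord₂₂, coord₁₂, h]
  simp [Fin.forall_fin_succ]

theorem coord₂₃_h (x : D.V₁) (i j l : Fin 2) : D.coord₂₃ (D.h x) i j l =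
    if ∀ y, y = i ∨ y = j ∨ y = l then D.coord₁₃ x ((![0, 0] : Fin 2 → Fin 1) i)
      ((![0, 0] : Fin 2 → Fin 1) j) ((![0, 0] : Fin 2 → Fin 1) l) else 0 := by
  have h : D.h₂ (D.h x) = D.h₁ (D.h x) := by simp
  revert i j l
  simp only [coord₂₃, coord₁₃, h, t₁_h₁, t₂_h₁_h]
  simp [Fin.forall_fin_succ]

theorem coord₁₃_p (x : D.V₂) (i j l : Fin 1) : D.coord₁₃ (D.p x) i j l =
    if ∀ y, y = i ∨ y = j ∨ y = l then
      ∑ i', ∑ j', ∑ l', if (![0, 0] : Fin 2 → Fin 1) i' = i ∧ (![0, 0] : Fin 2 → Fin 1) j' = j ∧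
        (![0, 0] : Fin 2 → Fin 1) l' = l then D.coord₂₃ x i' j' l' else 0 else 0 := by
  obtain rfl : i = 0 := Subsingleton.elim _ _
  obtain rfl : j = 0 := Subsingleton.elim _ _
  obtain rfl : l = 0 := Subsingleton.elim _ _
  simp only [coord₁₃, h₁_h_p_eq]
  simp [coord₂₃, Fin.sum_univ_succ]
  abel

theorem coord₃₃_h₁ (x : D.V₂) (i j l : Fin 3) : D.coord₃₃ (D.h₁ x) i j l =
    if ∀ y, y = i ∨ y = j ∨ y = l then D.coord₂₃ x ((![0, 0, 1] : Fin 3 → Fin 2) i)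
      ((![0, 0, 1] : Fin 3 → Fin 2) j) ((![0, 0, 1] : Fin 3 → Fin 2) l) else 0 := by
  revert i j l
  simp only [coord₃₃, coord₂₃, t₁_h₁]
  simp [Fin.forall_fin_succ]

theorem coord₃₃_h₂ (x : D.V₂) (i j l : Fin 3) : D.coord₃₃ (D.h₂ x) i j l =
    if ∀ y, y = i ∨ y = j ∨ y = l then D.coord₂₃ x ((![0, 1, 1] : Fin 3 → Fin 2) i)
      ((![0, 1, 1] : Fin 3 → Fin 2) j) ((![0, 1, 1] : Fin 3 → Fin 2) l) else 0 := by
  revert i j l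
  simp only [coord₃₃, coord₂₃, t₂_h₂, ← t₂_t₁_t₂]
  simp [Fin.forall_fin_succ]

theorem coord₂₂_p₁ (x : D.V₃) (i j : Fin 2) : D.coord₂₂ (D.p₁ x) i j = 0 := by
  have h : D.bil (D.h (D.p (D.p₁ x))) = 0 := by
    rw [← h_p_bil, bil_p₁, map_zero, map_zero]
  revert i j
  simp only [coord₂₂, h, bil_p₁]
  simp [Fin.forall_fin_succ]

theorem coord₂₂_p₂ (x : D.V₃) (i j : Fin 2) : D.coord₂₂ (D.p₂ x) i j = 0 := by
  have h : D.bil (D.h (D.p (D.p₂ x))) = 0 := by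
    rw [← h_p_bil, bil_p₂, map_zero, map_zero]
  revert i j
  simp only [coord₂₂, h, bil_p₂]
  simp [Fin.forall_fin_succ]

theorem coord₂₃_p₁ (x : D.V₃) (i j l : Fin 2) : D.coord₂₃ (D.p₁ x) i j l =
    if ∀ y, y = i ∨ y = j ∨ y = l then
      ∑ i', ∑ j', ∑ l', if (![0, 0, 1] : Fin 3 → Fin 2) i' = i ∧
        (![0, 0, 1] : Fin 3 → Fin 2) j' = j ∧ (![0, 0, 1] : Fin 3 → Fin 2) l' = l then
        D.coord₃₃ x i' j' l' else 0 else 0 := by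
  have h : D.h₂ (D.p₁ x) = 0 := by simp
  revert i j l
  simp only [coord₃₃, coord₂₃, h, h₁_p₁_eq]
  simp [Fin.forall_fin_succ, Fin.sum_univ_succ]

theorem coord₂₃_p₂ (x : D.V₃) (i j l : Fin 2) : D.coord₂₃ (D.p₂ x) i j l =
    if ∀ y, y = i ∨ y = j ∨ y = l then
      ∑ i', ∑ j', ∑ l', if (![0, 1, 1] : Fin 3 → Fin 2) i' = i ∧
        (![0, 1, 1] : Fin 3 → Fin 2) j' = j ∧ (![0, 1, 1] : Fin 3 → Fin 2) l' = l then
        D.coord₃₃ x i' j' l' else 0 else 0 := by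
  have h : D.h₁ (D.p₂ x) = 0 := by simp
  revert i j l
  simp only [coord₃₃, coord₂₃, h, h₂_p₂_eq]
  simp [Fin.forall_fin_succ, Fin.sum_univ_succ, t₂_t₁_t₂]

end


/-- Every torsion free `𝐀`-module is the diagram of a cubic module. -/
theorem IsTorsionFreeAModule.exists_isomorphic_diagram {D : CubicDiagram ℤ}
    (hD : D.IsTorsionFreeAModule) : ∃ M : TorsionFreeCubicModule, D.Isomorphic M.diagram := by
  have : Fact D.IsAModule := ⟨hD.isAModule⟩
  have := hD.finite₁
  have := hD.finite₂
  have := hD.finite₃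
  have := hD.torsionFree₁
  have := hD.torsionFree₂
  have := hD.torsionFree₃
  obtain ⟨f₁, g₁⟩ := finite_free_int (V := D.V₁) hD.finite₁ inferInstance
  obtain ⟨f₂, g₂⟩ := finite_free_int (V := D.V₂) hD.finite₂ inferInstance
  obtain ⟨f₃, g₃⟩ := finite_free_int (V := D.V₃) hD.finite₃ inferInstance
  let M := TorsionFreeCubicModule.ofMultilinear D.V₁ D.V₂ D.V₃
  let θ₁ (x : D.V₁) : (M.F.obj (FreeAb.pow 1)).obj :=
    TorsionFreeCubicModule.ofCoords (D.coord₁₁ x) (D.coord₁₂ x) (D.coord₁₃ x)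
  let θ₂ (x : D.V₂) : (M.F.obj (FreeAb.pow 2)).obj :=
    TorsionFreeCubicModule.ofCoords 0 (D.coord₂₂ x) (D.coord₂₃ x)
  let θ₃ (x : D.V₃) : (M.F.obj (FreeAb.pow 3)).obj :=
    TorsionFreeCubicModule.ofCoords 0 0 (D.coord₃₃ x)
  have add₁ (x y : D.V₁) : θ₁ (x + y) = θ₁ x + θ₁ y := by
    refine Eq.trans ?_ TorsionFreeCubicModule.ofCoords_add
    rw [← coord₁₁_add, ← coord₁₂_add, ← coord₁₃_add]
  have add₂ (x y : D.V₂) : θ₂ (x + y) = θ₂ x + θ₂ y := by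
    refine Eq.trans ?_ TorsionFreeCubicModule.ofCoords_add
    rw [← coord₂₂_add, ← coord₂₃_add, add_zero]
  have add₃ (x y : D.V₃) : θ₃ (x + y) = θ₃ x + θ₃ y := by
    refine Eq.trans ?_ TorsionFreeCubicModule.ofCoords_add
    rw [← coord₃₃_add, add_zero, add_zero]
  -- Injectivity needs only torsion freeness: `lin` is 6 on the kernel of `h`, and `bil` is 2 on the
  -- common kernel of `h₁` and `h₂`. The embedding is onto neither factor in general, but this is
  -- harmless.
  have z₁ (x : D.V₁) (hx : D.h x = 0) (hx' : D.lin x = 0) : x = 0 := by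
    rw [lin_apply, hx] at hx'
    simpa using hx'
  have z₂ (x : D.V₂) (h₁ : D.h₁ x = 0) (h₂ : D.h₂ x = 0) (h : D.bil x = 0) : x = 0 := by
    rw [bil_apply, h₁, h₂] at h
    simpa using h
  have i₁ (x : D.V₁) (hx : θ₁ x = 0) : x = 0 := by
    obtain ⟨h₁, h₂, h₃⟩ := TorsionFreeCubicModule.eq_zero_of_ofCoords_eq_zero
      (c₁ := D.coord₁₁ x) (c₂ := D.coord₁₂ x) (c₃ := D.coord₁₃ x) hx
    have h₃' : D.h₁ (D.h x) = 0 := h₃ 0 0 0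
    exact z₁ x (z₂ _ h₃' (by rw [← h₃']; simp) (h₂ 0 0)) (h₁ 0)
  have i₂ (x : D.V₂) (hx : θ₂ x = 0) : x = 0 := by
    obtain ⟨-, h₂, h₃⟩ := TorsionFreeCubicModule.eq_zero_of_ofCoords_eq_zero
      (c₁ := 0) (c₂ := D.coord₂₂ x) (c₃ := D.coord₂₃ x) hx
    exact z₂ x (h₃ 0 0 1) (h₃ 0 1 1) (h₂ 0 1)
  have i₃ (x : D.V₃) (hx : θ₃ x = 0) : x = 0 := by
    obtain ⟨-, -, h₃⟩ := TorsionFreeCubicModule.eq_zero_of_ofCoords_eq_zero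
      (c₁ := 0) (c₂ := 0) (c₃ := D.coord₃₃ x) hx
    exact h₃ 0 1 2
  have m₁ (x : D.V₁) : θ₁ x ∈ crossZ M.F 1 :=
    TorsionFreeCubicModule.ofCoords_mem_crossZ
      (c₁ := D.coord₁₁ x) (c₂ := D.coord₁₂ x) (c₃ := D.coord₁₃ x)
      (fun i h => absurd (fun y => Subsingleton.elim y i) h)
      (fun i j h => absurd (fun y => Or.inl (Subsingleton.elim y i)) h)
      (fun i j l h => absurd (fun y => Or.inl (Subsingleton.elim y i)) h)
  have m₂ (x : D.V₂) : θ₂ x ∈ crossZ M.F 2 :=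
    TorsionFreeCubicModule.ofCoords_mem_crossZ
      (c₁ := 0) (c₂ := D.coord₂₂ x) (c₃ := D.coord₂₃ x)
      (fun _ _ => rfl) (D.coord₂₂_eq_zero x) (D.coord₂₃_eq_zero x)
  have m₃ (x : D.V₃) : θ₃ x ∈ crossZ M.F 3 :=
    TorsionFreeCubicModule.ofCoords_mem_crossZ
      (c₁ := 0) (c₂ := 0) (c₃ := D.coord₃₃ x)
      (fun _ _ => rfl) (fun _ _ _ => rfl) (D.coord₃₃_eq_zero x)
  refine TorsionFreeCubicModule.exists_isomorphic_diagram M D (AddMonoidHom.mk' θ₁ add₁)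
    (AddMonoidHom.mk' θ₂ add₂) (AddMonoidHom.mk' θ₃ add₃) ((injective_iff_map_eq_zero _).2 i₁)
    ((injective_iff_map_eq_zero _).2 i₂) ((injective_iff_map_eq_zero _).2 i₃) m₁ m₂ m₃
    ?_ ?_ ?_ ?_ ?_ ?_
  · exact fun x => TorsionFreeCubicModule.crossDown_ofCoords
      (c₁ := D.coord₁₁ x) (c₂ := D.coord₁₂ x) (c₃ := D.coord₁₃ x)
      (e₁ := 0) (e₂ := D.coord₂₂ (D.h x)) (e₃ := D.coord₂₃ (D.h x))
      (fun i => (if_neg (by revert i; decide)).symm) (D.coord₂₂_h x) (D.coord₂₃_h x)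
  · exact fun x => TorsionFreeCubicModule.crossUp_ofCoords
      (c₁ := 0) (c₂ := D.coord₂₂ x) (c₃ := D.coord₂₃ x)
      (e₁ := D.coord₁₁ (D.p x)) (e₂ := D.coord₁₂ (D.p x)) (e₃ := D.coord₁₃ (D.p x))
      (fun i => by simp [coord₁₁]) (D.coord₁₂_p x) (D.coord₁₃_p x)
  · exact fun x => TorsionFreeCubicModule.crossDown_ofCoords
      (c₁ := 0) (c₂ := D.coord₂₂ x) (c₃ := D.coord₂₃ x)
      (e₁ := 0) (e₂ := 0) (e₃ := D.coord₃₃ (D.h₁ x))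
      (fun i => by simp) (fun i j => (if_neg (by revert i j; decide)).symm) (D.coord₃₃_h₁ x)
  · exact fun x => TorsionFreeCubicModule.crossDown_ofCoords
      (c₁ := 0) (c₂ := D.coord₂₂ x) (c₃ := D.coord₂₃ x)
      (e₁ := 0) (e₂ := 0) (e₃ := D.coord₃₃ (D.h₂ x))
      (fun i => by simp) (fun i j => (if_neg (by revert i j; decide)).symm) (D.coord₃₃_h₂ x)
  · exact fun x => TorsionFreeCubicModule.crossUp_ofCoords
      (c₁ := 0) (c₂ := 0) (c₃ := D.coord₃₃ x)
      (e₁ := 0) (e₂ := D.coord₂₂ (D.p₁ x)) (e₃ := D.coord₂₃ (D.p₁ x))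
      (fun i => by simp) (fun i j => by simp [D.coord₂₂_p₁]) (D.coord₂₃_p₁ x)
  · exact fun x => TorsionFreeCubicModule.crossUp_ofCoords
      (c₁ := 0) (c₂ := 0) (c₃ := D.coord₃₃ x)
      (e₁ := 0) (e₂ := D.coord₂₂ (D.p₂ x)) (e₃ := D.coord₂₃ (D.p₂ x))
      (fun i => by simp) (fun i j => by simp [D.coord₂₂_p₂]) (D.coord₂₃_p₂ x)

end CubicDiagram
end

noncomputable section

/-! ### The classification of torsion free cubic modules -/

namespace TorsionFreeCubicModule

variable (M N : TorsionFreeCubicModule)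

theorem localization_isTorsionFreeAModule (p : ℕ) [Fact p.Prime] :
    (M.localization p).IsTorsionFreeAModule :=
  M.diagram_isTorsionFreeAModule.tensor (ZLoc p)

theorem tensor_rat_isomorphic (p : ℕ) [Fact p.Prime] :
    (M.diagram.tensor ℚ).Isomorphic ((M.localization p).tensor ℚ) := by
  have := charZero_zLoc p
  exact CubicDiagram.tensor_tensor_rat_isomorphic (ZLoc p) (Ideal.span {(p : ℤ)}).primeCompl
    (CubicDiagram.zero_notMem_primeCompl p) M.diagram_isTorsionFreeAModule

variable {M N}

theorem Isomorphic.localization (h : M.Isomorphic N) (p : ℕ) [Fact p.Prime] :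
    (M.localization p).Isomorphic (N.localization p) :=
  h.diagram.tensor (ZLoc p)

theorem isomorphic_of_localization (h₂ : (M.localization 2).Isomorphic (N.localization 2))
    (h₃ : (M.localization 3).Isomorphic (N.localization 3)) : M.Isomorphic N :=
  isomorphic_of_diagram (CubicDiagram.isomorphic_of_zLoc M.diagram_isTorsionFreeAModule
    N.diagram_isTorsionFreeAModule h₂ h₃)

end TorsionFreeCubicModule

theorem mainTheorem6 :
    (∀ M : TorsionFreeCubicModule,
      (M.localization 2).IsTorsionFreeAModule ∧ (M.localization 3).IsTorsionFreeAModule ∧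
        ((M.localization 2).tensor ℚ).Isomorphic ((M.localization 3).tensor ℚ)) ∧
    (∀ M N : TorsionFreeCubicModule, M.Isomorphic N ↔
      (M.localization 2).Isomorphic (N.localization 2) ∧
        (M.localization 3).Isomorphic (N.localization 3)) ∧
    (∀ (M₂ : CubicDiagram (ZLoc 2)) (M₃ : CubicDiagram (ZLoc 3)),
      M₂.IsTorsionFreeAModule → M₃.IsTorsionFreeAModule →
      (M₂.tensor ℚ).Isomorphic (M₃.tensor ℚ) →
      ∃ M : TorsionFreeCubicModule,
        (M.localization 2).Isomorphic M₂ ∧ (M.localization 3).Isomorphic M₃) ∧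
    (∀ M N : TorsionFreeCubicModule, M.SameGenus N ↔ M.Isomorphic N) := by
  refine ⟨fun M => ⟨M.localization_isTorsionFreeAModule 2, M.localization_isTorsionFreeAModule 3,
      (M.tensor_rat_isomorphic 2).symm.trans (M.tensor_rat_isomorphic 3)⟩,
    fun M N => ⟨fun h => ⟨h.localization 2, h.localization 3⟩,
      fun h => TorsionFreeCubicModule.isomorphic_of_localization h.1 h.2⟩,
    fun M₂ M₃ h₂ h₃ h => ?_,
    fun M N => ⟨fun h => TorsionFreeCubicModule.isomorphic_of_localization (h 2) (h 3),
      fun h p _ => h.localization p⟩⟩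
  obtain ⟨D, hD, i₂, i₃⟩ := CubicDiagram.exists_tensor_zLoc_isomorphic h₂ h₃ h
  obtain ⟨M, i⟩ := hD.exists_isomorphic_diagram
  exact ⟨M, (i.symm.tensor (ZLoc 2)).trans i₂, (i.symm.tensor (ZLoc 3)).trans i₃⟩

end
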